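/- Let $M$ be a smooth $n$-manifold with a standard $T^k$-action: a smooth action such that every orbit has an invariant open neighbourhood which, after a change of generators of $T^k$, is equivariantly diffeomorphic to some $T^{k-l}\times\mathbb{C}^l\times\mathbb{R}^m$, where $T^{k-l}$ acts by translations on $T^{k-l}$, $T^l$ acts by the standard rotations on $\mathbb{C}^l$, and the action on $\mathbb{R}^m$ is trivial. Let $\pi: M\to B=M/T^k$ be the quotient map. $B$ is a manifold with corners, with $C^\infty(B)=\{f:\pi^*f\in C^\infty(M)\}$ and local boundary coordinates $t_j=|z_j|^2$. Let $\partial B[i]$ be the set of points of $B$ where exactly $i$ boundary coordinates vanish, let $I_{\partial B}\subset C^\infty(B)$ be the ideal of functions vanishing on $\partial B=\bigcup_{i\ge1}\partial B[i]$, and let $I_{|D|}=\pi^*I_{\partial B}\cdot C^\infty(M)$ be the associated elliptic divisor. Let $\mathcal{A}_{\partial B}\to B$ and $\mathcal{A}_{|D|}\to M$ be the Lie algebroids whose sections are the vector fields preserving $I_{\partial B}$ and $I_{|D|}$, respectively, and let $\rho:\mathcal{A}_{\partial B}\to TB$ be the anchor (the inclusion on sections). Let $\Theta\in\Omega^1(\mathcal{A}_{|D|};\mathfrak{t}^k)$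 be a connection one-form, i.e. $\Theta$ is $T^k$-invariant and $\Theta(\tilde a(v))=v$ for all $v\in\mathfrak{t}^k$, where $\tilde a(v)$ is the fundamental vector field of $v$, viewed as a section of $\mathcal{A}_{|D|}$. Let $K\in\Omega^2(\mathcal{A}_{\partial B};\mathfrak{t}^k)$ be its curvature, i.e. the form with $\pi^*K=d\Theta$. Then $K$ is closed and there is a closed smooth form $\tilde K\in\Omega^2(B;\mathfrak{t}^k)$ such that $$[\rho^*\tilde K]=[K]\in H^2(\mathcal{A}_{\partial B};\mathfrak{t}^k).$$ Moreover, the residues of $K$ vanish in cohomology: the one-form $\mathrm{Res}^1(K)=(\iota_{t\partial_t}K)|_{\partial B[1]}$ on $\partial B[1]$ is exact, and the function $\mathrm{Res}^2(K)=K(t_1\partial_{t_1},t_2\partial_{t_2})$, defined up to sign on $\partial B[2]$, vanishes identically. (A two-form has no further residues.) -/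

import Mathlib

open scoped Manifold ContDiff Topology

noncomputable section

/-! ### Derivations preserving an ideal, and their de Rham complex

For `R = C^∞(N)` and a (real log or elliptic) divisor `I`, the sections of the associated Lie
algebroid `𝒜_I` are the vector fields preserving `I`; the Lie bracket is the commutator and the
anchor is the inclusion into all vector fields. For `I = ⊤` (empty vanishing locus) this is the
tangent bundle. Lie algebroid `p`-forms with values in `ℝ^k` are the alternating `C^∞`-multilinear
maps from sections of `𝒜_I` to `ℝ^k`-valued smooth functions. -/

namespace LogForms

section Algebra

variable {R : Type*} [CommRing R] [Algebra ℝ R]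

/-- Sections of the Lie algebroid `𝒜_I`: the derivations of `R` which preserve the ideal `I`. -/
def logDer (I : Ideal R) : Submodule R (Derivation ℝ R R) where
  carrier := {X | ∀ f ∈ I, X f ∈ I}
  add_mem' := fun hX hY f hf => I.add_mem (hX f hf) (hY f hf)
  zero_mem' := fun _ _ => I.zero_mem
  smul_mem' := fun r _ hX f hf => I.mul_mem_left r (hX f hf)

/-- The Lie bracket on sections of `𝒜_I`: the commutator of derivations. -/
def bracket {I : Ideal R} (X Y : logDer I) : logDer I :=
  ⟨⁅X.1, Y.1⁆, fun f hf => by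
    rw [Derivation.commutator_apply]
    exact I.sub_mem (X.2 _ (Y.2 f hf)) (Y.2 _ (X.2 f hf))⟩

/-- The action of a derivation on `ℝ^k`-valued functions, componentwise. -/
def act {k : ℕ} (X : Derivation ℝ R R) (v : Fin k → R) : Fin k → R := fun i => X (v i)

/-- Lie algebroid one-forms on `𝒜_I` with values in `ℝ^k`. -/
abbrev OneForm (I : Ideal R) (k : ℕ) := logDer I →ₗ[R] (Fin k → R)

/-- Lie algebroid two-forms on `𝒜_I` with values in `ℝ^k`. -/
abbrev TwoForm (I : Ideal R) (k : ℕ) := logDer I [⋀^Fin 2]→ₗ[R] (Fin k → R)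

/-- Lie algebroid three-forms on `𝒜_I` with values in `ℝ^k`. -/
abbrev ThreeForm (I : Ideal R) (k : ℕ) := logDer I [⋀^Fin 3]→ₗ[R] (Fin k → R)

variable {I : Ideal R} {k : ℕ}

theorem act_add (X : Derivation ℝ R R) (v w : Fin k → R) : act X (v + w) = act X v + act X w := by
  ext i; simp [act]

theorem act_smul (X : Derivation ℝ R R) (r : R) (v : Fin k → R) :
    act X (r • v) = r • act X v + X r • v := by
  ext i; simp [act, mul_comm]

theorem act_real_smul (X : Derivation ℝ R R) (r : ℝ) (v : Fin k → R) :
    act X (r • v) = r • act X v := by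
  ext i; simp [act]

theorem act_neg (X : Derivation ℝ R R) (v : Fin k → R) : act X (-v) = -act X v := by
  ext i; simp [act]

theorem act_zero (X : Derivation ℝ R R) : act X (0 : Fin k → R) = 0 := by
  ext i; simp [act]

theorem add_act (X Y : Derivation ℝ R R) (v : Fin k → R) : act (X + Y) v = act X v + act Y v := by
  ext i; simp [act]

theorem smul_act (X : Derivation ℝ R R) (r : R) (v : Fin k → R) : act (r • X) v = r • act X v := by
  ext i; simp [act]

theorem bracket_add (X Y Z : logDer I) : bracket X (Y + Z) = bracket X Y + bracket X Z :=
  Subtype.ext (lie_add X.1 Y.1 Z.1)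

theorem add_bracket (X Y Z : logDer I) : bracket (X + Y) Z = bracket X Z + bracket Y Z :=
  Subtype.ext (add_lie X.1 Y.1 Z.1)

theorem bracket_self (X : logDer I) : bracket X X = 0 := Subtype.ext (lie_self X.1)

theorem bracket_skew (X Y : logDer I) : bracket X Y = -bracket Y X :=
  Subtype.ext (lie_skew X.1 Y.1).symm

theorem bracket_smul (X Y : logDer I) (r : R) :
    bracket X (r • Y) = r • bracket X Y + X.1 r • Y := by
  ext f
  simp only [bracket, Submodule.coe_add, Submodule.coe_smul, Derivation.commutator_apply,
    Derivation.add_apply, Derivation.smul_apply, Derivation.leibniz, smul_eq_mul]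
  ring

theorem smul_bracket (X Y : logDer I) (r : R) :
    bracket (r • X) Y = r • bracket X Y - Y.1 r • X := by
  rw [bracket_skew, bracket_smul, bracket_skew Y X, smul_neg]
  abel

theorem upd_zero {L : Type*} (X Y Z : L) : Function.update ![X, Y] 0 Z = ![Z, Y] := by
  ext i; fin_cases i <;> rfl

theorem upd_one {L : Type*} (X Y Z : L) : Function.update ![X, Y] 1 Z = ![X, Z] := by
  ext i; fin_cases i <;> rfl

theorem two_add_left (β : TwoForm I k) (X X' Y : logDer I) :
    β ![X + X', Y] = β ![X, Y] + β ![X', Y] := by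
  have h := β.map_update_add ![X, Y] 0 X X'
  simpa only [upd_zero] using h

theorem two_smul_left (β : TwoForm I k) (r : R) (X Y : logDer I) :
    β ![r • X, Y] = r • β ![X, Y] := by
  have h := β.map_update_smul ![X, Y] 0 r X
  simpa only [upd_zero] using h

theorem two_self (β : TwoForm I k) (X : logDer I) : β ![X, X] = 0 :=
  β.map_eq_zero_of_eq ![X, X] (i := 0) (j := 1) rfl (by decide)

theorem two_swap (β : TwoForm I k) (X Y : logDer I) : β ![X, Y] = -β ![Y, X] := by
  have h := two_self β (X + Y)
  have e : β ![X + Y, X + Y] = β ![X, X] + β ![X, Y] + (β ![Y, X] + β ![Y, Y]) := by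
    have r : ∀ Z, β ![Z, X + Y] = β ![Z, X] + β ![Z, Y] := fun Z => by
      have h := β.map_update_add ![Z, X] 1 X Y
      simpa only [upd_one] using h
    rw [two_add_left, r, r]
  rw [e, two_self, two_self, zero_add, add_zero] at h
  exact eq_neg_of_add_eq_zero_left h

theorem two_add_right (β : TwoForm I k) (X Y Y' : logDer I) :
    β ![X, Y + Y'] = β ![X, Y] + β ![X, Y'] := by
  have h := β.map_update_add ![X, Y] 1 Y Y'
  simpa only [upd_one] using h

theorem two_neg_left (β : TwoForm I k) (X Y : logDer I) : β ![-X, Y] = -β ![X, Y] := by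
  have h := two_smul_left β (-1 : R) X Y
  rw [show (-1 : R) • X = -X from neg_one_smul R X] at h
  rw [h]
  exact neg_one_smul R _

theorem two_sub_left (β : TwoForm I k) (X X' Y : logDer I) :
    β ![X - X', Y] = β ![X, Y] - β ![X', Y] := by
  rw [sub_eq_add_neg, two_add_left, two_neg_left, sub_eq_add_neg]

theorem two_zero_left (β : TwoForm I k) (Y : logDer I) : β ![0, Y] = 0 := by
  simpa using two_smul_left β (0 : R) 0 Y

theorem two_smul_right (β : TwoForm I k) (r : R) (X Y : logDer I) :
    β ![X, r • Y] = r • β ![X, Y] := by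
  have h := β.map_update_smul ![X, Y] 1 r Y
  simpa only [upd_one] using h

/-- The differential of functions: `(d f)(X) = X f`. -/
def dZero (I : Ideal R) (f : Fin k → R) : OneForm I k where
  toFun X := act X.1 f
  map_add' X Y := add_act X.1 Y.1 f
  map_smul' r X := smul_act X.1 r f

/-- The differential of one-forms, `(dα)(X, Y) = X(α(Y)) - Y(α(X)) - α([X, Y])`. -/
def dOneAux (α : OneForm I k) : TwoForm I k where
  toFun v := act (v 0).1 (α (v 1)) - act (v 1).1 (α (v 0)) - α (bracket (v 0) (v 1))
  map_update_add' := by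
    intro inst v i X Y
    obtain rfl : inst = instDecidableEqFin 2 := Subsingleton.elim _ _
    fin_cases i <;>
    · simp [act_add, add_act, add_bracket, bracket_add]
      abel
  map_update_smul' := by
    intro inst v i r X
    obtain rfl : inst = instDecidableEqFin 2 := Subsingleton.elim _ _
    fin_cases i <;>
    · simp only [Fin.zero_eta, Fin.mk_one, Function.update_self, ne_eq, one_ne_zero, zero_ne_one,
        not_false_eq_true, Function.update_of_ne, map_smul, act_smul, smul_act, smul_bracket,
        bracket_smul, Submodule.coe_smul, map_add, map_sub, smul_sub]
      abel
  map_eq_zero_of_eq' := by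
    intro v i j h hij
    have h' : v 0 = v 1 := by
      fin_cases i <;> fin_cases j <;> simp_all
    simp [h', bracket_self]

/-- The differential from one-forms to two-forms. -/
def dOne (I : Ideal R) (k : ℕ) : OneForm I k →ₗ[ℝ] TwoForm I k where
  toFun := dOneAux
  map_add' α β := by
    ext v i
    simp [dOneAux, act_add]
    abel
  map_smul' r α := by
    ext v i
    simp [dOneAux, act_real_smul, smul_sub]

/-- The differential of two-forms,
`(dβ)(X, Y, Z) = X(β(Y, Z)) - Y(β(X, Z)) + Z(β(X, Y)) - β([X, Y], Z) + β([X, Z], Y) - β([Y, Z], X)`.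
-/
def dTwoAux (β : TwoForm I k) : ThreeForm I k where
  toFun v := act (v 0).1 (β ![v 1, v 2]) - act (v 1).1 (β ![v 0, v 2]) + act (v 2).1 (β ![v 0, v 1])
    - β ![bracket (v 0) (v 1), v 2] + β ![bracket (v 0) (v 2), v 1] - β ![bracket (v 1) (v 2), v 0]
  map_update_add' := by
    intro inst v i X Y
    obtain rfl : inst = instDecidableEqFin 3 := Subsingleton.elim _ _
    fin_cases i <;>
    · simp [act_add, add_act, add_bracket, bracket_add, two_add_left, two_add_right,
        Function.update]
      abel
  map_update_smul' := by
    intro inst v i r X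
    obtain rfl : inst = instDecidableEqFin 3 := Subsingleton.elim _ _
    fin_cases i
    · simp [act_smul, smul_act, smul_bracket, two_smul_left, two_smul_right,
        two_sub_left, Function.update]
      module
    · simp [act_smul, smul_act, smul_bracket, bracket_smul, two_smul_left, two_smul_right,
        two_add_left, two_sub_left, Function.update]
      rw [two_swap β X (v 0)]
      module
    · simp [act_smul, smul_act, bracket_smul, two_smul_left, two_smul_right,
        two_add_left, Function.update]
      rw [two_swap β X (v 0), two_swap β X (v 1)]
      module
  map_eq_zero_of_eq' := by
    intro v i j h hij
    have key : v 0 = v 1 ∨ v 0 = v 2 ∨ v 1 = v 2 := by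
      fin_cases i <;> fin_cases j <;> simp_all
    rcases key with h | h | h
    · simp [h, bracket_self, two_self, two_zero_left, act_zero]
    · simp only [h, bracket_self, two_self, two_zero_left, act_zero]
      rw [two_swap β (v 1) (v 2), act_neg, bracket_skew (v 2) (v 1), two_neg_left]
      abel
    · simp [h, bracket_self, two_self, two_zero_left, act_zero]

/-- The differential from two-forms to three-forms. -/
def dTwo (I : Ideal R) (k : ℕ) : TwoForm I k →ₗ[ℝ] ThreeForm I k where
  toFun := dTwoAux
  map_add' α β := by
    ext v i
    simp [dTwoAux, act_add]
    abel
  map_smul' r α := by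
    ext v i
    simp [dTwoAux, act_real_smul, smul_sub, smul_add]

theorem bracket_jacobi (X Y Z : logDer I) :
    bracket (bracket X Y) Z = bracket X (bracket Y Z) - bracket Y (bracket X Z) :=
  Subtype.ext (lie_lie X.1 Y.1 Z.1)

theorem dTwo_dOne (α : OneForm I k) : dTwo I k (dOne I k α) = 0 := by
  ext v i
  have e : ∀ (X Y : logDer I) (i), dOneAux α ![X, Y] i =
      X.1 (α Y i) - Y.1 (α X i) - α (bracket X Y) i := fun X Y i => rfl
  have j := congrArg (fun W => α W i) (bracket_jacobi (v 0) (v 1) (v 2))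
  have s1 := congrArg (fun W => α W i) (bracket_skew (bracket (v 0) (v 2)) (v 1))
  have s2 := congrArg (fun W => α W i) (bracket_skew (bracket (v 1) (v 2)) (v 0))
  simp only [map_sub, map_neg, Pi.sub_apply, Pi.neg_apply] at j s1 s2
  simp only [dTwo, dOne, LinearMap.coe_mk, AddHom.coe_mk, dTwoAux, AlternatingMap.coe_mk,
    MultilinearMap.coe_mk, Pi.sub_apply, Pi.add_apply, act, e, map_sub, AlternatingMap.zero_apply,
    Pi.zero_apply]
  have b : ∀ (X Y : logDer I) f, (bracket X Y).1 f = X.1 (Y.1 f) - Y.1 (X.1 f) :=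
    fun X Y f => Derivation.commutator_apply ..
  simp only [b]
  rw [s1, s2, j]
  ring

/-- The cohomology `ker d₂ / im d₁` of `V₁ → V₂ → V₃` at `V₂`. -/
abbrev Cohomology {V₁ V₂ V₃ : Type*} [AddCommGroup V₁] [Module ℝ V₁] [AddCommGroup V₂] [Module ℝ V₂]
    [AddCommGroup V₃] [Module ℝ V₃] (d₁ : V₁ →ₗ[ℝ] V₂) (d₂ : V₂ →ₗ[ℝ] V₃) :=
  LinearMap.ker d₂ ⧸ (LinearMap.range d₁).comap (LinearMap.ker d₂).subtype

/-- Closed two-forms. -/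
abbrev ClosedTwoForm (I : Ideal R) (k : ℕ) : Submodule ℝ (TwoForm I k) := LinearMap.ker (dTwo I k)

/-- The Lie algebroid cohomology `H²(𝒜_I; ℝ^k)`: closed two-forms modulo exact two-forms. -/
abbrev HTwo (I : Ideal R) (k : ℕ) := Cohomology (dOne I k) (dTwo I k)

/-- The cohomology class of a closed two-form. -/
def cohomologyClass (β : ClosedTwoForm I k) : HTwo I k := Submodule.Quotient.mk β

theorem cohomologyClass_eq_iff (α β : ClosedTwoForm I k) :
    cohomologyClass α = cohomologyClass β ↔ ∃ η : OneForm I k, dOne I k η = α.1 - β.1 := by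
  unfold cohomologyClass
  rw [Submodule.Quotient.eq]
  rfl

/-- The anchor of `𝒜_I`, with values in all derivations. -/
def anchor (I : Ideal R) : logDer I →ₗ[R] logDer (⊤ : Ideal R) :=
  Submodule.inclusion fun _ _ _ _ => Submodule.mem_top

/-- The pull-back `ρ^*` of smooth two-forms along the anchor. -/
def anchorPullback (I : Ideal R) (β : TwoForm (⊤ : Ideal R) k) : TwoForm I k :=
  β.compLinearMap (anchor I)

theorem anchorPullback_closed (I : Ideal R) (β : ClosedTwoForm (⊤ : Ideal R) k) :
    anchorPullback I β.1 ∈ ClosedTwoForm I k := by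
  have h := β.2
  rw [LinearMap.mem_ker] at h ⊢
  ext1 v
  have h' := congrArg (fun η : ThreeForm (⊤ : Ideal R) k => η (fun i => anchor I (v i))) h
  have e : ∀ X Y : logDer I, anchorPullback I β.1 ![X, Y] = β.1 ![anchor I X, anchor I Y] := by
    intro X Y
    simp only [anchorPullback, AlternatingMap.compLinearMap_apply]
    congr 1
    ext i : 1
    fin_cases i <;> rfl
  simp only [dTwo, LinearMap.coe_mk, AddHom.coe_mk, dTwoAux, AlternatingMap.coe_mk,
    MultilinearMap.coe_mk, AlternatingMap.zero_apply, e] at h' ⊢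
  exact h'

variable {S : Type*} [CommRing S] [Algebra ℝ S] {J : Ideal S}

/-- For the pull-back of functions `φ = π^*` along a smooth map `π`, the vector fields `X` upstairs
and `Y` downstairs are `π`-related. -/
def Related (φ : R →ₐ[ℝ] S) (X : Derivation ℝ S S) (Y : Derivation ℝ R R) : Prop :=
  ∀ f, X (φ f) = φ (Y f)

/-- `α' = φ^* α` for one-forms: the two agree on related sections. (The maps `𝒜_J → 𝒜_I` to which
this is applied are submersions, so that related sections span every fibre.) -/
def IsPullbackOne (φ : R →ₐ[ℝ] S) (α : OneForm I k) (α' : OneForm J k) : Prop :=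
  ∀ (X : logDer J) (Y : logDer I), Related φ X.1 Y.1 → ∀ i, α' X i = φ (α Y i)

/-- `β' = φ^* β` for two-forms: the two agree on related sections. -/
def IsPullbackTwo (φ : R →ₐ[ℝ] S) (β : TwoForm I k) (β' : TwoForm J k) : Prop :=
  ∀ (X₁ X₂ : logDer J) (Y₁ Y₂ : logDer I), Related φ X₁.1 Y₁.1 → Related φ X₂.1 Y₂.1 →
    ∀ i, β' ![X₁, X₂] i = φ (β ![Y₁, Y₂] i)

end Algebra

end LogForms

/-! ### Standard torus actions -/

namespace TorusAction

open LogForms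

/-- The torus `T^k`; its Lie algebra is `ℝ^k`, with exponential map `torusExp`. -/
abbrev Torus (k : ℕ) := Fin k → Circle

/-- The exponential map `ℝ^k → T^k`, `v ↦ (e^{i v₁}, …, e^{i v_k})`. -/
def torusExp {k : ℕ} (v : Fin k → ℝ) : Torus k := fun i => Circle.exp (v i)

theorem torusExp_surjective {k : ℕ} : Function.Surjective (torusExp (k := k)) := fun g =>
  ⟨fun i => (g i : ℂ).arg, funext fun i => Circle.exp_arg (g i)⟩

/-- The action map `T^k × M → M` is smooth, i.e. smooth after composition with the surjective local
diffeomorphism `ℝ^k × M → T^k × M` given by the exponential map. -/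
class SmoothTorusAction (n k : ℕ) (M : Type*) [TopologicalSpace M]
    [ChartedSpace (EuclideanSpace ℝ (Fin n)) M] [MulAction (Torus k) M] : Prop where
  contMDiff_action : ContMDiff (𝓘(ℝ, Fin k → ℝ).prod (𝓡 n)) (𝓡 n) ∞
    fun p : (Fin k → ℝ) × M => torusExp p.1 • p.2

variable (n k : ℕ) (M : Type*) [TopologicalSpace M] [ChartedSpace (EuclideanSpace ℝ (Fin n)) M]
  [MulAction (Torus k) M]

/-- An equivariant diffeomorphism `(w, z, x)` from an invariant open subset `source` of `M` onto
the model `T^a × ℂ^l × ℝ^m`. After the change of generators `T^k ≃ T^a × T^l` (so `a = k - l`), the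
action on the model is by translations on `T^a`, by the standard rotations on `ℂ^l`, and trivial on
`ℝ^m`. -/
structure StandardChart (a l m : ℕ) where
  generators : Torus k ≃ₜ* Torus a × Torus l
  source : Set M
  isOpen_source : IsOpen source
  smul_mem : ∀ (g : Torus k), ∀ y ∈ source, g • y ∈ source
  w : M → Torus a
  z : M → Fin l → ℂ
  x : M → Fin m → ℝ
  inv : Torus a → (Fin l → ℂ) → (Fin m → ℝ) → M
  inv_mem : ∀ w' z' x', inv w' z' x' ∈ source
  left_inv : ∀ y ∈ source, inv (w y) (z y) (x y) = y
  w_inv : ∀ w' z' x', w (inv w' z' x') = w'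
  z_inv : ∀ w' z' x', z (inv w' z' x') = z'
  x_inv : ∀ w' z' x', x (inv w' z' x') = x'
  contMDiffOn_w : ∀ i, ContMDiffOn (𝓡 n) (𝓡 1) ∞ (fun y => w y i) source
  contMDiffOn_z : ContMDiffOn (𝓡 n) 𝓘(ℝ, Fin l → ℂ) ∞ z source
  contMDiffOn_x : ContMDiffOn (𝓡 n) 𝓘(ℝ, Fin m → ℝ) ∞ x source
  /-- The inverse is smooth, stated on the universal cover `ℝ^a` of `T^a`. -/
  contMDiff_inv : ContMDiff 𝓘(ℝ, (Fin a → ℝ) × (Fin l → ℂ) × (Fin m → ℝ)) (𝓡 n) ∞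
    fun p : (Fin a → ℝ) × (Fin l → ℂ) × (Fin m → ℝ) => inv (torusExp p.1) p.2.1 p.2.2
  w_smul : ∀ (g : Torus k), ∀ y ∈ source, w (g • y) = (generators g).1 * w y
  z_smul : ∀ (g : Torus k), ∀ y ∈ source, z (g • y) = fun j => ((generators g).2 j : ℂ) * z y j
  x_smul : ∀ (g : Torus k), ∀ y ∈ source, x (g • y) = x y

/-- The `T^k`-action on `M` is standard: each orbit has an invariant open neighbourhood which is
equivariantly diffeomorphic to some `T^{k-l} × ℂ^l × ℝ^m`. -/
def IsStandard : Prop :=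
  ∀ p : M, ∃ (a l m : ℕ) (c : StandardChart n k M a l m), p ∈ c.source

/-- The quotient `B = M / T^k`, with the quotient topology. -/
abbrev OrbitSpace := Quotient (MulAction.orbitRel (Torus k) M)

variable {k M} in
/-- The quotient map `π : M → B`. -/
def orbitMap (p : M) : OrbitSpace k M := Quotient.mk _ p

/-- `C^∞(B)`: the functions on `B` whose pull-back to `M` is smooth. -/
def smoothFunctions : Subalgebra ℝ (OrbitSpace k M → ℝ) where
  carrier := {f | ContMDiff (𝓡 n) 𝓘(ℝ) ∞ fun p : M => f (orbitMap p)}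
  mul_mem' := fun hf hg => hf.mul hg
  add_mem' := fun hf hg => hf.add hg
  algebraMap_mem' := fun _ => contMDiff_const

/-- The pull-back `π^* : C^∞(B) → C^∞(M)`. -/
def quotientPullback : smoothFunctions n k M →ₐ[ℝ] C^∞⟮𝓡 n, M; ℝ⟯ where
  toFun f := ⟨fun p => f.1 (orbitMap p), f.2⟩
  map_one' := rfl
  map_mul' _ _ := rfl
  map_zero' := rfl
  map_add' _ _ := rfl
  commutes' _ := rfl

/-- The points of `B` of multiplicity `i`, i.e. the open codimension `i` stratum `∂B[i]`: the orbits
where, in a standard chart with exactly `i` complex coordinates, all of these vanish. -/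
def stratum (i : ℕ) : Set (OrbitSpace k M) :=
  {b | ∃ (a m : ℕ) (c : StandardChart n k M a i m), ∃ p ∈ c.source, orbitMap p = b ∧ c.z p = 0}

/-- The boundary `∂B` of the manifold with corners `B`: the points of positive multiplicity. -/
def boundary : Set (OrbitSpace k M) := ⋃ i ≥ 1, stratum n k M i

/-- The divisor `I_{∂B}` of the boundary: the ideal of smooth functions vanishing on `∂B`. It is
locally generated by the product `|z₁|² ⋯ |z_l|²` of the boundary coordinates. -/
def boundaryIdeal : Ideal (smoothFunctions n k M) where
  carrier := {f | ∀ b ∈ boundary n k M, f.1 b = 0}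
  add_mem' := fun {f g} hf hg b hb => by simp [hf b hb, hg b hb]
  zero_mem' := fun _ _ => rfl
  smul_mem' := fun f g hg b hb => by simp [hg b hb]

/-- The elliptic divisor `I_{|D|} = π^* I_{∂B}`: the ideal of `C^∞(M)` generated by the pull-backs
of the elements of `I_{∂B}`. -/
def ellipticIdeal : Ideal C^∞⟮𝓡 n, M; ℝ⟯ := (boundaryIdeal n k M).map (quotientPullback n k M)

section Action

variable [SmoothTorusAction n k M]

theorem contMDiff_smul (g : Torus k) : ContMDiff (𝓡 n) (𝓡 n) ∞ fun p : M => g • p := by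
  obtain ⟨v, rfl⟩ := torusExp_surjective g
  exact (SmoothTorusAction.contMDiff_action (n := n) (k := k) (M := M)).comp
    (contMDiff_const.prodMk contMDiff_id)

variable {k} in
/-- The pull-back `m_g^*` of functions along the action `m_g` of `g`. -/
def translate (g : Torus k) : C^∞⟮𝓡 n, M; ℝ⟯ →ₐ[ℝ] C^∞⟮𝓡 n, M; ℝ⟯ where
  toFun f := ⟨fun p => f (g • p), f.contMDiff.comp (contMDiff_smul n k M g)⟩
  map_one' := rfl
  map_mul' _ _ := rfl
  map_zero' := rfl
  map_add' _ _ := rfl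
  commutes' _ := rfl

theorem contMDiff_curve (v : Fin k → ℝ) (f : C^∞⟮𝓡 n, M; ℝ⟯) :
    ContMDiff ((𝓡 n).prod 𝓘(ℝ)) 𝓘(ℝ) ∞ fun q : M × ℝ => f (torusExp (q.2 • v) • q.1) := by
  refine f.contMDiff.comp ((SmoothTorusAction.contMDiff_action (n := n) (k := k) (M := M)).comp
    (ContMDiff.prodMk ?_ contMDiff_fst))
  exact (contDiff_id.smul contDiff_const).contMDiff.comp contMDiff_snd

theorem differentiableAt_curve (v : Fin k → ℝ) (f : C^∞⟮𝓡 n, M; ℝ⟯) (p : M) :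
    DifferentiableAt ℝ (fun s : ℝ => f (torusExp (s • v) • p)) 0 := by
  have h : ContMDiff 𝓘(ℝ) 𝓘(ℝ) ∞ fun s : ℝ => f (torusExp (s • v) • p) :=
    (contMDiff_curve n k M v f).comp (contMDiff_const.prodMk contMDiff_id)
  exact (h.contDiff.differentiable (by simp)).differentiableAt

variable [IsManifold (𝓡 n) ∞ M]

theorem contMDiff_deriv_curve (v : Fin k → ℝ) (f : C^∞⟮𝓡 n, M; ℝ⟯) :
    ContMDiff (𝓡 n) 𝓘(ℝ) ∞ fun p : M => deriv (fun s : ℝ => f (torusExp (s • v) • p)) 0 := by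
  intro p
  have h := ContMDiffAt.mfderiv (I := 𝓘(ℝ)) (I' := 𝓘(ℝ)) (J := 𝓡 n) (m := ∞) (n := ∞) (x₀ := p)
    (fun (q : M) (s : ℝ) => f (torusExp (s • v) • q)) (fun _ => (0 : ℝ))
    (contMDiff_curve n k M v f).contMDiffAt contMDiffAt_const (by simp)
  erw [inTangentCoordinates_model_space] at h
  have h' := h.clm_apply (contMDiffAt_const (c := (1 : ℝ)))
  refine h'.congr_of_eventuallyEq (Filter.Eventually.of_forall fun q => ?_)
  simp only [mfderiv_eq_fderiv]
  rfl

/-- The fundamental vector field of `v ∈ 𝔱^k`: `(X_v f)(p) = d/ds|₀ f(exp(s v) • p)`. -/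
def fundamentalField (v : Fin k → ℝ) :
    Derivation ℝ C^∞⟮𝓡 n, M; ℝ⟯ C^∞⟮𝓡 n, M; ℝ⟯ := by
  refine Derivation.mk'
    { toFun := fun f => ⟨fun p => deriv (fun s : ℝ => f (torusExp (s • v) • p)) 0,
        contMDiff_deriv_curve n k M v f⟩
      map_add' := ?_
      map_smul' := ?_ } ?_
  · intro f g
    ext p
    exact deriv_add (differentiableAt_curve n k M v f p) (differentiableAt_curve n k M v g p)
  · intro r f
    ext p
    exact deriv_const_mul r (differentiableAt_curve n k M v f p)
  · intro f g
    ext p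
    have h := deriv_mul (differentiableAt_curve n k M v f p) (differentiableAt_curve n k M v g p)
    have e : torusExp ((0 : ℝ) • v) • p = p := by
      have e' : torusExp ((0 : ℝ) • v) = (1 : Torus k) := by
        funext i
        simp [torusExp]
      rw [e', one_smul]
    simp only [e] at h
    refine h.trans ?_
    change _ = f p * deriv (fun s : ℝ => g (torusExp (s • v) • p)) 0
      + g p * deriv (fun s : ℝ => f (torusExp (s • v) • p)) 0
    ring

theorem fundamentalField_quotientPullback (v : Fin k → ℝ) (f : smoothFunctions n k M) :
    fundamentalField n k M v (quotientPullback n k M f) = 0 := by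
  ext p
  have e : (fun s : ℝ => (quotientPullback n k M f) (torusExp (s • v) • p)) =
      fun _ => f.1 (orbitMap p) := by
    funext s
    exact congrArg f.1 (Quotient.sound ⟨torusExp (s • v), rfl⟩)
  change deriv (fun s : ℝ => (quotientPullback n k M f) (torusExp (s • v) • p)) 0 = 0
  rw [e, deriv_const]

/-- The lift `ã : 𝔱^k → 𝒜_{|D|}` of the infinitesimal action: the fundamental vector fields preserve
the elliptic divisor. -/
def liftedAction (v : Fin k → ℝ) : logDer (ellipticIdeal n k M) :=
  ⟨fundamentalField n k M v, fun f hf => by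
    unfold ellipticIdeal Ideal.map at hf ⊢
    induction hf using Submodule.span_induction with
    | mem f hf =>
      obtain ⟨f, -, rfl⟩ := hf
      rw [show fundamentalField n k M v _ = 0 from fundamentalField_quotientPullback n k M v f]
      exact Submodule.zero_mem _
    | zero => rw [map_zero]; exact Submodule.zero_mem _
    | add f g _ _ hf hg => rw [map_add]; exact Submodule.add_mem _ hf hg
    | smul r f hf' hf =>
      rw [smul_eq_mul, Derivation.leibniz]
      exact Submodule.add_mem _ (Submodule.smul_mem _ r hf)
        (by rw [smul_eq_mul, mul_comm]; exact Submodule.smul_mem _ _ hf')⟩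

variable {n k M}

/-- A connection one-form: an invariant `Θ ∈ Ω¹(𝒜_{|D|}; 𝔱^k)` with `ι_{ã(v)} Θ = v`. -/
structure IsConnection (Θ : OneForm (ellipticIdeal n k M) k) : Prop where
  invariant : ∀ g : Torus k, IsPullbackOne (translate n M g) Θ Θ
  vertical : ∀ (v : Fin k → ℝ) (i : Fin k),
    Θ (liftedAction n k M v) i = algebraMap ℝ C^∞⟮𝓡 n, M; ℝ⟯ (v i)

end Action

variable {n k M}

/-- `K ∈ Ω²(𝒜_{∂B}; 𝔱^k)` is the curvature of `Θ`: the form to which `dΘ` descends, `π^* K = dΘ`. -/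
def IsCurvature (Θ : OneForm (ellipticIdeal n k M) k) (K : TwoForm (boundaryIdeal n k M) k) :
    Prop :=
  IsPullbackTwo (quotientPullback n k M) K (dOne (ellipticIdeal n k M) k Θ)

/-! ### Residues -/

/-- `t₁, …, t_i` are, near the point `b` of multiplicity `i`, the boundary coordinates
`t_j = |z_j|²` of a standard chart. -/
def IsBoundaryCoordinates {i : ℕ} (b : OrbitSpace k M) (t : Fin i → smoothFunctions n k M) : Prop :=
  ∃ (a m : ℕ) (c : StandardChart n k M a i m), ∃ p ∈ c.source, orbitMap p = b ∧ c.z p = 0 ∧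
    ∀ j, ∀ᶠ q in 𝓝 p, (t j).1 (orbitMap q) = ‖c.z q j‖ ^ 2

/-- The value of `E` in the fibre of `𝒜_{∂B}` over `b` is that of `t_j ∂_{t_j}`: the vector field
`E` vanishes at `b`, and near `b` one has `E(t_l) = u_l t_l` with `u_l(b) = δ_{jl}`. -/
def IsLogGenerator {i : ℕ} (b : OrbitSpace k M) (t : Fin i → smoothFunctions n k M) (j : Fin i)
    (E : logDer (boundaryIdeal n k M)) : Prop :=
  (∀ f, (E.1 f).1 b = 0) ∧
  ∀ l, ∃ u : smoothFunctions n k M, (∀ᶠ b' in 𝓝 b, (E.1 (t l)).1 b' = u.1 b' * (t l).1 b') ∧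
    u.1 b = if l = j then 1 else 0

variable (n k M) in
/-- `C^∞(∂B[1])`: the functions on `∂B[1]` which are locally restrictions of smooth functions. -/
def stratumFunctions : Subalgebra ℝ (stratum n k M 1 → ℝ) where
  carrier := {f | ∀ b, ∃ F : smoothFunctions n k M, ∀ᶠ b' in 𝓝 b, f b' = F.1 b'}
  mul_mem' := fun {f g} hf hg b => by
    obtain ⟨F, hF⟩ := hf b
    obtain ⟨G, hG⟩ := hg b
    refine ⟨F * G, ?_⟩
    filter_upwards [hF, hG] with b' h₁ h₂
    simp [h₁, h₂]
  add_mem' := fun {f g} hf hg b => by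
    obtain ⟨F, hF⟩ := hf b
    obtain ⟨G, hG⟩ := hg b
    refine ⟨F + G, ?_⟩
    filter_upwards [hF, hG] with b' h₁ h₂
    simp [h₁, h₂]
  algebraMap_mem' := fun r _ => ⟨algebraMap ℝ _ r, Filter.Eventually.of_forall fun _ => rfl⟩

/-- Restriction of a smooth function on `B` to `∂B[1]`. -/
def restrictToStratum (f : smoothFunctions n k M) : stratumFunctions n k M :=
  ⟨fun b => f.1 b, fun _ => ⟨f, Filter.Eventually.of_forall fun _ => rfl⟩⟩

/-- `σ ∈ Ω¹(∂B[1]; 𝔱^k)` is the residue `Res¹(K)`, the restriction of `ι_{t ∂_t} K` to `∂B[1]`: if a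
vector field `W` on `∂B[1]` agrees at `b` with the vector field on `B` underlying a section `Y` of
`𝒜_{∂B}`, then `σ(W)(b) = K(t ∂_t, Y)(b)`. -/
def IsResidueOne (K : TwoForm (boundaryIdeal n k M) k)
    (σ : OneForm (⊤ : Ideal (stratumFunctions n k M)) k) : Prop :=
  ∀ (b : stratum n k M 1) (t : Fin 1 → smoothFunctions n k M), IsBoundaryCoordinates b.1 t →
    ∀ E, IsLogGenerator b.1 t 0 E →
      ∀ (Y : logDer (boundaryIdeal n k M)) (W : logDer (⊤ : Ideal (stratumFunctions n k M))),
        (∀ f, (W.1 (restrictToStratum f)).1 b = (Y.1 f).1 b) →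
          ∀ i, (σ W i).1 b = (K ![E, Y] i).1 b

/-- `[Res¹(K)] = 0` in `H¹(∂B[1]; 𝔱^k)`: the residue `Res¹(K)` is an exact one-form. -/
def ResidueOneExact (K : TwoForm (boundaryIdeal n k M) k) : Prop :=
  ∃ f : Fin k → stratumFunctions n k M, IsResidueOne K (dZero ⊤ f)

/-- `Res²(K) = 0` in `H⁰(∂B[2]; 𝔱^k)`: the function `K(t₁ ∂_{t₁}, t₂ ∂_{t₂})` vanishes on `∂B[2]`. -/
def ResidueTwoVanishes (K : TwoForm (boundaryIdeal n k M) k) : Prop :=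
  ∀ b ∈ stratum n k M 2, ∀ t : Fin 2 → smoothFunctions n k M, IsBoundaryCoordinates b t →
    ∀ E₁ E₂, IsLogGenerator b t 0 E₁ → IsLogGenerator b t 1 E₂ → ∀ i, (K ![E₁, E₂] i).1 b = 0

end TorusAction

end

set_option linter.unusedSectionVars false

noncomputable section

/-! ### Calculus: parametric integrals and division -/

namespace SmoothDivision

open MeasureTheory Set

variable {V : Type} [NormedAddCommGroup V] [NormedSpace ℝ V] [FiniteDimensional ℝ V]

/-! In a standard chart the fields t_j ∂_{t_j} and ∂_{x_i} of B lift to M as the radial scaling of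
z_j and the translation of x_i. These lifts are invariant and preserve all angles, so they are
horizontal for the flat connection of the chart. Evaluating Θ on them gives a one-form η_c = Σ a_j
dlog t_j + Σ b_i dx_i on 𝒜_{∂B} with smooth coefficients (`primitive`). The lift of a bracket and
the bracket of the lifts differ by a vertical field that annihilates the angles, hence one that Θ
annihilates; therefore K = dη_c locally (`curvature_eq`).

For two charts c and c', the difference η_c - η_c' is Θ applied to the vertical difference of the
two lifts, that is, the derivative of the angles of c' along the lifted frame of c. The decisive
point is that along a ray z_j = r > 0 of c, ending where z_j alone vanishes, the angles of c' extend
smoothly to r = 0 (`exists_ray_angle`). Their derivative along r ∂_r therefore tends to zero, so the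
coefficient of dlog t_j in the difference vanishes on t_j = 0 (`residue_eq`). An invariant function
vanishing on z_j = 0 is divisible by |z_j|² (`exists_div_sq`, `exists_div`), and t_j dlog t_j =
dt_j; so η_c - η_c' is a smooth form on B (`exists_primitive_sub`).

With a countable family of cutoffs, the η_c are patched to a global form η such that each η_c - η is
locally a smooth form β_c on B (`exists_global_primitive`). Then K - dη is locally dβ_c. These
differentials agree on overlaps, because free orbits are dense and over them 𝒜_{∂B} is the whole
tangent bundle; they glue to the closed smooth form sought.

For the residues, a on ∂B[1] does not depend on the chart (`conn_eq`). Since K = dη_c, contraction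
with t ∂_t gives -da there, which is exact. On ∂B[2] the value K(E₁, E₂) is a combination of
derivatives along E₂, which vanishes at the point.

Density of the free orbits is used throughout: identities of smooth functions are checked there,
where all boundary coordinates are invertible. -/

theorem hasFDerivAt_parametric_integral {W : Type} [NormedAddCommGroup W] [NormedSpace ℝ W]
    [CompleteSpace W] {Φ : V × ℝ → W} (hΦ : ContDiff ℝ ∞ Φ) (v₀ : V) :
    HasFDerivAt (fun v => ∫ s in (0 : ℝ)..1, Φ (v, s))
      (∫ s in (0 : ℝ)..1, (fderiv ℝ Φ (v₀, s)).comp (ContinuousLinearMap.inl ℝ V ℝ)) v₀ := by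
  have hΦ' : Continuous fun p : V × ℝ =>
      (fderiv ℝ Φ p).comp (ContinuousLinearMap.inl ℝ V ℝ) :=
    (hΦ.continuous_fderiv (by simp)).clm_comp continuous_const
  have hK : IsCompact (Metric.closedBall v₀ 1 ×ˢ Icc (0 : ℝ) 1) :=
    (isCompact_closedBall v₀ 1).prod isCompact_Icc
  obtain ⟨C, hC⟩ := hK.exists_bound_of_continuousOn hΦ'.continuousOn
  refine intervalIntegral.hasFDerivAt_integral_of_dominated_of_fderiv_le
    (F := fun v s => Φ (v, s)) (F' := fun v s => (fderiv ℝ Φ (v, s)).comp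
      (ContinuousLinearMap.inl ℝ V ℝ)) (bound := fun _ => C)
    (Metric.closedBall_mem_nhds v₀ one_pos) ?_ ?_ ?_ ?_ ?_ ?_
  · exact .of_forall fun v =>
      (hΦ.continuous.comp (Continuous.prodMk_right v)).aestronglyMeasurable
  · exact (hΦ.continuous.comp (Continuous.prodMk_right v₀)).intervalIntegrable _ _
  · exact (hΦ'.comp (Continuous.prodMk_right v₀)).aestronglyMeasurable
  · refine .of_forall fun s hs v hv => hC (v, s) ⟨hv, ?_⟩
    rw [uIoc_of_le zero_le_one] at hs
    exact ⟨hs.1.le, hs.2⟩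
  · exact intervalIntegrable_const
  · refine .of_forall fun s _ v _ => ?_
    have h := (hΦ.differentiable (by simp) (v, s)).hasFDerivAt
    exact h.comp v (hasFDerivAt_prodMk_left v s)

/-- Induction on the order of differentiability. The target `W` has to vary, because the derivative
is again a parametric integral, with values in `V →L[ℝ] W`. -/
theorem contDiff_parametric_integral {W : Type} [NormedAddCommGroup W] [NormedSpace ℝ W]
    [CompleteSpace W] {Φ : V × ℝ → W} (hΦ : ContDiff ℝ ∞ Φ) :
    ContDiff ℝ ∞ fun v => ∫ s in (0 : ℝ)..1, Φ (v, s) := by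
  rw [contDiff_infty]
  intro n
  induction n generalizing W with
  | zero =>
    rw [CharP.cast_eq_zero, contDiff_zero]
    exact intervalIntegral.continuous_parametric_intervalIntegral_of_continuous'
      (f := fun v s => Φ (v, s)) hΦ.continuous 0 1
  | succ n ih =>
    rw [Nat.cast_add, Nat.cast_one, contDiff_succ_iff_hasFDerivAt]
    refine ⟨_, ih (Φ := fun p => (fderiv ℝ Φ p).comp (ContinuousLinearMap.inl ℝ V ℝ)) ?_,
      fun v => hasFDerivAt_parametric_integral hΦ v⟩
    exact (hΦ.fderiv_right (m := ∞) (by simp)).clm_comp contDiff_const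

omit [FiniteDimensional ℝ V] in
theorem sub_eq_integral_fderiv {F : V → ℝ} (hF : ContDiff ℝ ∞ F) (v₀ w : V) :
    F (v₀ + w) - F v₀ = ∫ s in (0 : ℝ)..1, fderiv ℝ F (v₀ + s • w) w := by
  have hd : ∀ s : ℝ, HasDerivAt (fun s : ℝ => F (v₀ + s • w)) (fderiv ℝ F (v₀ + s • w) w) s := by
    intro s
    have h₁ : HasDerivAt (fun s : ℝ => v₀ + s • w) w s := by
      simpa using ((hasDerivAt_id s).smul_const w).const_add v₀
    exact (hF.differentiable (by simp) _).hasFDerivAt.comp_hasDerivAt s h₁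
  have hc : Continuous fun s : ℝ => fderiv ℝ F (v₀ + s • w) w :=
    ((hF.continuous_fderiv (by simp)).comp (by fun_prop)).clm_apply continuous_const
  rw [intervalIntegral.integral_eq_sub_of_hasDerivAt (fun s _ => hd s) (hc.intervalIntegrable _ _)]
  simp

/-- Hadamard's lemma. -/
theorem exists_hadamard {F : V → ℝ} (hF : ContDiff ℝ ∞ F) (v₀ : V) :
    ∃ Φ : V → V →L[ℝ] ℝ, ContDiff ℝ ∞ Φ ∧ ∀ v, F v = F v₀ + Φ v (v - v₀) := by
  have hc : ContDiff ℝ ∞ fun p : V × ℝ => fderiv ℝ F (v₀ + p.2 • (p.1 - v₀)) :=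
    (hF.fderiv_right (m := ∞) (by simp)).comp (by fun_prop)
  refine ⟨fun v => ∫ s in (0 : ℝ)..1, fderiv ℝ F (v₀ + s • (v - v₀)),
    contDiff_parametric_integral hc, fun v => ?_⟩
  have h := sub_eq_integral_fderiv hF v₀ (v - v₀)
  rw [add_sub_cancel] at h
  beta_reduce
  rw [ContinuousLinearMap.intervalIntegral_apply, ← h]
  · ring
  · exact (hc.continuous.comp (Continuous.prodMk_right v)).intervalIntegrable _ _

/-- A smooth function vanishing on a hyperplane is divisible by the defining linear function. -/
theorem exists_div_linear {F : V → ℝ} (hF : ContDiff ℝ ∞ F) (l : V →L[ℝ] ℝ) {e : V} (he : l e = 1)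
    (h0 : ∀ v, l v = 0 → F v = 0) : ∃ G : V → ℝ, ContDiff ℝ ∞ G ∧ ∀ v, F v = l v * G v := by
  have hc : ContDiff ℝ ∞ fun p : V × ℝ =>
      fderiv ℝ F (p.1 - l p.1 • e + p.2 • l p.1 • e) e :=
    ((hF.fderiv_right (m := ∞) (by simp)).comp (by fun_prop)).clm_apply contDiff_const
  -- The point v - l(v)e is the projection of v to the hyperplane along e, where F vanishes; G is
  -- the mean of the e-derivative over the segment from there to v.
  refine ⟨fun v => ∫ s in (0 : ℝ)..1, fderiv ℝ F (v - l v • e + s • l v • e) e,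
    contDiff_parametric_integral hc, fun v => ?_⟩
  have h := sub_eq_integral_fderiv hF (v - l v • e) (l v • e)
  rw [sub_add_cancel, h0 (v - l v • e) (by simp [he]), sub_zero] at h
  rw [h, ← intervalIntegral.integral_const_mul]
  simp

omit [FiniteDimensional ℝ V] in
theorem dense_ne_zero_of_linear (l : V →L[ℝ] ℝ) {e : V} (he : l e = 1) : Dense {v | l v ≠ 0} := by
  intro v
  by_cases hv : l v = 0
  · have h : Filter.Tendsto (fun s : ℝ => v + s • e) (𝓝[≠] 0) (𝓝 v) := by
      have : Continuous fun s : ℝ => v + s • e := by fun_prop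
      simpa using (this.tendsto 0).mono_left nhdsWithin_le_nhds
    refine mem_closure_of_tendsto h ?_
    filter_upwards [self_mem_nhdsWithin] with s hs
    simpa [hv, he] using hs
  · exact subset_closure hv

/-- A smooth function of `(x, y, …)` which is invariant under rotations of the `(x, y)`-plane and
vanishes at `x = y = 0` is divisible by `x² + y²`. -/
theorem exists_div_sq {F : V → ℝ} (hF : ContDiff ℝ ∞ F) (x y : V →L[ℝ] ℝ) {e₁ e₂ : V}
    (x₁ : x e₁ = 1) (x₂ : x e₂ = 0) (y₁ : y e₁ = 0) (y₂ : y e₂ = 1)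
    (hrot : ∀ (θ : ℝ) (v : V), F (v - x v • e₁ - y v • e₂
      + (Real.cos θ * x v - Real.sin θ * y v) • e₁
      + (Real.sin θ * x v + Real.cos θ * y v) • e₂) = F v)
    (h0 : ∀ v, x v = 0 → y v = 0 → F v = 0) :
    ∃ G : V → ℝ, ContDiff ℝ ∞ G ∧ ∀ v, F v = (x v ^ 2 + y v ^ 2) * G v := by
  have hF' : ContDiff ℝ ∞ (fderiv ℝ F) := hF.fderiv_right (m := ∞) (by simp)
  -- The derivative of the rotation invariance at θ = 0: x ∂_y F = y ∂_x F.
  have key : ∀ v, x v * fderiv ℝ F v e₂ = y v * fderiv ℝ F v e₁ := by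
    intro v
    have h₁ : HasDerivAt (fun θ : ℝ => v - x v • e₁ - y v • e₂
      + (Real.cos θ * x v - Real.sin θ * y v) • e₁
      + (Real.sin θ * x v + Real.cos θ * y v) • e₂) (- y v • e₁ + x v • e₂) 0 := by
      have hcos := Real.hasDerivAt_cos 0
      have hsin := Real.hasDerivAt_sin 0
      have h := (((hcos.mul_const (x v)).sub (hsin.mul_const (y v))).smul_const e₁).const_add
        (v - x v • e₁ - y v • e₂) |>.add
          (((hsin.mul_const (x v)).add (hcos.mul_const (y v))).smul_const e₂)
      convert h using 1
      · rfl
      · simp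
    have h₂ := (hF.differentiable (by simp) _).hasFDerivAt.comp_hasDerivAt (0 : ℝ) h₁
    have h₃ := h₂.unique ((hasDerivAt_const (0 : ℝ) (F v)).congr_of_eventuallyEq
      (.of_forall fun θ => hrot θ v))
    have e : v - x v • e₁ - y v • e₂ + x v • e₁ + y v • e₂ = v := by abel
    simp only [Real.cos_zero, Real.sin_zero, one_mul, zero_mul, sub_zero, zero_add, e, map_add,
      map_smul, smul_eq_mul, neg_smul, map_neg] at h₃
    linarith
  have c₁ : ContDiff ℝ ∞ fun v => fderiv ℝ F v e₁ := hF'.clm_apply contDiff_const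
  have c₂ : ContDiff ℝ ∞ fun v => fderiv ℝ F v e₂ := hF'.clm_apply contDiff_const
  -- On x = 0 the identity reads y ∂_x F = 0. This gives ∂_x F = 0 where y ≠ 0, and by density on
  -- the whole hyperplane. Thus ∂_x F = x g, and then ∂_y F = y g, with the same g.
  have v₁ : ∀ v, x v = 0 → fderiv ℝ F v e₁ = 0 := by
    intro v hv
    have hcl : (fun v : V => fderiv ℝ F (v - x v • e₁) e₁) = fun _ => 0 := by
      refine Continuous.ext_on (dense_ne_zero_of_linear y y₂) ?_ continuous_const fun w hw => ?_
      · exact c₁.continuous.comp (by fun_prop)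
      · have h := key (w - x w • e₁)
        simp only [map_sub, map_smul, x₁, y₁, smul_eq_mul, mul_one, sub_self, zero_mul, mul_zero,
          sub_zero] at h
        exact (mul_eq_zero.mp h.symm).resolve_left hw
    simpa [hv] using congrFun hcl v
  obtain ⟨g, hg, hg'⟩ := exists_div_linear c₁ x x₁ v₁
  have g₂ : ∀ v, fderiv ℝ F v e₂ = y v * g v := by
    refine congrFun (Continuous.ext_on (dense_ne_zero_of_linear x x₁) c₂.continuous
      (y.continuous.mul hg.continuous) fun v hv => ?_)
    have h := key v
    rw [hg' v] at h
    exact mul_left_cancel₀ hv (h.trans (by ring))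
  -- Along the segment the coordinates are s x and s y, so the radial derivative of F is s (x² + y²)
  -- g; this is the source of the factor `p.2`.
  have hc : ContDiff ℝ ∞ fun p : V × ℝ =>
      p.2 * g (p.1 - x p.1 • e₁ - y p.1 • e₂ + p.2 • (x p.1 • e₁ + y p.1 • e₂)) :=
    contDiff_snd.mul (hg.comp (by fun_prop))
  refine ⟨_, contDiff_parametric_integral hc, fun v => ?_⟩
  have h := sub_eq_integral_fderiv hF (v - x v • e₁ - y v • e₂) (x v • e₁ + y v • e₂)
  rw [h0 (v - x v • e₁ - y v • e₂) (by simp [x₁, x₂]) (by simp [y₁, y₂]), sub_zero] at h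
  have e : v - x v • e₁ - y v • e₂ + (x v • e₁ + y v • e₂) = v := by abel
  rw [e] at h
  rw [h, ← intervalIntegral.integral_const_mul]
  refine intervalIntegral.integral_congr fun s _ => ?_
  simp only [map_add, map_smul, hg', g₂, smul_eq_mul, map_sub, x₁, x₂, y₁, y₂]
  ring

end SmoothDivision

/-! ### Characters of tori -/

namespace TorusAction

/-- A continuous homomorphism `ℝ → S¹` is of the form `t ↦ e^{ict}`. -/
theorem exists_circleExp_of_hom {φ : ℝ → Circle} (hφ : Continuous φ)
    (hadd : ∀ s t, φ (s + t) = φ s * φ t) : ∃ c : ℝ, ∀ t, φ t = Circle.exp (c * t) := by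
  set f : ℝ → ℂ := fun t => φ t with hf
  have fc : Continuous f := continuous_subtype_val.comp hφ
  have fadd : ∀ s t, f (s + t) = f s * f t := fun s t => by simp [hf, hadd]
  have f0 : f 0 = 1 := by
    have h := hadd 0 0
    rw [add_zero] at h
    simp [hf, left_eq_mul.mp h]
  have hF : ∀ t, HasDerivAt (fun t => ∫ s in (0 : ℝ)..t, f s) (f t) t := fun t =>
    intervalIntegral.integral_hasDerivAt_right (fc.intervalIntegrable _ _)
      (fc.stronglyMeasurableAtFilter _ _) fc.continuousAt
  -- If the primitive of f vanished identically, its derivative f(0) = 1 would be zero.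
  obtain ⟨δ, hδ⟩ : ∃ δ, (∫ s in (0 : ℝ)..δ, f s) ≠ 0 := by
    by_contra! h
    have h' := (hF 0).unique ((hasDerivAt_const (0 : ℝ) (0 : ℂ)).congr_of_eventuallyEq
      (.of_forall h))
    rw [f0] at h'
    exact one_ne_zero h'
  -- Multiplicativity gives f(t) ∫₀^δ f = ∫_t^{t+δ} f, so continuity of f already implies
  -- differentiability.
  have fd : Differentiable ℝ f := by
    have e : f = fun t => ((∫ s in (0 : ℝ)..(t + δ), f s) - ∫ s in (0 : ℝ)..t, f s) *
        (∫ s in (0 : ℝ)..δ, f s)⁻¹ := by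
      funext t
      rw [eq_mul_inv_iff_mul_eq₀ hδ, ← intervalIntegral.integral_const_mul,
        intervalIntegral.integral_interval_sub_left (fc.intervalIntegrable _ _)
          (fc.intervalIntegrable _ _)]
      simp_rw [← fadd]
      rw [intervalIntegral.integral_comp_add_left (fun s => f s) t, add_zero]
    rw [e]
    intro t
    refine DifferentiableAt.mul_const (DifferentiableAt.sub ?_ (hF t).differentiableAt) _
    exact (hF (t + δ)).differentiableAt.comp (f := fun t => t + δ) t (by fun_prop)
  set a := deriv f 0 with ha
  have hd : ∀ t, HasDerivAt f (f t * a) t := by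
    intro t
    have h₁ : HasDerivAt (fun s => f t * f (s - t)) (f t * a) t := by
      refine HasDerivAt.const_mul _ ?_
      have h0 : HasDerivAt f a (t - t) := by rw [sub_self]; exact (fd 0).hasDerivAt
      exact h0.comp_sub_const t t
    refine h₁.congr_of_eventuallyEq (.of_forall fun s => ?_)
    change f s = f t * f (s - t)
    rw [← fadd]
    simp
  have hexp : ∀ t : ℝ, f t = Complex.exp (a * t) := by
    have hder : ∀ t : ℝ, HasDerivAt (fun t : ℝ => f t * Complex.exp (-(a * t))) 0 t := by
      intro t
      have h₂ : HasDerivAt (fun t : ℝ => -(a * (t : ℂ))) (-a) t := by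
        have h := (Complex.ofRealCLM.hasDerivAt (x := t)).const_mul a
        have h' := h.neg
        rw [Complex.ofRealCLM_apply, Complex.ofReal_one, mul_one] at h'
        exact h'
      exact ((hd t).mul h₂.cexp).congr_deriv (by ring)
    intro t
    have h := is_const_of_deriv_eq_zero (fun t => (hder t).differentiableAt)
      (fun t => (hder t).deriv) t 0
    simp only [f0, Complex.ofReal_zero, mul_zero, neg_zero, Complex.exp_zero, mul_one] at h
    rw [Complex.exp_neg, mul_inv_eq_one₀ (Complex.exp_ne_zero _)] at h
    exact h
  -- Since |f(1)| = 1, the exponent is purely imaginary.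
  have hre : a.re = 0 := by
    have h := congrArg norm (hexp 1)
    simp only [hf, Circle.norm_coe, Complex.norm_exp, Complex.ofReal_one, mul_one] at h
    exact Real.exp_eq_one_iff _ |>.mp h.symm
  refine ⟨a.im, fun t => Circle.ext ?_⟩
  rw [Circle.coe_exp]
  refine (hexp t).trans (congrArg Complex.exp ?_)
  apply Complex.ext <;> simp [hre]

theorem torusExp_add {k : ℕ} (v w : Fin k → ℝ) :
    torusExp (v + w) = torusExp v * torusExp w := by
  funext i
  simp [torusExp, Circle.exp_add]

theorem torusExp_zero {k : ℕ} : torusExp (0 : Fin k → ℝ) = 1 := by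
  funext i
  simp [torusExp]

theorem continuous_torusExp {k : ℕ} : Continuous (torusExp (k := k)) :=
  continuous_pi fun i => Circle.exp.continuous.comp (continuous_apply i)

/-- A character of the torus is linear on the Lie algebra. -/
theorem exists_linear_of_character {k : ℕ} (φ : Torus k →* Circle) (hφ : Continuous φ) :
    ∃ c : (Fin k → ℝ) →L[ℝ] ℝ, ∀ v, φ (torusExp v) = Circle.exp (c v) := by
  have h : ∀ i, ∃ c : ℝ, ∀ t, φ (torusExp (t • Pi.single i 1)) = Circle.exp (c * t) := fun i => by
    refine exists_circleExp_of_hom (φ := fun t => φ (torusExp (t • Pi.single i 1))) ?_ ?_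
    · exact hφ.comp (continuous_torusExp.comp (by fun_prop))
    · intro s t
      rw [add_smul, torusExp_add, map_mul]
  choose c hc using h
  refine ⟨∑ i, c i • ContinuousLinearMap.proj i, fun v => ?_⟩
  have hs : ∀ (s : Finset (Fin k)), φ (torusExp (∑ i ∈ s, v i • Pi.single i (1 : ℝ))) =
      Circle.exp (∑ i ∈ s, c i * v i) := by
    intro s
    induction s using Finset.induction_on with
    | empty => simp [torusExp_zero]
    | insert i s hi ih =>
      rw [Finset.sum_insert hi, Finset.sum_insert hi, torusExp_add, map_mul, ih, hc,
        Circle.exp_add]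
  have e : ∑ i, v i • Pi.single i (1 : ℝ) = v := by
    funext j
    simp [Finset.sum_apply, Pi.single_apply]
  have h := hs Finset.univ
  rw [e] at h
  rw [h]
  congr 1
  simp

/-- A homomorphism of tori is linear on Lie algebras. -/
theorem exists_linear_of_torusHom {k a : ℕ} (φ : Torus k →* Torus a) (hφ : Continuous φ) :
    ∃ c : (Fin k → ℝ) →L[ℝ] (Fin a → ℝ), ∀ v, φ (torusExp v) = torusExp (c v) := by
  have h : ∀ i, ∃ c : (Fin k → ℝ) →L[ℝ] ℝ, ∀ v, φ (torusExp v) i = Circle.exp (c v) := fun i =>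
    exists_linear_of_character ((Pi.evalMonoidHom (fun _ => Circle) i).comp φ)
      ((continuous_apply i).comp hφ)
  choose c hc using h
  exact ⟨ContinuousLinearMap.pi c, fun v => funext fun i => hc i v⟩

end TorusAction
end

noncomputable section

/-! ### Local angles and standard charts -/

namespace TorusAction

open LogForms Set

section Lift

variable {E H X : Type*} [NormedAddCommGroup E] [NormedSpace ℝ E] [TopologicalSpace H]
  {I : ModelWithCorners ℝ E H} [TopologicalSpace X] [ChartedSpace H X]

attribute [local instance] finrank_real_complex_fact'

theorem contMDiff_circle_coe : ContMDiff (𝓡 1) 𝓘(ℝ, ℂ) ∞ fun u : Circle => (u : ℂ) := by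
  let c : Circle → ℂ := (↑)
  have h : ContMDiff (𝓡 1) 𝓘(ℝ, ℂ) ∞ c := contMDiff_coe_sphere
  exact h

/-- A smooth map to the circle has a smooth local angle. -/
theorem exists_angle {f : X → Circle} {s : Set X} (hs : IsOpen s)
    (hf : ContMDiffOn I (𝓡 1) ∞ f s) {p : X} (hp : p ∈ s) :
    ∃ O : Set X, IsOpen O ∧ p ∈ O ∧ O ⊆ s ∧ ∃ θ : X → ℝ, ContMDiffOn I 𝓘(ℝ) ∞ θ O ∧
      ∀ q ∈ O, Circle.exp (θ q) = f q := by
  have hc : ContMDiffOn I 𝓘(ℝ, ℂ) ∞ (fun q => (f q : ℂ)) s := contMDiff_circle_coe.comp_contMDiffOn hf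
  have hm : ContMDiffOn I 𝓘(ℝ, ℂ) ∞ (fun q => (f q : ℂ) * ((f p)⁻¹ : Circle)) s :=
    (contDiff_id.mul contDiff_const : ContDiff ℝ ∞ fun z : ℂ =>
      z * ((f p)⁻¹ : Circle)).contMDiff.comp_contMDiffOn hc
  -- Division by f(p) moves the value at p to 1, inside the slit plane, where the logarithm is
  -- smooth; the argument of f(p) is added back afterwards.
  refine ⟨s ∩ (fun q => (f q : ℂ) * ((f p)⁻¹ : Circle)) ⁻¹' Complex.slitPlane,
    hm.continuousOn.isOpen_inter_preimage hs Complex.isOpen_slitPlane, ⟨hp, ?_⟩, inter_subset_left,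
    fun q => (Complex.log ((f q : ℂ) * ((f p)⁻¹ : Circle))).im + (f p : ℂ).arg, ?_, ?_⟩
  · simp [Complex.one_mem_slitPlane]
  · intro q hq
    have h₁ : ContDiffAt ℝ ∞ (fun z : ℂ => (Complex.log z).im + (f p : ℂ).arg)
        ((f q : ℂ) * ((f p)⁻¹ : Circle)) :=
      (Complex.imCLM.contDiff.contDiffAt.comp _
        ((Complex.contDiffAt_log hq.2).restrict_scalars ℝ)).add contDiffAt_const
    exact h₁.contMDiffAt.comp_contMDiffWithinAt q ((hm q hq.1).mono inter_subset_left)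
  · intro q hq
    have e : (f q : ℂ) * ((f p)⁻¹ : Circle) = ((f q * (f p)⁻¹ : Circle) : ℂ) := by simp
    change Circle.exp ((Complex.log ((f q : ℂ) * ((f p)⁻¹ : Circle))).im + (f p : ℂ).arg) = f q
    rw [Complex.log_im, Circle.exp_add, e, Circle.exp_arg, Circle.exp_arg, inv_mul_cancel_right]

/-- A smooth map to the torus has a smooth local logarithm. -/
theorem exists_torus_angle {a : ℕ} {f : X → Torus a} {s : Set X} (hs : IsOpen s)
    (hf : ∀ i, ContMDiffOn I (𝓡 1) ∞ (fun q => f q i) s) {p : X} (hp : p ∈ s) :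
    ∃ O : Set X, IsOpen O ∧ p ∈ O ∧ O ⊆ s ∧ ∃ θ : X → Fin a → ℝ,
      ContMDiffOn I 𝓘(ℝ, Fin a → ℝ) ∞ θ O ∧ ∀ q ∈ O, torusExp (θ q) = f q := by
  choose O hO hpO hOs θ hθ he using fun i => exists_angle hs (hf i) hp
  refine ⟨(⋂ i, O i) ∩ s, (isOpen_iInter_of_finite hO).inter hs, ⟨mem_iInter.mpr hpO, hp⟩,
    inter_subset_right, fun q i => θ i q, ?_, ?_⟩
  · rw [contMDiffOn_pi_space]
    exact fun i => (hθ i).mono (inter_subset_left.trans (iInter_subset _ i))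
  · exact fun q hq => funext fun i => he i q (mem_iInter.mp hq.1 i)

end Lift

variable {n k : ℕ} {M : Type*} [TopologicalSpace M] [ChartedSpace (EuclideanSpace ℝ (Fin n)) M]
  [MulAction (Torus k) M]

omit [TopologicalSpace M] in
theorem orbitMap_eq_iff {p q : M} : orbitMap (k := k) p = orbitMap q ↔ ∃ g : Torus k, g • q = p :=
  Quotient.eq''

omit [TopologicalSpace M] in
theorem orbitMap_smul (g : Torus k) (p : M) : orbitMap (k := k) (g • p) = orbitMap p :=
  orbitMap_eq_iff.mpr ⟨g, rfl⟩

omit [TopologicalSpace M] in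
theorem orbitMap_surjective : Function.Surjective (orbitMap (k := k) (M := M)) :=
  Quotient.mk_surjective

theorem continuous_orbitMap : Continuous (orbitMap (k := k) (M := M)) := continuous_quotient_mk'

/-- The slice `ℂ^l × ℝ^m` of a standard chart. -/
abbrev Slice (l m : ℕ) := (Fin l → ℂ) × (Fin m → ℝ)

/-- The map `(z, x) ↦ (|z|², x)`. -/
def sqMap {l m : ℕ} (v : Slice l m) : (Fin l → ℝ) × (Fin m → ℝ) := (fun j => ‖v.1 j‖ ^ 2, v.2)

theorem contDiff_sqMap {l m : ℕ} : ContDiff ℝ ∞ (sqMap (l := l) (m := m)) :=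
  ContDiff.prodMk (contDiff_pi.mpr fun j =>
    (contDiff_apply ℝ ℂ j |>.comp contDiff_fst).norm_sq ℝ) contDiff_snd

namespace StandardChart

variable {a l m : ℕ} (c : StandardChart n k M a l m)

/-- The coordinates of a point transverse to the orbit directions `T^a`. -/
def coord (p : M) : Slice l m := (c.z p, c.x p)

/-- The slice through `w = 1`. -/
def sec (v : Slice l m) : M := c.inv 1 v.1 v.2

theorem sec_mem (v : Slice l m) : c.sec v ∈ c.source := c.inv_mem _ _ _

@[simp] theorem coord_sec (v : Slice l m) : c.coord (c.sec v) = v := by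
  simp [coord, sec, c.z_inv, c.x_inv]

@[simp] theorem z_sec (v : Slice l m) : c.z (c.sec v) = v.1 := c.z_inv _ _ _

@[simp] theorem x_sec (v : Slice l m) : c.x (c.sec v) = v.2 := c.x_inv _ _ _

@[simp] theorem w_sec (v : Slice l m) : c.w (c.sec v) = 1 := c.w_inv _ _ _

theorem contMDiff_sec : ContMDiff 𝓘(ℝ, Slice l m) (𝓡 n) ∞ c.sec := by
  have h : ContDiff ℝ ∞ fun v : Slice l m => ((0 : Fin a → ℝ), v.1, v.2) := by fun_prop
  have h' := c.contMDiff_inv.comp h.contMDiff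
  refine h'.congr fun v => ?_
  simp [sec, torusExp_zero]

theorem contMDiffOn_coord : ContMDiffOn (𝓡 n) 𝓘(ℝ, Slice l m) ∞ c.coord c.source :=
  c.contMDiffOn_z.prodMk_space c.contMDiffOn_x

theorem eq_of_coords {p q : M} (hp : p ∈ c.source) (hq : q ∈ c.source) (hw : c.w p = c.w q)
    (hz : c.z p = c.z q) (hx : c.x p = c.x q) : p = q := by
  rw [← c.left_inv p hp, ← c.left_inv q hq, hw, hz, hx]

theorem smul_mem_iff (g : Torus k) {p : M} : g • p ∈ c.source ↔ p ∈ c.source :=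
  ⟨fun h => by simpa using c.smul_mem g⁻¹ _ h, c.smul_mem g p⟩

theorem smul_inv (g : Torus k) (w : Torus a) (z : Fin l → ℂ) (x : Fin m → ℝ) :
    g • c.inv w z x = c.inv ((c.generators g).1 * w) (fun j => ((c.generators g).2 j : ℂ) * z j) x := by
  have h := c.inv_mem w z x
  refine c.eq_of_coords (c.smul_mem g _ h) (c.inv_mem _ _ _) ?_ ?_ ?_
  · rw [c.w_smul g _ h, c.w_inv, c.w_inv]
  · rw [c.z_smul g _ h, c.z_inv, c.z_inv]
  · rw [c.x_smul g _ h, c.x_inv, c.x_inv]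

/-- Points with the same `|z|` and `x` lie on the same orbit. -/
theorem exists_smul_eq {p q : M} (hp : p ∈ c.source) (hq : q ∈ c.source)
    (h : sqMap (c.coord p) = sqMap (c.coord q)) : ∃ g : Torus k, g • p = q := by
  have hz : ∀ j, ∃ u : Circle, (u : ℂ) * c.z p j = c.z q j := fun j => by
    have hj : ‖c.z p j‖ ^ 2 = ‖c.z q j‖ ^ 2 := congrFun (congrArg Prod.fst h) j
    have hj' : ‖c.z p j‖ = ‖c.z q j‖ := by
      rwa [sq_eq_sq₀ (norm_nonneg _) (norm_nonneg _)] at hj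
    by_cases h0 : c.z p j = 0
    · refine ⟨1, ?_⟩
      rw [h0, norm_zero] at hj'
      rw [h0, norm_eq_zero.mp hj'.symm, mul_zero]
    · have h1 : ‖c.z q j / c.z p j‖ = 1 := by
        rw [norm_div, ← hj', div_self (norm_ne_zero_iff.mpr h0)]
      exact ⟨⟨c.z q j / c.z p j, mem_sphere_zero_iff_norm.mpr h1⟩, div_mul_cancel₀ _ h0⟩
  choose u hu using hz
  refine ⟨c.generators.symm (c.w q * (c.w p)⁻¹, u), ?_⟩
  refine c.eq_of_coords (c.smul_mem _ _ hp) hq ?_ ?_ ?_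
  · rw [c.w_smul _ _ hp]; simp
  · rw [c.z_smul _ _ hp]; simp [hu]
  · rw [c.x_smul _ _ hp]; exact congrArg Prod.snd h

theorem exists_smul_sec {p : M} (hp : p ∈ c.source) {v : Slice l m}
    (h : sqMap v = sqMap (c.coord p)) : ∃ g : Torus k, g • c.sec v = p :=
  c.exists_smul_eq (c.sec_mem v) hp (by rw [coord_sec, h])

theorem exists_smul_sec_coord {p : M} (hp : p ∈ c.source) : ∃ g : Torus k,
    g • c.sec (c.coord p) = p := c.exists_smul_sec hp rfl

theorem sqMap_coord_smul (g : Torus k) {p : M} (hp : p ∈ c.source) :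
    sqMap (c.coord (g • p)) = sqMap (c.coord p) := by
  simp only [sqMap, coord, c.z_smul g p hp, c.x_smul g p hp, norm_mul, Circle.norm_coe, one_mul]

theorem smul_eq_self_iff (g : Torus k) {p : M} (hp : p ∈ c.source) :
    g • p = p ↔ (c.generators g).1 = 1 ∧ ∀ j, c.z p j ≠ 0 → (c.generators g).2 j = 1 := by
  constructor
  · intro h
    refine ⟨?_, fun j hj => ?_⟩
    · have h₁ := c.w_smul g p hp
      rw [h] at h₁
      exact right_eq_mul.mp h₁
    · have h₁ := congrFun (c.z_smul g p hp) j
      rw [h] at h₁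
      exact Circle.ext (by simpa using (mul_right_cancel₀ hj ((one_mul _).trans h₁)).symm)
  · rintro ⟨h₁, h₂⟩
    refine c.eq_of_coords (c.smul_mem g p hp) hp ?_ ?_ (c.x_smul g p hp)
    · rw [c.w_smul g p hp, h₁, one_mul]
    · rw [c.z_smul g p hp]
      funext j
      by_cases hj : c.z p j = 0
      · simp [hj]
      · simp [h₂ j hj]

/-- The inverse of a standard chart is smooth, as a map defined on `T^a × ℂ^l × ℝ^m`. -/
theorem contMDiffOn_inv_comp {E H X : Type*} [NormedAddCommGroup E] [NormedSpace ℝ E]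
    [TopologicalSpace H] {I : ModelWithCorners ℝ E H} [TopologicalSpace X] [ChartedSpace H X]
    {s : Set X} (hs : IsOpen s) {w : X → Torus a} {v : X → Slice l m}
    (hw : ∀ i, ContMDiffOn I (𝓡 1) ∞ (fun q => w q i) s)
    (hv : ContMDiffOn I 𝓘(ℝ, Slice l m) ∞ v s) :
    ContMDiffOn I (𝓡 n) ∞ (fun q => c.inv (w q) (v q).1 (v q).2) s := by
  intro p hp
  obtain ⟨O, hO, hpO, hOs, θ, hθ, he⟩ := exists_torus_angle hs hw hp
  have h₁ : ContMDiffOn I 𝓘(ℝ, (Fin a → ℝ) × (Fin l → ℂ) × (Fin m → ℝ)) ∞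
      (fun q => (θ q, v q)) O := hθ.prodMk_space (hv.mono hOs)
  have h₂ := c.contMDiff_inv.comp_contMDiffOn h₁
  have h₃ : ContMDiffAt I (𝓡 n) ∞ (fun q => c.inv (w q) (v q).1 (v q).2) p := by
    refine ((h₂ p hpO).contMDiffAt (hO.mem_nhds hpO)).congr_of_eventuallyEq ?_
    filter_upwards [hO.mem_nhds hpO] with q hq
    simp [he q hq]
  exact h₃.contMDiffWithinAt

end StandardChart

/-! ### Invariant functions and cutoffs -/

/-- Extension by zero of a function which is smooth on a neighbourhood of the support. -/
def extendByZero (ψ : C^∞⟮𝓡 n, M; ℝ⟯) {K s : Set M} (hK : IsClosed K) (hψ : ∀ p ∉ K, ψ p = 0)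
    (hs : IsOpen s) (hKs : K ⊆ s) {g : M → ℝ} (hg : ContMDiffOn (𝓡 n) 𝓘(ℝ) ∞ g s) :
    C^∞⟮𝓡 n, M; ℝ⟯ := by
  refine ⟨fun p => ψ p * g p, fun p => ?_⟩
  by_cases hp : p ∈ s
  · exact (ψ.contMDiff p).mul ((hg p hp).contMDiffAt (hs.mem_nhds hp))
  · refine (contMDiffAt_const (c := (0 : ℝ))).congr_of_eventuallyEq ?_
    filter_upwards [hK.isOpen_compl.mem_nhds fun h => hp (hKs h)] with q hq
    rw [hψ q hq, zero_mul]

/-- An invariant smooth function on `M`, as a function on the quotient. -/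
def descend (s : C^∞⟮𝓡 n, M; ℝ⟯) (hs : ∀ (g : Torus k) (p : M), s (g • p) = s p) :
    smoothFunctions n k M :=
  ⟨Quotient.lift s (by rintro p q ⟨g, rfl⟩; exact hs g q), s.contMDiff⟩

@[simp] theorem quotientPullback_descend (s : C^∞⟮𝓡 n, M; ℝ⟯)
    (hs : ∀ (g : Torus k) (p : M), s (g • p) = s p) :
    quotientPullback n k M (descend s hs) = s := rfl

@[simp] theorem descend_apply (s : C^∞⟮𝓡 n, M; ℝ⟯)
    (hs : ∀ (g : Torus k) (p : M), s (g • p) = s p) (p : M) :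
    (descend s hs).1 (orbitMap p) = s p := rfl

theorem quotientPullback_apply (f : smoothFunctions n k M) (p : M) :
    quotientPullback n k M f p = f.1 (orbitMap p) := rfl

theorem quotientPullback_smul (f : smoothFunctions n k M) (g : Torus k) (p : M) :
    quotientPullback n k M f (g • p) = quotientPullback n k M f p := by
  rw [quotientPullback_apply, orbitMap_smul, quotientPullback_apply]

theorem smoothFunctions_ext {f g : smoothFunctions n k M}
    (h : ∀ p : M, f.1 (orbitMap p) = g.1 (orbitMap p)) : f = g :=
  Subtype.ext (funext fun b => by obtain ⟨p, rfl⟩ := orbitMap_surjective b; exact h p)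

theorem quotientPullback_injective : Function.Injective (quotientPullback n k M) := fun _ _ h =>
  smoothFunctions_ext fun p => congrArg (fun s : C^∞⟮𝓡 n, M; ℝ⟯ => s p) h

namespace StandardChart

variable {a l m : ℕ} (c : StandardChart n k M a l m)

theorem continuousOn_sqMap_coord : ContinuousOn (fun p => sqMap (c.coord p)) c.source :=
  contDiff_sqMap.continuous.comp_continuousOn c.contMDiffOn_coord.continuousOn

/-- `sqMap` is proper: a bound r on |z_j|² bounds |z_j| by 1 + r, because 2|z_j| ≤ 1 + |z_j|². -/
theorem isCompact_sqMap_preimage {C : Set ((Fin l → ℝ) × (Fin m → ℝ))} (hC : IsCompact C) :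
    IsCompact (sqMap ⁻¹' C : Set (Slice l m)) := by
  refine Metric.isCompact_of_isClosed_isBounded (hC.isClosed.preimage contDiff_sqMap.continuous) ?_
  obtain ⟨r, hr⟩ := hC.isBounded.exists_norm_le
  refine isBounded_iff_forall_norm_le.mpr ⟨1 + r, fun v hv => ?_⟩
  have h := hr _ hv
  have h₁ : ∀ j, ‖v.1 j‖ ^ 2 ≤ r := fun j => by
    have := (norm_le_pi_norm (sqMap v).1 j).trans ((norm_fst_le (sqMap v)).trans h)
    simpa [sqMap] using this
  have r0 : 0 ≤ r := (norm_nonneg _).trans h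
  refine norm_prod_le_iff.mpr ⟨(pi_norm_le_iff_of_nonneg (by linarith)).mpr fun j => ?_, ?_⟩
  · nlinarith [h₁ j, sq_nonneg (‖v.1 j‖ - 1)]
  · exact (norm_snd_le (sqMap v)).trans (h.trans (by linarith))

/-- The points of the chart whose coordinates `(|z|², x)` lie in `C`. -/
def tube (C : Set ((Fin l → ℝ) × (Fin m → ℝ))) : Set M := {p ∈ c.source | sqMap (c.coord p) ∈ C}

/-- The box [-π, π]^a already covers the torus factor, so the tube is the image of a compact set
under the inverse chart. In a Hausdorff manifold the tube is then closed, as extension by zero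
requires. -/
theorem isCompact_tube {C : Set ((Fin l → ℝ) × (Fin m → ℝ))} (hC : IsCompact C) :
    IsCompact (c.tube C) := by
  have hA : IsCompact (Set.univ.pi fun _ : Fin a => Icc (-Real.pi) Real.pi) :=
    isCompact_univ_pi fun _ => isCompact_Icc
  have h := (hA.prod (isCompact_sqMap_preimage hC)).image c.contMDiff_inv.continuous
  convert h using 1
  ext p
  constructor
  · rintro ⟨hp, hpC⟩
    refine ⟨(fun i => (c.w p i : ℂ).arg, c.coord p),
      ⟨fun i _ => ⟨(Complex.neg_pi_lt_arg _).le, Complex.arg_le_pi _⟩, hpC⟩, ?_⟩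
    have e : torusExp (fun i => (c.w p i : ℂ).arg) = c.w p := funext fun i => Circle.exp_arg _
    simp only [e, coord, c.left_inv p hp]
  · rintro ⟨⟨θ, v⟩, ⟨-, hv⟩, rfl⟩
    exact ⟨c.inv_mem _ _ _, by simpa [coord, c.z_inv, c.x_inv] using hv⟩

theorem isOpen_tube {C : Set ((Fin l → ℝ) × (Fin m → ℝ))} (hC : IsOpen C) : IsOpen (c.tube C) :=
  c.continuousOn_sqMap_coord.isOpen_inter_preimage c.isOpen_source hC

variable [T2Space M]

open Classical in
/-- The function on the quotient which is a given compactly supported function of the coordinates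
`(|z|², x)` in a chart, and zero outside of the chart. -/
def cutoff (β : (Fin l → ℝ) × (Fin m → ℝ) → ℝ) (hβ : ContDiff ℝ ∞ β) (hc : HasCompactSupport β) :
    smoothFunctions n k M := by
  refine descend ⟨fun p => if p ∈ c.source then β (sqMap (c.coord p)) else 0, fun p => ?_⟩ ?_
  · by_cases hp : p ∈ c.source
    · have h := ((hβ.comp contDiff_sqMap).contMDiff.comp_contMDiffOn c.contMDiffOn_coord)
      refine ((h p hp).contMDiffAt (c.isOpen_source.mem_nhds hp)).congr_of_eventuallyEq ?_
      filter_upwards [c.isOpen_source.mem_nhds hp] with q hq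
      rw [if_pos hq]
      rfl
    · refine (contMDiffAt_const (c := (0 : ℝ))).congr_of_eventuallyEq ?_
      have hK := (c.isCompact_tube hc).isClosed
      filter_upwards [hK.isOpen_compl.mem_nhds fun h => hp h.1] with q hq
      split_ifs with hqs
      · exact image_eq_zero_of_notMem_tsupport fun h => hq ⟨hqs, h⟩
      · rfl
  · intro g p
    change (if _ then _ else _) = if _ then _ else _
    simp only [c.smul_mem_iff g]
    split_ifs with hp
    · rw [c.sqMap_coord_smul g hp]
    · rfl

theorem cutoff_of_mem {β : (Fin l → ℝ) × (Fin m → ℝ) → ℝ} (hβ : ContDiff ℝ ∞ β)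
    (hc : HasCompactSupport β) {p : M} (hp : p ∈ c.source) :
    (c.cutoff β hβ hc).1 (orbitMap p) = β (sqMap (c.coord p)) := if_pos hp

theorem cutoff_of_notMem {β : (Fin l → ℝ) × (Fin m → ℝ) → ℝ} (hβ : ContDiff ℝ ∞ β)
    (hc : HasCompactSupport β) {p : M} (hp : p ∉ c.tube (tsupport β)) :
    (c.cutoff β hβ hc).1 (orbitMap p) = 0 := by
  by_cases hs : p ∈ c.source
  · rw [cutoff_of_mem c hβ hc hs]
    exact image_eq_zero_of_notMem_tsupport fun h => hp ⟨hs, h⟩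
  · exact if_neg hs

end StandardChart

end TorusAction
end

noncomputable section

namespace TorusAction

open LogForms Set

/-! ### Free orbits and the boundary -/

/-- The phase of a complex number. -/
def phase (z : ℂ) : Circle := Circle.exp z.arg

theorem norm_mul_phase (z : ℂ) : (‖z‖ : ℂ) * phase z = z := by
  rw [phase, Circle.coe_exp]
  exact Complex.norm_mul_exp_arg_mul_I z

theorem phase_mul (u : Circle) {z : ℂ} (hz : z ≠ 0) : phase (u * z) = u * phase z := by
  have h := norm_mul_phase (u * z)
  rw [norm_mul, Circle.norm_coe, one_mul] at h
  refine Circle.ext (mul_left_cancel₀ (a := (‖z‖ : ℂ)) ?_ ?_)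
  · exact_mod_cast norm_ne_zero_iff.mpr hz
  · rw [h, Circle.coe_mul, mul_left_comm, norm_mul_phase]

theorem phase_real_mul {r : ℝ} (hr : 0 < r) (u : Circle) : phase (r * u) = u := by
  rw [phase, Complex.arg_real_mul _ hr, Circle.exp_arg]

-- Rotating z to the positive real axis puts it into the slit plane, where the imaginary part of the
-- logarithm is a smooth argument; the rotation is undone after exponentiation.
attribute [local instance] finrank_real_complex_fact' in
theorem contMDiffAt_phase {z : ℂ} (hz : z ≠ 0) : ContMDiffAt 𝓘(ℝ, ℂ) (𝓡 1) ∞ phase z := by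
  have mem : z * ((phase z)⁻¹ : Circle) ∈ Complex.slitPlane := by
    have e : z * ((phase z)⁻¹ : Circle) = (‖z‖ : ℂ) := by
      conv_lhs => rw [← norm_mul_phase z]
      rw [mul_assoc]
      simp [phase]
    rw [e]
    exact Complex.ofReal_mem_slitPlane.mpr (norm_pos_iff.mpr hz)
  have h₁ : ContDiffAt ℝ ∞ (fun y : ℂ => (Complex.log (y * ((phase z)⁻¹ : Circle))).im
      + (phase z : ℂ).arg) z := by
    have h : ContDiffAt ℝ ∞ (fun y : ℂ => Complex.log (y * ((phase z)⁻¹ : Circle))) z := by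
      refine ContDiffAt.comp z ((Complex.contDiffAt_log ?_).restrict_scalars ℝ) (by fun_prop)
      exact mem
    exact (Complex.imCLM.contDiff.contDiffAt.comp z h).add contDiffAt_const
  have h₂ := (contMDiff_circleExp (m := ∞)).contMDiffAt.comp z h₁.contMDiffAt
  refine h₂.congr_of_eventuallyEq ?_
  filter_upwards [isOpen_ne.mem_nhds hz] with y hy
  simp only [Function.comp_apply, Circle.exp_add, Circle.exp_arg, Complex.log_im]
  have e := phase_mul (phase z)⁻¹ hy
  rw [mul_comm (y : ℂ)]
  change _ = Circle.exp _ * _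
  rw [← phase, e, mul_comm, mul_inv_cancel_left]

variable {n k : ℕ} {M : Type*} [TopologicalSpace M] [ChartedSpace (EuclideanSpace ℝ (Fin n)) M]
  [MulAction (Torus k) M]

variable (k) in
/-- The torus acts freely on the orbit of `p`. -/
def IsFree (p : M) : Prop := ∀ g : Torus k, g • p = p → g = 1

omit [TopologicalSpace M] in
theorem isFree_smul (g : Torus k) {p : M} : IsFree k (g • p) ↔ IsFree k p := by
  have h : ∀ (g : Torus k) (p : M), IsFree k p → IsFree k (g • p) := fun g p hp u hu => hp u (by
    rwa [smul_smul, mul_comm, ← smul_smul, smul_left_cancel_iff] at hu)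
  exact ⟨fun hp => by simpa using h g⁻¹ _ hp, h g p⟩

namespace StandardChart

variable {a l m : ℕ} (c : StandardChart n k M a l m)

/-- The stabiliser of p is the product of the circles belonging to the vanishing z_j. If one z_j is
zero, the element -1 = exp(iπ) of its circle is a nontrivial stabilising element. -/
theorem isFree_iff {p : M} (hp : p ∈ c.source) : IsFree k p ↔ ∀ j, c.z p j ≠ 0 := by
  constructor
  · intro h j hj
    have h₁ := h (c.generators.symm (1, Pi.mulSingle j (Circle.exp Real.pi))) <| by
      rw [c.smul_eq_self_iff _ hp]
      simp only [ContinuousMulEquiv.apply_symm_apply, true_and]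
      intro i hi
      exact Pi.mulSingle_eq_of_ne (by rintro rfl; exact hi hj) _
    rw [EmbeddingLike.map_eq_one_iff, Prod.mk_eq_one, Pi.mulSingle_eq_one_iff] at h₁
    have := congrArg (fun z : Circle => (z : ℂ).re) h₁.2
    simp [Circle.coe_exp] at this
    norm_num at this
  · intro h g hg
    rw [c.smul_eq_self_iff _ hp] at hg
    have : c.generators g = 1 := Prod.ext hg.1 (funext fun j => hg.2 j (h j))
    simpa using this

/-- The regrouping of generators `T^a × T^{l+1} ≃ T^{a+1} × T^l`. -/
def moveGenerator (a : ℕ) {l : ℕ} (j : Fin (l + 1)) :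
    Torus a × Torus (l + 1) ≃ₜ* Torus (a + 1) × Torus l where
  toFun g := (Fin.cons (g.2 j) g.1, fun i => g.2 (j.succAbove i))
  invFun g := (fun i => g.1 i.succ, j.insertNth (g.1 0) g.2)
  left_inv g := by
    refine Prod.ext rfl (funext fun i => ?_)
    refine Fin.succAboveCases j ?_ (fun i => ?_) i <;> simp
  right_inv g := by
    refine Prod.ext (funext fun i => ?_) (funext fun i => ?_)
    · refine Fin.cases ?_ (fun i => ?_) i <;> simp
    · simp
  map_mul' g h := by
    refine Prod.ext (funext fun i => ?_) rfl
    refine Fin.cases ?_ (fun i => ?_) i <;> simp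
  continuous_toFun := by
    refine Continuous.prodMk (continuous_pi fun i => ?_) (by fun_prop)
    refine Fin.cases ?_ (fun i => ?_) i
    · simp only [Fin.cons_zero]; fun_prop
    · simp only [Fin.cons_succ]; fun_prop
  continuous_invFun := by
    refine Continuous.prodMk (by fun_prop) (continuous_pi fun i => ?_)
    refine Fin.succAboveCases j ?_ (fun i => ?_) i
    · simp only [Fin.insertNth_apply_same]; fun_prop
    · simp only [Fin.insertNth_apply_succAbove]; fun_prop

attribute [local instance] finrank_real_complex_fact' in
/-- The standard chart obtained by restriction to `z_j ≠ 0`, with polar coordinates for `z_j`. -/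
def dropZ {l : ℕ} (c : StandardChart n k M a (l + 1) m) (j : Fin (l + 1)) :
    StandardChart n k M (a + 1) l (m + 1) where
  generators := c.generators.trans (moveGenerator a j)
  source := {p ∈ c.source | c.z p j ≠ 0}
  isOpen_source := c.contMDiffOn_z.continuousOn.isOpen_inter_preimage c.isOpen_source
    (t := (fun z : Fin (l + 1) → ℂ => z j) ⁻¹' {z | z ≠ 0})
    (isOpen_ne.preimage (continuous_apply j))
  smul_mem g p hp := ⟨c.smul_mem g p hp.1, by simpa [c.z_smul g p hp.1] using hp.2⟩
  w p := Fin.cons (phase (c.z p j)) (c.w p)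
  z p i := c.z p (j.succAbove i)
  -- The logarithm turns the radius in (0, ∞) into a coordinate filling ℝ, since a standard chart
  -- must be onto its model.
  x p := Fin.cons (Real.log ‖c.z p j‖) (c.x p)
  inv w z x := c.inv (fun i => w i.succ) (j.insertNth ((Real.exp (x 0) : ℝ) * (w 0 : ℂ)) z)
    (fun i => x i.succ)
  inv_mem w z x := ⟨c.inv_mem _ _ _, by simp [c.z_inv]⟩
  left_inv p hp := by
    have h : ((Real.exp (Real.log ‖c.z p j‖) : ℝ) : ℂ) * (phase (c.z p j) : ℂ) = c.z p j := by
      rw [Real.exp_log (norm_pos_iff.mpr hp.2), norm_mul_phase]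
    simp only [Fin.cons_zero, Fin.cons_succ, h]
    convert c.left_inv p hp.1 using 2
    funext i
    refine Fin.succAboveCases j ?_ (fun i => ?_) i <;> simp
  w_inv w z x := by
    funext i
    refine Fin.cases ?_ (fun i => ?_) i
    · simp only [Fin.cons_zero, c.z_inv, Fin.insertNth_apply_same]
      exact phase_real_mul (Real.exp_pos _) _
    · simp [c.w_inv]
  z_inv w z x := by simp [c.z_inv]
  x_inv w z x := by
    funext i
    refine Fin.cases ?_ (fun i => ?_) i
    · simp only [c.z_inv, Fin.insertNth_apply_same, Fin.cons_zero, norm_mul, Circle.norm_coe,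
        mul_one, Complex.norm_real, Real.norm_eq_abs, Real.abs_exp, Real.log_exp]
    · simp [c.x_inv]
  contMDiffOn_w i := by
    have hz : ContMDiffOn (𝓡 n) 𝓘(ℝ, ℂ) ∞ (fun p => c.z p j) c.source :=
      contMDiffOn_pi_space.mp c.contMDiffOn_z j
    refine Fin.cases ?_ (fun i => ?_) i
    · simp only [Fin.cons_zero]
      exact fun p hp => ContMDiffAt.comp_contMDiffWithinAt (g := phase) p
        (contMDiffAt_phase hp.2) ((hz p hp.1).mono (sep_subset _ _))
    · simp only [Fin.cons_succ]
      exact (c.contMDiffOn_w i).mono fun q hq => hq.1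
  contMDiffOn_z := by
    rw [contMDiffOn_pi_space]
    exact fun i => (contMDiffOn_pi_space.mp c.contMDiffOn_z _).mono fun q hq => hq.1
  contMDiffOn_x := by
    have hz : ContMDiffOn (𝓡 n) 𝓘(ℝ, ℂ) ∞ (fun p => c.z p j) c.source :=
      contMDiffOn_pi_space.mp c.contMDiffOn_z j
    rw [contMDiffOn_pi_space]
    refine fun i => Fin.cases ?_ (fun i => ?_) i
    · simp only [Fin.cons_zero]
      intro p hp
      have h : ContDiffAt ℝ ∞ (fun z : ℂ => Real.log ‖z‖) (c.z p j) :=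
        (contDiffAt_norm ℝ hp.2).log (norm_ne_zero_iff.mpr hp.2)
      exact h.contMDiffAt.comp_contMDiffWithinAt p ((hz p hp.1).mono (sep_subset _ _))
    · simp only [Fin.cons_succ]
      exact (contMDiffOn_pi_space.mp c.contMDiffOn_x i).mono fun q hq => hq.1
  contMDiff_inv := by
    have h : ContDiff ℝ ∞ fun p : (Fin (a + 1) → ℝ) × (Fin l → ℂ) × (Fin (m + 1) → ℝ) =>
        ((fun i : Fin a => p.1 i.succ), (j.insertNth ((Real.exp (p.2.2 0) : ℝ) *
          (Circle.exp (p.1 0) : ℂ)) p.2.1 : Fin (l + 1) → ℂ), fun i : Fin m => p.2.2 i.succ) := by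
      refine ContDiff.prodMk (by fun_prop) (ContDiff.prodMk (contDiff_pi.mpr fun i => ?_)
        (by fun_prop))
      refine Fin.succAboveCases j ?_ (fun i => ?_) i
      · simp only [Fin.insertNth_apply_same, Circle.coe_exp]
        have e₁ : ContDiff ℝ ∞ fun p : (Fin (a + 1) → ℝ) × (Fin l → ℂ) × (Fin (m + 1) → ℝ) =>
          Real.exp (p.2.2 0) := by fun_prop
        have e₂ : ContDiff ℝ ∞ fun p : (Fin (a + 1) → ℝ) × (Fin l → ℂ) × (Fin (m + 1) → ℝ) =>
          p.1 0 := by fun_prop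
        exact (Complex.ofRealCLM.contDiff.comp e₁).mul
          ((Complex.ofRealCLM.contDiff.comp e₂).mul contDiff_const).cexp
      · simp only [Fin.insertNth_apply_succAbove]; fun_prop
    exact c.contMDiff_inv.comp h.contMDiff
  w_smul g p hp := by
    funext i
    refine Fin.cases ?_ (fun i => ?_) i
    · simp [c.z_smul g p hp.1, phase_mul _ hp.2, moveGenerator]
    · simp [c.w_smul g p hp.1, moveGenerator]
  z_smul g p hp := by
    funext i
    simp [c.z_smul g p hp.1, moveGenerator]
  x_smul g p hp := by
    simp only [c.z_smul g p hp.1, c.x_smul g p hp.1, norm_mul, Circle.norm_coe, one_mul]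

/-- Around each point of a standard chart there is a standard chart centred at it. -/
theorem exists_centred (c : StandardChart n k M a l m) {p : M} (hp : p ∈ c.source) :
    ∃ (a' l' m' : ℕ) (c' : StandardChart n k M a' l' m'), p ∈ c'.source ∧ c'.z p = 0 := by
  induction l generalizing a m with
  | zero => exact ⟨_, _, _, c, hp, Subsingleton.elim _ _⟩
  | succ l ih =>
    by_cases h : c.z p = 0
    · exact ⟨_, _, _, c, hp, h⟩
    · obtain ⟨j, hj⟩ := Function.ne_iff.mp h
      exact ih (c.dropZ j) ⟨hp, hj⟩

end StandardChart

theorem IsStandard.exists_centred (hM : IsStandard n k M) (p : M) :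
    ∃ (a l m : ℕ) (c : StandardChart n k M a l m), p ∈ c.source ∧ c.z p = 0 := by
  obtain ⟨a, l, m, c, hp⟩ := hM p
  exact c.exists_centred hp

/-- Free orbits have charts without complex coordinates. -/
theorem IsStandard.exists_chart_of_isFree (hM : IsStandard n k M) {p : M} (hp : IsFree k p) :
    ∃ (a m : ℕ) (c : StandardChart n k M a 0 m), p ∈ c.source := by
  obtain ⟨a, l, m, c, hpc, hz⟩ := hM.exists_centred p
  rcases l with _ | l
  · exact ⟨a, m, c, hpc⟩
  · exact absurd (congrFun hz 0) ((c.isFree_iff hpc).mp hp 0)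

/-- The boundary consists of the orbits which are not free. -/
theorem IsStandard.mem_boundary_iff (hM : IsStandard n k M) {p : M} :
    orbitMap p ∈ boundary n k M ↔ ¬ IsFree k p := by
  simp only [boundary, mem_iUnion]
  constructor
  · rintro ⟨i, hi, a, m, c, q, hq, hqp, hz⟩ hp
    obtain ⟨g, rfl⟩ := orbitMap_eq_iff.mp hqp
    exact (c.isFree_iff hq).mp ((isFree_smul g).mpr hp) ⟨0, hi⟩ (congrFun hz _)
  · intro hp
    obtain ⟨a, l, m, c, hpc, hz⟩ := hM.exists_centred p
    refine ⟨l, ?_, a, m, c, p, hpc, rfl, hz⟩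
    by_contra hl
    obtain rfl : l = 0 := by omega
    exact hp ((c.isFree_iff hpc).mpr fun j => j.elim0)

namespace StandardChart

variable {a l m : ℕ} (c : StandardChart n k M a l m)

theorem mem_boundary_iff (hM : IsStandard n k M) {p : M} (hp : p ∈ c.source) :
    orbitMap p ∈ boundary n k M ↔ ∃ j, c.z p j = 0 := by
  rw [hM.mem_boundary_iff, c.isFree_iff hp]
  push Not
  rfl

theorem continuous_inv (w : Torus a) : Continuous fun v : Slice l m => c.inv w v.1 v.2 := by
  obtain ⟨θ, rfl⟩ := torusExp_surjective w
  exact c.contMDiff_inv.continuous.comp (by fun_prop : Continuous fun v : Slice l m =>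
    (θ, v.1, v.2))

/-- Points with prescribed vanishing coordinates `z_j`, `j ∈ J`, are limits of points where the
other coordinates do not vanish. -/
theorem mem_closure_of_vanishing (J : Set (Fin l)) {p : M} (hp : p ∈ c.source)
    (hJ : ∀ j ∈ J, c.z p j = 0) :
    p ∈ closure {q ∈ c.source | ∀ j, c.z q j = 0 ↔ j ∈ J} := by
  classical
  -- The vanishing coordinates outside J are moved to the value s ≠ 0; all others are kept.
  let v : ℝ → Slice l m := fun s =>
    (fun j => if c.z p j = 0 then (if j ∈ J then 0 else (s : ℂ)) else c.z p j, c.x p)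
  have hv : Continuous v := by
    refine Continuous.prodMk (continuous_pi fun j => ?_) continuous_const
    split_ifs
    · exact continuous_const
    · exact Complex.continuous_ofReal
    · exact continuous_const
  have h := (((c.continuous_inv (c.w p)).comp hv).tendsto 0).mono_left
    (nhdsWithin_le_nhds (s := {0}ᶜ))
  have e : c.inv (c.w p) (v 0).1 (v 0).2 = p := by
    conv_rhs => rw [← c.left_inv p hp]
    congr 1
    funext j
    simp only [v]
    split_ifs with h <;> simp [h]
  simp only [Function.comp_apply, e] at h
  refine mem_closure_of_tendsto h ?_
  filter_upwards [self_mem_nhdsWithin] with s hs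
  refine ⟨c.inv_mem _ _ _, fun j => ?_⟩
  have hs' : (s : ℂ) ≠ 0 := Complex.ofReal_ne_zero.mpr hs
  rw [Function.comp_apply, c.z_inv]
  simp only [v]
  split_ifs with h₁ h₂
  · simp [h₂]
  · simp [h₂, hs']
  · exact ⟨fun h => absurd h h₁, fun h => absurd (hJ j h) h₁⟩

end StandardChart

/-- The case J = ∅ of `mem_closure_of_vanishing`: every vanishing coordinate can be made nonzero by
a small change. -/
theorem IsStandard.dense_isFree (hM : IsStandard n k M) : Dense {p : M | IsFree k p} := by
  intro p
  obtain ⟨a, l, m, c, hp⟩ := hM p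
  refine closure_mono ?_ (c.mem_closure_of_vanishing ∅ hp (by simp))
  rintro q ⟨hq, h⟩
  exact (c.isFree_iff hq).mpr fun j hj => by simpa using (h j).mp hj

theorem IsStandard.ext_of_isFree (hM : IsStandard n k M) {f g : C^∞⟮𝓡 n, M; ℝ⟯}
    (h : ∀ p, IsFree k p → f p = g p) : f = g := by
  have := Continuous.ext_on hM.dense_isFree f.contMDiff.continuous g.contMDiff.continuous h
  exact ContMDiffMap.ext (congrFun this)

/-- An identity of continuous functions holds on an open set if it holds on the free orbits. -/
theorem IsStandard.eqOn_of_isFree (hM : IsStandard n k M) {f g : M → ℝ} {O : Set M}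
    (hO : IsOpen O) (hf : ContinuousOn f O) (hg : ContinuousOn g O)
    (h : ∀ p ∈ O, IsFree k p → f p = g p) : ∀ p ∈ O, f p = g p := by
  intro p hp
  have hcl : p ∈ closure (O ∩ {p : M | IsFree k p}) :=
    hM.dense_isFree.open_subset_closure_inter hO hp
  have hne : (𝓝[O ∩ {p : M | IsFree k p}] p).NeBot := mem_closure_iff_nhdsWithin_neBot.mp hcl
  have hf' := ((hf p hp).mono (inter_subset_left (t := {p : M | IsFree k p}))).tendsto
  have hg' := ((hg p hp).mono (inter_subset_left (t := {p : M | IsFree k p}))).tendsto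
  refine tendsto_nhds_unique_of_eventuallyEq hf' hg' ?_
  filter_upwards [self_mem_nhdsWithin] with q hq
  exact h q hq.1 hq.2

/-! ### Invariant bump functions -/

theorem isOpenMap_orbitMap [SmoothTorusAction n k M] : IsOpenMap (orbitMap (k := k) (M := M)) := by
  have : ContinuousConstSMul (Torus k) M := ⟨fun g => (contMDiff_smul n k M g).continuous⟩
  exact isOpenMap_quotient_mk'_mul

namespace StandardChart

variable {a l m : ℕ} (c : StandardChart n k M a l m)

/-- The tubes form a basis of the invariant neighbourhoods. -/
theorem exists_tube_subset {O : Set M} (hO : IsOpen O) (hinv : ∀ (g : Torus k), ∀ p ∈ O, g • p ∈ O)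
    {p : M} (hp : p ∈ c.source) (hpO : p ∈ O) :
    ∃ r > 0, c.tube (Metric.closedBall (sqMap (c.coord p)) r) ⊆ O := by
  -- The continuous choice z_j = √(t_j) of a slice point in each orbit. It makes the condition of
  -- meeting O an open condition on (|z|², x).
  let σ : (Fin l → ℝ) × (Fin m → ℝ) → Slice l m := fun y => (fun j => (Real.sqrt (y.1 j) : ℂ), y.2)
  have hσ : Continuous σ := by fun_prop
  have hsq : ∀ v : Slice l m, sqMap (σ (sqMap v)) = sqMap v := fun v => by
    simp [σ, sqMap, Real.sqrt_sq (norm_nonneg _)]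
  have hopen : IsOpen {y | c.sec (σ y) ∈ O} := hO.preimage (c.contMDiff_sec.continuous.comp hσ)
  have hmem : sqMap (c.coord p) ∈ {y | c.sec (σ y) ∈ O} := by
    obtain ⟨g, hg⟩ := c.exists_smul_sec hp (hsq (c.coord p))
    have e := eq_inv_smul_iff.mpr hg
    change c.sec _ ∈ O
    rw [e]
    exact hinv _ _ hpO
  obtain ⟨r, hr, hball⟩ := Metric.nhds_basis_closedBall.mem_iff.mp (hopen.mem_nhds hmem)
  refine ⟨r, hr, fun q hq => ?_⟩
  obtain ⟨g, hg⟩ := c.exists_smul_sec hq.1 (hsq (c.coord q))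
  rw [← hg]
  exact hinv g _ (hball hq.2)

theorem tube_smul {C : Set ((Fin l → ℝ) × (Fin m → ℝ))} (g : Torus k) {p : M}
    (hp : p ∈ c.tube C) : g • p ∈ c.tube C :=
  ⟨c.smul_mem g p hp.1, by rw [c.sqMap_coord_smul g hp.1]; exact hp.2⟩

variable [T2Space M]

/-- A compactly supported invariant function in a chart, with boundary coordinates which are correct
near its support. -/
structure Cut (c : StandardChart n k M a l m) where
  ψ : smoothFunctions n k M
  t : Fin l → smoothFunctions n k M
  x : Fin m → smoothFunctions n k M
  K : Set M
  U : Set M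
  isClosed_K : IsClosed K
  isOpen_U : IsOpen U
  subset_U : K ⊆ U
  subset_source : U ⊆ c.source
  smul_mem : ∀ (g : Torus k), ∀ p ∈ U, g • p ∈ U
  ψ_eq_zero : ∀ p ∉ K, ψ.1 (orbitMap p) = 0
  t_eq : ∀ p ∈ U, ∀ j, (t j).1 (orbitMap p) = ‖c.z p j‖ ^ 2
  x_eq : ∀ p ∈ U, ∀ j, (x j).1 (orbitMap p) = c.x p j

/-- A bump function makes g compactly supported without changing it near y₀, so that `cutoff`
applies. This supplies global functions on B with prescribed germs in (|z|², x). -/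
theorem exists_smooth_germ {g : (Fin l → ℝ) × (Fin m → ℝ) → ℝ} (hg : ContDiff ℝ ∞ g)
    (y₀ : (Fin l → ℝ) × (Fin m → ℝ)) {r : ℝ} (hr : 0 < r) :
    ∃ f : smoothFunctions n k M,
      ∀ p ∈ c.tube (Metric.ball y₀ r), f.1 (orbitMap p) = g (sqMap (c.coord p)) := by
  let χ : ContDiffBump y₀ := ⟨r, 2 * r, hr, by linarith⟩
  refine ⟨c.cutoff (fun y => χ y * g y) (χ.contDiff.mul hg) χ.hasCompactSupport.mul_right,
    fun p hp => ?_⟩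
  rw [c.cutoff_of_mem _ _ hp.1, χ.one_of_mem_closedBall (Metric.ball_subset_closedBall hp.2),
    one_mul]

/-- Cutoffs exist, with support in any given invariant neighbourhood. -/
theorem exists_cut {O : Set M} (hO : IsOpen O) (hinv : ∀ (g : Torus k), ∀ p ∈ O, g • p ∈ O)
    {p : M} (hp : p ∈ c.source) (hpO : p ∈ O) :
    ∃ C : Cut c, C.U ⊆ O ∧ ∀ᶠ q in 𝓝 p, C.ψ.1 (orbitMap q) = 1 := by
  obtain ⟨r, hr, hrO⟩ := c.exists_tube_subset hO hinv hp hpO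
  set y₀ := sqMap (c.coord p) with hy₀
  -- Three nested radii: ψ is one up to r/3, its support lies within r/2, and the coordinate
  -- functions are correct on the open ball of radius r.
  let β : ContDiffBump y₀ := ⟨r / 3, r / 2, by linarith, by linarith⟩
  have h₁ : ∀ j : Fin l, ContDiff ℝ ∞ fun y : (Fin l → ℝ) × (Fin m → ℝ) => y.1 j :=
    fun j => by fun_prop
  have h₂ : ∀ j : Fin m, ContDiff ℝ ∞ fun y : (Fin l → ℝ) × (Fin m → ℝ) => y.2 j :=
    fun j => by fun_prop
  choose t ht using fun j => c.exists_smooth_germ (h₁ j) y₀ hr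
  choose x hx using fun j => c.exists_smooth_germ (h₂ j) y₀ hr
  refine ⟨⟨c.cutoff β β.contDiff β.hasCompactSupport, t, x, c.tube (tsupport β),
    c.tube (Metric.ball y₀ r), (c.isCompact_tube β.hasCompactSupport).isClosed,
    c.isOpen_tube Metric.isOpen_ball, ?_, fun q hq => hq.1, fun g q hq => c.tube_smul g hq,
    fun q hq => c.cutoff_of_notMem _ _ hq, fun q hq j => ht j q hq, fun q hq j => hx j q hq⟩,
    ?_, ?_⟩
  · rintro q ⟨hq, hq'⟩
    rw [β.tsupport_eq] at hq'
    exact ⟨hq, Metric.closedBall_subset_ball (by simp [β]; linarith) hq'⟩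
  · exact (fun q hq => hrO ⟨hq.1, Metric.ball_subset_closedBall hq.2⟩)
  · have hmem : p ∈ c.tube (Metric.ball y₀ (r / 3)) := ⟨hp, Metric.mem_ball_self (by linarith)⟩
    filter_upwards [(c.isOpen_tube Metric.isOpen_ball).mem_nhds hmem] with q hq
    rw [c.cutoff_of_mem _ _ hq.1]
    exact β.one_of_mem_closedBall (Metric.ball_subset_closedBall hq.2)

end StandardChart

/-- Invariant bump functions. -/
theorem IsStandard.exists_bump [T2Space M] (hM : IsStandard n k M) {O : Set M} (hO : IsOpen O)
    (hinv : ∀ (g : Torus k), ∀ p ∈ O, g • p ∈ O) {p : M} (hpO : p ∈ O) :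
    ∃ ψ : smoothFunctions n k M, (∀ᶠ q in 𝓝 p, ψ.1 (orbitMap q) = 1) ∧
      ∀ q ∉ O, ψ.1 (orbitMap q) = 0 := by
  obtain ⟨a, l, m, c, hp⟩ := hM p
  obtain ⟨C, hC, h⟩ := c.exists_cut hO hinv hp hpO
  exact ⟨C.ψ, h, fun q hq => C.ψ_eq_zero q fun hK => hq (hC (C.subset_U hK))⟩

/-- Around a free orbit there are functions in the boundary ideal equal to one. -/
theorem IsStandard.exists_mem_boundaryIdeal [T2Space M] (hM : IsStandard n k M) {p : M}
    (hp : IsFree k p) : ∃ P ∈ boundaryIdeal n k M, P.1 (orbitMap p) = 1 := by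
  obtain ⟨a, m, c, hpc⟩ := hM.exists_chart_of_isFree hp
  obtain ⟨ψ, h₁, h₀⟩ := hM.exists_bump c.isOpen_source c.smul_mem hpc
  refine ⟨ψ, fun b hb => ?_, h₁.self_of_nhds⟩
  obtain ⟨q, rfl⟩ := orbitMap_surjective b
  by_cases hq : q ∈ c.source
  · obtain ⟨j, -⟩ := (c.mem_boundary_iff hM hq).mp hb
    exact j.elim0
  · exact h₀ q hq

end TorusAction
end

noncomputable section

namespace LogForms

open Filter

/-! ### Derivations of function algebras -/

section Hadamard

variable {A X : Type*} [CommRing A] [Algebra ℝ A] [TopologicalSpace X] {φ : A →ₐ[ℝ] (X → ℝ)}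
  {D : Derivation ℝ A A} {p : X}

omit [TopologicalSpace X] in
-- The Leibniz rule for χf = 0 at a point where χ = 1 and f = 0. All locality statements for
-- derivations, on M, on B and on the stratum, come from it.
theorem derivation_apply_eq_zero {χ f : A} (hχ : φ χ p = 1) (hf : φ f p = 0) (h : χ * f = 0) :
    φ (D f) p = 0 := by
  have h₁ := congrArg (fun g => φ (D g) p) h
  simp only [Derivation.leibniz, smul_eq_mul, map_add, map_mul, Pi.add_apply, Pi.mul_apply, hχ, hf,
    one_mul, zero_mul, add_zero, map_zero, Pi.zero_apply] at h₁
  exact h₁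

/-- A derivation which annihilates the coordinates `y` at `p` annihilates the smooth functions of
`y`. -/
theorem derivation_eq_zero_of_coordinates
    (hloc : ∀ f : A, φ f =ᶠ[𝓝 p] 0 → φ (D f) p = 0)
    {V : Type} [NormedAddCommGroup V] [NormedSpace ℝ V] [FiniteDimensional ℝ V] {y : X → V}
    (hy : ContinuousAt y p)
    (hreal : ∀ g : V → ℝ, ContDiff ℝ ∞ g → ∃ g' : A, φ g' =ᶠ[𝓝 p] g ∘ y)
    (hD : ∀ (L : V →L[ℝ] ℝ) (f : A), φ f =ᶠ[𝓝 p] L ∘ y → φ (D f) p = 0)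
    {f : A} {G : V → ℝ} {O : Set V} (hO : O ∈ 𝓝 (y p)) (hG : ContDiffOn ℝ ∞ G O)
    (hf : φ f =ᶠ[𝓝 p] G ∘ y) : φ (D f) p = 0 := by
  obtain ⟨r, hr, hrO⟩ := Metric.mem_nhds_iff.mp hO
  let b : ContDiffBump (y p) := ⟨r / 3, r / 2, by linarith, by linarith⟩
  -- G is only smooth near y(p); multiplication by a bump function gives a global smooth function
  -- with the same germ, as Hadamard's lemma needs.
  set F : V → ℝ := fun v => b v * G v with hF
  have hFs : ContDiff ℝ ∞ F := by
    rw [contDiff_iff_contDiffAt]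
    intro v
    by_cases hv : v ∈ Metric.ball (y p) r
    · exact b.contDiff.contDiffAt.mul
        ((hG v (hrO hv)).contDiffAt (mem_of_superset (Metric.isOpen_ball.mem_nhds hv) hrO))
    · refine (contDiffAt_const (c := (0 : ℝ))).congr_of_eventuallyEq ?_
      have hv' : v ∈ (Metric.closedBall (y p) (r / 2))ᶜ := fun h =>
        hv (Metric.closedBall_subset_ball (by linarith) h)
      filter_upwards [Metric.isClosed_closedBall.isOpen_compl.mem_nhds hv'] with w hw
      rw [hF]
      simp only
      rw [b.zero_of_le_dist (not_le.mp fun h => hw (Metric.mem_closedBall.mpr h)).le, zero_mul]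
  have hfF : φ f =ᶠ[𝓝 p] F ∘ y := by
    have h := hy.eventually (b.eventuallyEq_one)
    filter_upwards [hf, h] with q h₁ h₂
    simp only [Function.comp_apply, hF] at h₁ ⊢
    rw [h₁, h₂, Pi.one_apply, one_mul]
  obtain ⟨Φ, hΦ, hΦF⟩ := SmoothDivision.exists_hadamard hFs (y p)
  let e := Module.finBasis ℝ V
  have hs : ∀ i, ContDiff ℝ ∞ fun v => Φ v (e i) := fun i => hΦ.clm_apply contDiff_const
  choose g hg using fun i => hreal _ (hs i)
  have hl : ∀ i, ContDiff ℝ ∞ fun v => (e.coord i).toContinuousLinearMap v := fun i =>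
    ContinuousLinearMap.contDiff _
  choose x hx using fun i => hreal _ (hl i)
  -- Hadamard's expansion f = F(y(p)) + Σ g_i (x_i - x_i(p)), valid as an identity of germs. After
  -- applying D and evaluating at p, only the terms g_i(p) D(x_i)(p) remain, and these vanish by
  -- assumption.
  have hfs : φ (f - (algebraMap ℝ A (F (y p)) +
      ∑ i, g i * (x i - algebraMap ℝ A (e.coord i (y p))))) =ᶠ[𝓝 p] 0 := by
    filter_upwards [hfF, eventually_all.mpr hg, eventually_all.mpr hx] with q h₁ h₂ h₃
    simp only [map_sub, map_add, map_sum, map_mul, AlgHom.commutes, Pi.sub_apply, Pi.add_apply,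
      Finset.sum_apply, Pi.mul_apply, Pi.algebraMap_apply, Algebra.algebraMap_self, RingHom.id_apply,
      h₁, h₂, h₃, Function.comp_apply, Pi.zero_apply, hΦF (y q)]
    have : y q - y p = ∑ i, (e.coord i (y q) - e.coord i (y p)) • e i := by
      simp only [← map_sub]
      exact (e.sum_repr _).symm
    have h₄ := congrArg (Φ (y q)) this
    rw [map_sum] at h₄
    simp only [map_smul, smul_eq_mul] at h₄
    rw [sub_eq_zero, ← map_sub, h₄]
    congr 1
    exact Finset.sum_congr rfl fun i _ => mul_comm _ _
  have h := hloc _ hfs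
  rw [map_sub, map_sub, Pi.sub_apply, sub_eq_zero] at h
  rw [h]
  simp only [map_add, Derivation.map_algebraMap, map_sum, Derivation.leibniz, map_sub, smul_eq_mul,
    zero_add, sub_zero, map_mul, AlgHom.commutes, Finset.sum_apply, Pi.add_apply,
    Pi.mul_apply, Pi.sub_apply, Pi.algebraMap_apply, Algebra.algebraMap_self, RingHom.id_apply]
  refine Finset.sum_eq_zero fun i _ => ?_
  have h₁ := hD (e.coord i).toContinuousLinearMap (x i) (hx i)
  have h₂ := (hx i).self_of_nhds
  simp only [Function.comp_apply, LinearMap.coe_toContinuousLinearMap'] at h₂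
  rw [h₁, h₂]
  simp

end Hadamard

end LogForms

/-! ### Locality of derivations on the manifold and on the quotient -/

namespace TorusAction

open LogForms Set

variable {n k : ℕ} {M : Type*} [TopologicalSpace M] [ChartedSpace (EuclideanSpace ℝ (Fin n)) M]
  [MulAction (Torus k) M]

variable (n M) in
/-- Evaluation of smooth functions. -/
def evalHom : C^∞⟮𝓡 n, M; ℝ⟯ →ₐ[ℝ] (M → ℝ) where
  toFun f := f
  map_one' := rfl
  map_mul' _ _ := rfl
  map_zero' := rfl
  map_add' _ _ := rfl
  commutes' _ := rfl

section

variable [T2Space M] [IsManifold (𝓡 n) ∞ M]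

theorem exists_bump_smooth {O : Set M} (hO : IsOpen O) {p : M} (hp : p ∈ O) :
    ∃ (Q : C^∞⟮𝓡 n, M; ℝ⟯) (K : Set M), IsClosed K ∧ K ⊆ O ∧ (∀ q ∉ K, Q q = 0) ∧
      ∀ᶠ q in 𝓝 p, Q q = 1 := by
  obtain ⟨f, -, hf⟩ := (SmoothBumpFunction.nhds_basis_tsupport (I := 𝓡 n) p).mem_iff.mp
    (hO.mem_nhds hp)
  exact ⟨⟨f, f.contMDiff⟩, tsupport f, isClosed_tsupport f, hf,
    fun q hq => image_eq_zero_of_notMem_tsupport hq, f.eventuallyEq_one⟩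

/-- Smooth germs are germs of global smooth functions. -/
theorem exists_smooth_extension {O : Set M} (hO : IsOpen O) {p : M} (hp : p ∈ O) {g : M → ℝ}
    (hg : ContMDiffOn (𝓡 n) 𝓘(ℝ) ∞ g O) : ∃ s : C^∞⟮𝓡 n, M; ℝ⟯, s =ᶠ[𝓝 p] g := by
  obtain ⟨Q, K, hK, hKO, hQ, h1⟩ := exists_bump_smooth (n := n) hO hp
  refine ⟨extendByZero Q hK hQ hO hKO hg, ?_⟩
  filter_upwards [h1] with q hq
  change Q q * g q = g q
  rw [hq, one_mul]

theorem derivation_local (D : Derivation ℝ C^∞⟮𝓡 n, M; ℝ⟯ C^∞⟮𝓡 n, M; ℝ⟯) {p : M}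
    {f : C^∞⟮𝓡 n, M; ℝ⟯} (hf : f =ᶠ[𝓝 p] 0) : D f p = 0 := by
  obtain ⟨O, hO', hO, hp⟩ := eventually_nhds_iff.mp hf
  obtain ⟨Q, K, -, hKO, hQ, h1⟩ := exists_bump_smooth (n := n) hO hp
  refine derivation_apply_eq_zero (φ := evalHom n M) (χ := Q) h1.self_of_nhds (hO' p hp) ?_
  ext q
  by_cases hq : q ∈ K
  · exact (congrArg (Q q * ·) (hO' q (hKO hq))).trans (mul_zero _)
  · exact (congrArg (· * f q) (hQ q hq)).trans (zero_mul _)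

theorem derivation_congr (D : Derivation ℝ C^∞⟮𝓡 n, M; ℝ⟯ C^∞⟮𝓡 n, M; ℝ⟯) {p : M}
    {f g : C^∞⟮𝓡 n, M; ℝ⟯} (h : f =ᶠ[𝓝 p] g) : D f p = D g p := by
  have h₁ : (f - g : C^∞⟮𝓡 n, M; ℝ⟯) =ᶠ[𝓝 p] 0 := by
    filter_upwards [h] with q hq
    exact sub_eq_zero.mpr hq
  have h₂ := derivation_local D h₁
  rw [map_sub] at h₂
  exact sub_eq_zero.mp h₂

end

variable (n k M) in
/-- Functions on the quotient as functions on `M`. -/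
def evalQuotient : smoothFunctions n k M →ₐ[ℝ] (M → ℝ) :=
  (evalHom n M).comp (quotientPullback n k M)

theorem eventually_orbitMap [SmoothTorusAction n k M] {P : OrbitSpace k M → Prop} {p : M} :
    (∀ᶠ b in 𝓝 (orbitMap p), P b) ↔ ∀ᶠ q in 𝓝 p, P (orbitMap q) := by
  rw [← isOpenMap_orbitMap (n := n).map_nhds_eq continuous_orbitMap.continuousAt]
  exact Filter.eventually_map

variable [T2Space M] [SmoothTorusAction n k M]

theorem IsStandard.derivation_local (hM : IsStandard n k M)
    (D : Derivation ℝ (smoothFunctions n k M) (smoothFunctions n k M)) {p : M}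
    {f : smoothFunctions n k M} (hf : ∀ᶠ q in 𝓝 p, f.1 (orbitMap q) = 0) :
    (D f).1 (orbitMap p) = 0 := by
  have hf' : ∀ᶠ b in 𝓝 (orbitMap (k := k) p), f.1 b = 0 := (eventually_orbitMap (n := n)).mpr hf
  obtain ⟨O, hO', hO, hp⟩ := eventually_nhds_iff.mp hf'
  obtain ⟨ψ, h1, h0⟩ := hM.exists_bump (hO.preimage continuous_orbitMap)
    (fun g q hq => by rwa [mem_preimage, orbitMap_smul]) hp
  refine derivation_apply_eq_zero (φ := evalQuotient n k M) (χ := ψ) h1.self_of_nhds (hO' _ hp) ?_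
  refine smoothFunctions_ext fun q => ?_
  by_cases hq : orbitMap q ∈ O
  · exact (congrArg (ψ.1 (orbitMap q) * ·) (hO' _ hq)).trans (mul_zero _)
  · exact (congrArg (· * f.1 (orbitMap q)) (h0 q hq)).trans (zero_mul _)

theorem IsStandard.derivation_congr (hM : IsStandard n k M)
    (D : Derivation ℝ (smoothFunctions n k M) (smoothFunctions n k M)) {p : M}
    {f g : smoothFunctions n k M} (h : ∀ᶠ q in 𝓝 p, f.1 (orbitMap q) = g.1 (orbitMap q)) :
    (D f).1 (orbitMap p) = (D g).1 (orbitMap p) := by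
  have h₂ := hM.derivation_local D (f := f - g) (p := p) (by
    filter_upwards [h] with q hq
    exact sub_eq_zero.mpr hq)
  rw [map_sub] at h₂
  exact sub_eq_zero.mp h₂

end TorusAction
end

noncomputable section

namespace TorusAction

open LogForms Set

variable {n k : ℕ} {M : Type*} [TopologicalSpace M] [ChartedSpace (EuclideanSpace ℝ (Fin n)) M]
  [MulAction (Torus k) M]

section Instances

set_option synthInstance.maxHeartbeats 100000

instance derivationSMul : SMul (smoothFunctions n k M)
    (Derivation ℝ (smoothFunctions n k M) (smoothFunctions n k M)) := inferInstance

instance logDerModule (I : Ideal (smoothFunctions n k M)) :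
    Module (smoothFunctions n k M) (logDer I) := inferInstance

instance logDerSMul (I : Ideal (smoothFunctions n k M)) :
    SMul (smoothFunctions n k M) (logDer I) := inferInstance

end Instances

namespace StandardChart

variable {a l m : ℕ} (c : StandardChart n k M a l m)

/-! ### Division by boundary coordinates -/

/-- A smooth function on the quotient which vanishes on `z_j = 0` is divisible by `|z_j|²` on the
slice. -/
theorem exists_div_slice (F : smoothFunctions n k M) (j : Fin l)
    (hF : ∀ p ∈ c.source, c.z p j = 0 → F.1 (orbitMap p) = 0) :
    ∃ G : Slice l m → ℝ, ContDiff ℝ ∞ G ∧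
      ∀ v, F.1 (orbitMap (c.sec v)) = ‖v.1 j‖ ^ 2 * G v := by
  have hs : ContDiff ℝ ∞ fun v : Slice l m => F.1 (orbitMap (c.sec v)) :=
    (F.2.comp c.contMDiff_sec).contDiff
  let z : Slice l m →L[ℝ] ℂ :=
    (ContinuousLinearMap.proj j).comp (ContinuousLinearMap.fst ℝ (Fin l → ℂ) (Fin m → ℝ))
  have hz : ∀ v : Slice l m, z v = v.1 j := fun v => rfl
  refine Exists.imp (fun G hG => ⟨hG.1, fun v => ?_⟩) (SmoothDivision.exists_div_sq hs
    (Complex.reCLM.comp z) (Complex.imCLM.comp z) (e₁ := (Pi.single j 1, 0))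
    (e₂ := (Pi.single j Complex.I, 0)) (by simp [hz]) (by simp [hz])
    (by simp [hz]) (by simp [hz]) (fun θ v => ?_) (fun v h₁ h₂ => ?_))
  · rw [hG.2 v, Complex.sq_norm, Complex.normSq_apply]
    simp [hz, sq]
  -- Rotating z_j alone keeps (|z|², x), hence the orbit; this is the rotation invariance which
  -- division by |z_j|² requires.
  · refine congrArg F.1 (orbitMap_eq_iff.mpr (c.exists_smul_eq (c.sec_mem _) (c.sec_mem _) ?_))
    rw [coord_sec, coord_sec]
    refine Prod.ext (funext fun i => ?_) ?_
    · by_cases hi : i = j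
      · subst hi
        have e : ∀ w : ℂ, ‖w‖ ^ 2 = w.re ^ 2 + w.im ^ 2 := fun w => by
          rw [Complex.sq_norm, Complex.normSq_apply, sq, sq]
        simp only [sqMap, e]
        simp [hz, -Complex.ofReal_cos, -Complex.ofReal_sin]
        linear_combination -(v.1 i).re ^ 2 * Real.sin_sq_add_cos_sq θ -
          (v.1 i).im ^ 2 * Real.sin_sq_add_cos_sq θ
      · simp [sqMap, hi]
    · simp [sqMap]
  · refine hF _ (c.sec_mem v) ?_
    rw [z_sec]
    exact Complex.ext h₁ h₂

open Classical in
/-- Division by `|z_j|²` of functions supported in the chart. -/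
theorem exists_div (hM : IsStandard n k M) {K : Set M} (hK : IsClosed K) (hKs : K ⊆ c.source)
    (F : smoothFunctions n k M) (j : Fin l)
    (hF : ∀ p ∈ c.source, c.z p j = 0 → F.1 (orbitMap p) = 0)
    (hFK : ∀ p ∉ K, F.1 (orbitMap p) = 0) :
    ∃ G : smoothFunctions n k M, (∀ p ∉ K, G.1 (orbitMap p) = 0) ∧
      ∀ p ∈ c.source, F.1 (orbitMap p) = ‖c.z p j‖ ^ 2 * G.1 (orbitMap p) := by
  obtain ⟨G, hG, h⟩ := c.exists_div_slice F j hF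
  have hGs : ContMDiffOn (𝓡 n) 𝓘(ℝ) ∞ (fun p => G (c.coord p)) c.source :=
    hG.contMDiff.comp_contMDiffOn c.contMDiffOn_coord
  have hFG : ∀ p ∈ c.source, F.1 (orbitMap p) = ‖c.z p j‖ ^ 2 * G (c.coord p) := fun p hp => by
    obtain ⟨g, hg⟩ := c.exists_smul_sec_coord hp
    have e := h (c.coord p)
    rwa [← orbitMap_smul g, hg] at e
  have hfree : ∀ p ∈ c.source, IsFree k p → ‖c.z p j‖ ^ 2 ≠ 0 := fun p hp hp' =>
    pow_ne_zero _ (norm_ne_zero_iff.mpr ((c.isFree_iff hp).mp hp' j))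
  -- On free orbits |z_j|² can be cancelled, so the support and the invariance of F pass to G there;
  -- density carries both to the whole chart.
  have h0 : ∀ p ∈ c.source ∩ Kᶜ, G (c.coord p) = 0 := by
    refine hM.eqOn_of_isFree (c.isOpen_source.inter hK.isOpen_compl)
      (hGs.continuousOn.mono inter_subset_left) continuousOn_const fun p hp hp' => ?_
    have e := hFG p hp.1
    rw [hFK p hp.2] at e
    exact (mul_eq_zero.mp e.symm).resolve_left (hfree p hp.1 hp')
  have hinv : ∀ (g : Torus k), ∀ p ∈ c.source, G (c.coord (g • p)) = G (c.coord p) := by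
    intro g
    have hc : ContMDiffOn (𝓡 n) 𝓘(ℝ) ∞ (fun p => G (c.coord (g • p))) c.source := by
      have hu : ContDiff ℝ ∞ fun v : Slice l m => G (fun j => ((c.generators g).2 j : ℂ) * v.1 j,
          v.2) := hG.comp (by fun_prop)
      refine (hu.contMDiff.comp_contMDiffOn c.contMDiffOn_coord).congr fun p hp => ?_
      simp only [coord, c.z_smul g p hp, c.x_smul g p hp]
      rfl
    refine hM.eqOn_of_isFree c.isOpen_source hc.continuousOn hGs.continuousOn fun p hp hp' => ?_
    have e₁ := hFG p hp
    have e₂ := hFG (g • p) (c.smul_mem g p hp)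
    rw [orbitMap_smul, e₁, c.z_smul g p hp, norm_mul, Circle.norm_coe, one_mul] at e₂
    exact (mul_left_cancel₀ (hfree p hp hp') e₂).symm
  refine ⟨descend ⟨fun p => if p ∈ c.source then G (c.coord p) else 0, fun p => ?_⟩ ?_, ?_, ?_⟩
  · by_cases hp : p ∈ c.source
    · refine ((hGs p hp).contMDiffAt (c.isOpen_source.mem_nhds hp)).congr_of_eventuallyEq ?_
      filter_upwards [c.isOpen_source.mem_nhds hp] with q hq using if_pos hq
    · refine (contMDiffAt_const (c := (0 : ℝ))).congr_of_eventuallyEq ?_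
      filter_upwards [hK.isOpen_compl.mem_nhds fun h => hp (hKs h)] with q hq
      split_ifs with hqs
      · exact h0 q ⟨hqs, hq⟩
      · rfl
  · intro g p
    change (if _ then _ else _) = if _ then _ else _
    simp only [c.smul_mem_iff g]
    split_ifs with hp
    · exact hinv g p hp
    · rfl
  · intro p hp
    change (if _ then _ else _) = _
    split_ifs with hps
    · exact h0 p ⟨hps, hp⟩
    · rfl
  · intro p hp
    change _ = _ * (if _ then _ else _)
    rw [if_pos hp, hFG p hp]

end StandardChart

/-! ### Derivations from smooth families of curves -/

section FlowDer

variable [IsManifold (𝓡 n) ∞ M]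

/-- The derivation defined by a smooth family of curves. -/
def flowDer (Φ : M × ℝ → M) (hΦ : ContMDiff ((𝓡 n).prod 𝓘(ℝ)) (𝓡 n) ∞ Φ)
    (h0 : ∀ p, Φ (p, 0) = p) : Derivation ℝ C^∞⟮𝓡 n, M; ℝ⟯ C^∞⟮𝓡 n, M; ℝ⟯ := by
  have hd : ∀ (f : C^∞⟮𝓡 n, M; ℝ⟯) (p : M), DifferentiableAt ℝ (fun s : ℝ => f (Φ (p, s))) 0 := by
    intro f p
    have h : ContMDiff 𝓘(ℝ) 𝓘(ℝ) ∞ fun s : ℝ => f (Φ (p, s)) :=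
      f.contMDiff.comp (hΦ.comp (contMDiff_const.prodMk contMDiff_id))
    exact (h.contDiff.differentiable (by simp)).differentiableAt
  refine Derivation.mk'
    { toFun := fun f => ⟨fun p => deriv (fun s : ℝ => f (Φ (p, s))) 0, fun p => ?_⟩
      map_add' := ?_
      map_smul' := ?_ } ?_
  · have h := ContMDiffAt.mfderiv (I := 𝓘(ℝ)) (I' := 𝓘(ℝ)) (J := 𝓡 n) (m := ∞) (n := ∞) (x₀ := p)
      (fun (q : M) (s : ℝ) => f (Φ (q, s))) (fun _ => (0 : ℝ))
      (f.contMDiff.comp hΦ).contMDiffAt contMDiffAt_const (by simp)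
    erw [inTangentCoordinates_model_space] at h
    have h' := h.clm_apply (contMDiffAt_const (c := (1 : ℝ)))
    refine h'.congr_of_eventuallyEq (Filter.Eventually.of_forall fun q => ?_)
    simp only [mfderiv_eq_fderiv]
    rfl
  · intro f g
    ext p
    exact deriv_add (hd f p) (hd g p)
  · intro r f
    ext p
    exact deriv_const_mul r (hd f p)
  · intro f g
    ext p
    have h := deriv_mul (hd f p) (hd g p)
    simp only [h0] at h
    refine h.trans ?_
    change _ = f p * deriv (fun s : ℝ => g (Φ (p, s))) 0 + g p * deriv (fun s : ℝ => f (Φ (p, s))) 0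
    ring

variable {Φ : M × ℝ → M} (hΦ : ContMDiff ((𝓡 n).prod 𝓘(ℝ)) (𝓡 n) ∞ Φ) (h0 : ∀ p, Φ (p, 0) = p)

omit [IsManifold (𝓡 n) ∞ M] in
include hΦ h0 in
theorem tendsto_flow (p : M) : Filter.Tendsto (fun s : ℝ => Φ (p, s)) (𝓝 0) (𝓝 p) := by
  have h := (hΦ.continuous.comp (Continuous.prodMk_right p)).tendsto 0
  simpa [h0, Function.comp_def] using h

theorem flowDer_germ {f : C^∞⟮𝓡 n, M; ℝ⟯} {g : M → ℝ} {p : M} (h : f =ᶠ[𝓝 p] g) :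
    flowDer Φ hΦ h0 f p = deriv (fun s : ℝ => g (Φ (p, s))) 0 :=
  Filter.EventuallyEq.deriv_eq ((tendsto_flow hΦ h0 p).eventually h)

omit [IsManifold (𝓡 n) ∞ M] in
include hΦ in
theorem differentiableAt_flow (f : C^∞⟮𝓡 n, M; ℝ⟯) (p : M) :
    DifferentiableAt ℝ (fun s : ℝ => f (Φ (p, s))) 0 := by
  have h : ContMDiff 𝓘(ℝ) 𝓘(ℝ) ∞ fun s : ℝ => f (Φ (p, s)) :=
    f.contMDiff.comp (hΦ.comp (contMDiff_const.prodMk contMDiff_id))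
  exact (h.contDiff.differentiable (by simp)).differentiableAt

end FlowDer

/-- The derivation on the quotient induced by an invariant derivation. -/
def descendDer [SmoothTorusAction n k M] (D : Derivation ℝ C^∞⟮𝓡 n, M; ℝ⟯ C^∞⟮𝓡 n, M; ℝ⟯)
    (hD : ∀ g : Torus k, Related (translate n M g) D D) :
    Derivation ℝ (smoothFunctions n k M) (smoothFunctions n k M) := by
  have hinv : ∀ (f : smoothFunctions n k M) (g : Torus k) (p : M),
      D (quotientPullback n k M f) (g • p) = D (quotientPullback n k M f) p := fun f g p => by
    have e : translate n M g (quotientPullback n k M f) = quotientPullback n k M f :=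
      ContMDiffMap.ext fun q => quotientPullback_smul f g q
    have h := hD g (quotientPullback n k M f)
    rw [e] at h
    exact (congrArg (fun s : C^∞⟮𝓡 n, M; ℝ⟯ => s p) h).symm
  refine Derivation.mk'
    { toFun := fun f => descend (D (quotientPullback n k M f)) (hinv f)
      map_add' := fun f g => quotientPullback_injective (by simp)
      map_smul' := fun r f => quotientPullback_injective (by simp) } fun f g => ?_
  refine quotientPullback_injective ?_
  simp

theorem related_descendDer [SmoothTorusAction n k M]
    (D : Derivation ℝ C^∞⟮𝓡 n, M; ℝ⟯ C^∞⟮𝓡 n, M; ℝ⟯)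
    (hD : ∀ g : Torus k, Related (translate n M g) D D) :
    Related (quotientPullback n k M) D (descendDer D hD) := fun _ => rfl

end TorusAction

/-! ### Calculus of related derivations -/

namespace LogForms

section Related

variable {R S : Type*} [CommRing R] [Algebra ℝ R] [CommRing S] [Algebra ℝ S] {φ : R →ₐ[ℝ] S}

theorem Related.add {X X' : Derivation ℝ S S} {Y Y' : Derivation ℝ R R} (h : Related φ X Y)
    (h' : Related φ X' Y') : Related φ (X + X') (Y + Y') := fun f => by
  simp [h f, h' f]

theorem Related.smul {X : Derivation ℝ S S} {Y : Derivation ℝ R R} (h : Related φ X Y) (r : R) :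
    Related φ (φ r • X) (r • Y) := fun f => by simp [h f]

theorem Related.sum {ι : Type*} {s : Finset ι} {X : ι → Derivation ℝ S S}
    {Y : ι → Derivation ℝ R R} (h : ∀ i ∈ s, Related φ (X i) (Y i)) :
    Related φ (∑ i ∈ s, X i) (∑ i ∈ s, Y i) := by
  classical
  induction s using Finset.induction_on with
  | empty => exact fun f => by simp
  | insert i s hi ih =>
    rw [Finset.sum_insert hi, Finset.sum_insert hi]
    exact (h i (Finset.mem_insert_self i s)).add
      (ih fun j hj => h j (Finset.mem_insert_of_mem hj))

theorem Related.lie {X X' : Derivation ℝ S S} {Y Y' : Derivation ℝ R R} (h : Related φ X Y)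
    (h' : Related φ X' Y') : Related φ ⁅X, X'⁆ ⁅Y, Y'⁆ := fun f => by
  rw [Derivation.commutator_apply, Derivation.commutator_apply, h' f, h f, h, h', map_sub]

/-- A lift of a derivation preserving `I` preserves the ideal generated by `I`. -/
theorem Related.mem_logDer {I : Ideal R} {X : Derivation ℝ S S} {Y : Derivation ℝ R R}
    (h : Related φ X Y) (hY : Y ∈ logDer I) : X ∈ logDer (I.map φ) := by
  intro f hf
  unfold Ideal.map at hf ⊢
  induction hf using Submodule.span_induction with
  | mem f hf =>
    obtain ⟨f, hf, rfl⟩ := hf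
    refine Ideal.subset_span ⟨Y f, hY f hf, (h f).symm⟩
  | zero => rw [map_zero]; exact Submodule.zero_mem _
  | add f g _ _ hf hg => rw [map_add]; exact Submodule.add_mem _ hf hg
  | smul r f hf' hf =>
    rw [smul_eq_mul, Derivation.leibniz]
    exact Submodule.add_mem _ (Submodule.smul_mem _ r hf)
      (by rw [smul_eq_mul, mul_comm]; exact Submodule.smul_mem _ _ hf')

end Related

end LogForms
end

noncomputable section

namespace TorusAction

open LogForms Set

variable {n k : ℕ} {M : Type*} [TopologicalSpace M] [ChartedSpace (EuclideanSpace ℝ (Fin n)) M]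
  [MulAction (Torus k) M] [T2Space M] {a l m : ℕ} {c : StandardChart n k M a l m}

namespace StandardChart.Cut

/-! ### The radial and transverse vector fields of a chart -/

theorem mem_source (C : Cut c) {p : M} (hp : p ∈ C.U) : p ∈ c.source := C.subset_source hp

open Classical in
/-- The flow along the radial and the `x`-directions of a chart, scaled by the cutoff. -/
def flow (C : Cut c) (e : (Fin l → ℝ) × (Fin m → ℝ)) (q : M × ℝ) : M :=
  if q.1 ∈ c.source then
    c.inv (c.w q.1) (fun j => (Real.exp (q.2 * (C.ψ.1 (orbitMap q.1) * e.1 j) / 2) : ℝ) * c.z q.1 j)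
      (fun i => c.x q.1 i + q.2 * (C.ψ.1 (orbitMap q.1) * e.2 i))
  else q.1

variable (C : Cut c) (e : (Fin l → ℝ) × (Fin m → ℝ))

theorem flow_of_mem {p : M} (hp : p ∈ c.source) (τ : ℝ) : C.flow e (p, τ) =
    c.inv (c.w p) (fun j => (Real.exp (τ * (C.ψ.1 (orbitMap p) * e.1 j) / 2) : ℝ) * c.z p j)
      (fun i => c.x p i + τ * (C.ψ.1 (orbitMap p) * e.2 i)) := if_pos hp

/-- Covers time zero as well as all points outside the support of ψ; the second case joins the flow
smoothly to the identity outside the chart. -/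
theorem flow_of_eq_zero {p : M} (τ : ℝ) (h : τ * C.ψ.1 (orbitMap p) = 0) :
    C.flow e (p, τ) = p := by
  by_cases hp : p ∈ c.source
  · rw [C.flow_of_mem e hp]
    simp only [← mul_assoc, h, zero_mul, zero_div, Real.exp_zero, Complex.ofReal_one, one_mul,
      add_zero]
    exact c.left_inv p hp
  · exact if_neg hp

theorem flow_zero (p : M) : C.flow e (p, 0) = p := C.flow_of_eq_zero e 0 (zero_mul _)

theorem flow_smul (g : Torus k) (p : M) (τ : ℝ) : C.flow e (g • p, τ) = g • C.flow e (p, τ) := by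
  by_cases hp : p ∈ c.source
  · rw [C.flow_of_mem e hp, C.flow_of_mem e (c.smul_mem g p hp), c.smul_inv, c.w_smul g p hp,
      c.z_smul g p hp, c.x_smul g p hp, orbitMap_smul]
    congr 1
    funext j
    ring
  · have h : ∀ q, q ∉ c.source → C.flow e (q, τ) = q := fun q hq => if_neg hq
    rw [h p hp, h (g • p) (by rwa [c.smul_mem_iff g])]

theorem contMDiff_flow : ContMDiff ((𝓡 n).prod 𝓘(ℝ)) (𝓡 n) ∞ (C.flow e) := by
  rintro ⟨p, τ⟩
  by_cases hp : p ∈ c.source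
  · have hO : IsOpen (c.source ×ˢ (univ : Set ℝ)) := c.isOpen_source.prod isOpen_univ
    have hψ : ContMDiff ((𝓡 n).prod 𝓘(ℝ)) 𝓘(ℝ) ∞ fun q : M × ℝ => C.ψ.1 (orbitMap q.1) :=
      (quotientPullback n k M C.ψ).contMDiff.comp contMDiff_fst
    have hfst : ContMDiffOn ((𝓡 n).prod 𝓘(ℝ)) (𝓡 n) ∞ (Prod.fst : M × ℝ → M)
      (c.source ×ˢ (univ : Set ℝ)) := contMDiff_fst.contMDiffOn
    have hmaps : MapsTo (Prod.fst : M × ℝ → M) (c.source ×ˢ (univ : Set ℝ)) c.source :=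
      fun q hq => hq.1
    have hcoord := c.contMDiffOn_coord.comp hfst hmaps
    have hall : ContMDiffOn ((𝓡 n).prod 𝓘(ℝ)) 𝓘(ℝ, (ℝ × ℝ) × Slice l m) ∞
        (fun q : M × ℝ => ((q.2, C.ψ.1 (orbitMap q.1)), c.coord q.1))
        (c.source ×ˢ (univ : Set ℝ)) :=
      ((contMDiff_snd.prodMk_space hψ).contMDiffOn).prodMk_space hcoord
    have hv : ContDiff ℝ ∞ fun u : (ℝ × ℝ) × Slice l m =>
        (((fun j => (Real.exp (u.1.1 * (u.1.2 * e.1 j) / 2) : ℝ) * u.2.1 j),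
          (fun i => u.2.2 i + u.1.1 * (u.1.2 * e.2 i))) : Slice l m) := by
      refine ContDiff.prodMk (contDiff_pi.mpr fun j => ?_) (by fun_prop)
      have h₁ : ContDiff ℝ ∞ fun u : (ℝ × ℝ) × Slice l m =>
        Real.exp (u.1.1 * (u.1.2 * e.1 j) / 2) := by fun_prop
      exact (Complex.ofRealCLM.contDiff.comp h₁).mul (by fun_prop)
    have h := c.contMDiffOn_inv_comp hO (w := fun q : M × ℝ => c.w q.1)
      (fun i => (c.contMDiffOn_w i).comp hfst hmaps) (hv.contMDiff.comp_contMDiffOn hall)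
    refine ((h (p, τ) ⟨hp, mem_univ _⟩).contMDiffAt
      (hO.mem_nhds ⟨hp, mem_univ _⟩)).congr_of_eventuallyEq ?_
    filter_upwards [hO.mem_nhds ⟨hp, mem_univ _⟩] with q hq
    exact C.flow_of_mem e hq.1 q.2
  · refine (contMDiffAt_fst (p := (p, τ))).congr_of_eventuallyEq ?_
    have hp' : p ∉ C.K := fun h => hp (C.subset_source (C.subset_U h))
    have hO : IsOpen (C.Kᶜ ×ˢ (univ : Set ℝ)) := C.isClosed_K.isOpen_compl.prod isOpen_univ
    filter_upwards [hO.mem_nhds ⟨hp', mem_univ _⟩] with q hq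
    exact C.flow_of_eq_zero e q.2 (by rw [C.ψ_eq_zero q.1 hq.1, mul_zero])

variable [IsManifold (𝓡 n) ∞ M]

/-- The vector field on `M` generating the flow. -/
def derUp : Derivation ℝ C^∞⟮𝓡 n, M; ℝ⟯ C^∞⟮𝓡 n, M; ℝ⟯ :=
  flowDer (C.flow e) (C.contMDiff_flow e) (C.flow_zero e)

theorem derUp_apply (f : C^∞⟮𝓡 n, M; ℝ⟯) (p : M) :
    C.derUp e f p = deriv (fun s : ℝ => f (C.flow e (p, s))) 0 := rfl

variable [SmoothTorusAction n k M]

theorem derUp_related_translate (g : Torus k) :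
    Related (translate n M g) (C.derUp e) (C.derUp e) := fun f => by
  ext p
  change deriv (fun s : ℝ => f (g • C.flow e (p, s))) 0 = deriv (fun s => f (C.flow e (g • p, s))) 0
  simp only [C.flow_smul e g]

/-- The vector field on the quotient induced by the flow. -/
def der : Derivation ℝ (smoothFunctions n k M) (smoothFunctions n k M) :=
  descendDer (C.derUp e) (C.derUp_related_translate e)

theorem derUp_related : Related (quotientPullback n k M) (C.derUp e) (C.der e) :=
  related_descendDer _ _

theorem der_apply (f : smoothFunctions n k M) (p : M) : (C.der e f).1 (orbitMap p) =
    deriv (fun s : ℝ => f.1 (orbitMap (C.flow e (p, s)))) 0 := rfl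

/-- An equivariant flow cannot turn an orbit with nontrivial stabiliser into a free one. A function
vanishing on ∂B is therefore zero along the whole flow line of a boundary point. -/
theorem der_mem (hM : IsStandard n k M) : C.der e ∈ logDer (boundaryIdeal n k M) := by
  intro f hf b hb
  obtain ⟨p, rfl⟩ := orbitMap_surjective b
  rw [der_apply]
  have h : ∀ s, f.1 (orbitMap (C.flow e (p, s))) = 0 := fun s => by
    refine hf _ ?_
    rw [hM.mem_boundary_iff] at hb ⊢
    intro hfree
    refine hb fun g hg => hfree g ?_
    rw [← C.flow_smul, hg]
  simp only [h, deriv_const]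

/-- The factor 1/2 in the exponent of `flow` makes |z_j|² scale by exp(s ψ e_j), so the flow
generates ψ e_j t_j ∂_{t_j} in the boundary directions. -/
theorem der_t {p : M} (hp : p ∈ C.U) (j : Fin l) : (C.der e (C.t j)).1 (orbitMap p) =
    C.ψ.1 (orbitMap p) * e.1 j * ‖c.z p j‖ ^ 2 := by
  have h : (quotientPullback n k M (C.t j)) =ᶠ[𝓝 p] fun q => ‖c.z q j‖ ^ 2 := by
    filter_upwards [C.isOpen_U.mem_nhds hp] with q hq using C.t_eq q hq j
  have h₁ := flowDer_germ (C.contMDiff_flow e) (C.flow_zero e) h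
  have h₂ : ∀ s : ℝ, ‖c.z (C.flow e (p, s)) j‖ ^ 2 =
      Real.exp (s * (C.ψ.1 (orbitMap p) * e.1 j)) * ‖c.z p j‖ ^ 2 := fun s => by
    rw [C.flow_of_mem e (C.mem_source hp), c.z_inv, norm_mul, Complex.norm_real, Real.norm_eq_abs,
      Real.abs_exp, mul_pow, ← Real.exp_nat_mul]
    congr 2
    push_cast
    ring
  refine h₁.trans ?_
  simp only [h₂]
  have h₃ : HasDerivAt (fun s : ℝ => s * (C.ψ.1 (orbitMap p) * e.1 j))
      (C.ψ.1 (orbitMap p) * e.1 j) 0 := by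
    simpa using (hasDerivAt_id (0 : ℝ)).mul_const (C.ψ.1 (orbitMap p) * e.1 j)
  have h₄ := h₃.exp.mul_const (‖c.z p j‖ ^ 2)
  rw [zero_mul, Real.exp_zero, one_mul] at h₄
  exact h₄.deriv

theorem der_x {p : M} (hp : p ∈ C.U) (i : Fin m) : (C.der e (C.x i)).1 (orbitMap p) =
    C.ψ.1 (orbitMap p) * e.2 i := by
  have h : (quotientPullback n k M (C.x i)) =ᶠ[𝓝 p] fun q => c.x q i := by
    filter_upwards [C.isOpen_U.mem_nhds hp] with q hq using C.x_eq q hq i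
  have h₁ := flowDer_germ (C.contMDiff_flow e) (C.flow_zero e) h
  have h₂ : ∀ s : ℝ, c.x (C.flow e (p, s)) i = c.x p i + s * (C.ψ.1 (orbitMap p) * e.2 i) :=
    fun s => by rw [C.flow_of_mem e (C.mem_source hp), c.x_inv]
  refine h₁.trans ?_
  simp only [h₂]
  have h₃ : HasDerivAt (fun s : ℝ => c.x p i + s * (C.ψ.1 (orbitMap p) * e.2 i))
      (C.ψ.1 (orbitMap p) * e.2 i) 0 := by
    simpa using ((hasDerivAt_id (0 : ℝ)).mul_const (C.ψ.1 (orbitMap p) * e.2 i)).const_add (c.x p i)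
  exact h₃.deriv

/-- The coordinate directions. -/
def dir : Fin l ⊕ Fin m → (Fin l → ℝ) × (Fin m → ℝ) :=
  Sum.elim (fun j => (Pi.single j 1, 0)) fun i => (0, Pi.single i 1)

/-- The local frame of `𝒜_{∂B}`. -/
def frame (hM : IsStandard n k M) (i : Fin l ⊕ Fin m) : logDer (boundaryIdeal n k M) :=
  ⟨C.der (dir i), C.der_mem _ hM⟩

/-- The horizontal lift of the local frame of `𝒜_{∂B}`. -/
def frameUp (hM : IsStandard n k M) (i : Fin l ⊕ Fin m) : logDer (ellipticIdeal n k M) :=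
  ⟨C.derUp (dir i), (C.derUp_related _).mem_logDer (C.der_mem _ hM)⟩

/-! ### Coefficients of sections in the local frame -/

include C in
/-- Sections of `𝒜_{∂B}` are tangent to the boundary. -/
theorem logDer_t_eq_zero (hM : IsStandard n k M) (Y : logDer (boundaryIdeal n k M)) {p : M}
    (hp : p ∈ C.U) {j : Fin l} (hj : c.z p j = 0) : (Y.1 (C.t j)).1 (orbitMap p) = 0 := by
  -- The function t_j itself need not vanish on all of ∂B. Near a point where z_j alone vanishes it
  -- does so after multiplication by a bump function χ, and then Y(χ t_j) vanishes on ∂B.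
  have key : ∀ q ∈ C.U, (∀ i, c.z q i = 0 ↔ i = j) → (Y.1 (C.t j)).1 (orbitMap q) = 0 := by
    intro q hq hqj
    set O : Set M := {q | q ∈ C.U ∧ ∀ i, i ≠ j → c.z q i ≠ 0} with hO
    have hOo : IsOpen O := by
      have h : IsOpen {z : Fin l → ℂ | ∀ i, i ≠ j → z i ≠ 0} := by
        simp only [ofPred_forall]
        exact isOpen_iInter_of_finite fun i => isOpen_iInter_of_finite fun _ =>
          isOpen_ne.preimage (continuous_apply i)
      exact (c.contMDiffOn_z.continuousOn.mono C.subset_source).isOpen_inter_preimage C.isOpen_U h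
    obtain ⟨χ, hχ, hχ0⟩ := hM.exists_bump hOo (fun g r hr => ⟨C.smul_mem g r hr.1, fun i hi => by
      rw [c.z_smul g r (C.mem_source hr.1)]
      exact mul_ne_zero (Circle.coe_ne_zero _) (hr.2 i hi)⟩)
      (⟨hq, fun i hi h => hi ((hqj i).mp h)⟩ : q ∈ O)
    have hmem : χ * C.t j ∈ boundaryIdeal n k M := by
      intro b hb
      obtain ⟨r, rfl⟩ := orbitMap_surjective b
      change χ.1 _ * (C.t j).1 _ = 0
      by_cases hr : r ∈ O
      · obtain ⟨i, hi⟩ := (c.mem_boundary_iff hM (C.mem_source hr.1)).mp hb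
        have hij : i = j := by
          by_contra h
          exact hr.2 i h hi
        rw [C.t_eq r hr.1, ← hij, hi, norm_zero]
        ring
      · rw [hχ0 r hr, zero_mul]
    have h := Y.2 _ hmem (orbitMap q)
      ((c.mem_boundary_iff hM (C.mem_source hq)).mpr ⟨j, (hqj j).mpr rfl⟩)
    rw [Derivation.leibniz] at h
    change χ.1 _ * (Y.1 (C.t j)).1 _ + (C.t j).1 _ * (Y.1 χ).1 _ = 0 at h
    rw [hχ.self_of_nhds, C.t_eq q hq, (hqj j).mpr rfl, norm_zero] at h
    simpa using h
  -- The deeper strata follow by continuity, being limits of points where z_j alone vanishes.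
  have hcl := c.mem_closure_of_vanishing {j} (C.mem_source hp) (by simpa using hj)
  have hcl' : p ∈ closure {q | q ∈ C.U ∧ ∀ i, c.z q i = 0 ↔ i = j} := by
    rw [mem_closure_iff_nhds] at hcl ⊢
    intro t ht
    obtain ⟨q, hq, hq'⟩ := hcl _ (Filter.inter_mem ht (C.isOpen_U.mem_nhds hp))
    exact ⟨q, hq.1, hq.2, hq'.2⟩
  have hcont : Continuous fun q : M => (Y.1 (C.t j)).1 (orbitMap q) :=
    (quotientPullback n k M (Y.1 (C.t j))).contMDiff.continuous
  exact closure_minimal (t := {q : M | (Y.1 (C.t j)).1 (orbitMap q) = 0})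
    (fun q hq => key q hq.1 hq.2) (isClosed_eq hcont continuous_const) hcl'

theorem exists_quot (hM : IsStandard n k M) (j : Fin l) (Y : logDer (boundaryIdeal n k M)) :
    ∃ G : smoothFunctions n k M, (∀ p ∉ C.K, G.1 (orbitMap p) = 0) ∧ ∀ p ∈ c.source,
      C.ψ.1 (orbitMap p) * (Y.1 (C.t j)).1 (orbitMap p) = ‖c.z p j‖ ^ 2 * G.1 (orbitMap p) := by
  refine c.exists_div hM C.isClosed_K (C.subset_U.trans C.subset_source) (C.ψ * Y.1 (C.t j)) j ?_ ?_
  · intro p hp hj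
    change C.ψ.1 _ * _ = 0
    by_cases hK : p ∈ C.K
    · rw [C.logDer_t_eq_zero hM Y (C.subset_U hK) hj, mul_zero]
    · rw [C.ψ_eq_zero p hK, zero_mul]
  · intro p hK
    change C.ψ.1 _ * _ = 0
    rw [C.ψ_eq_zero p hK, zero_mul]

include C in
-- Quotients by |z_j|² are unique because the free orbits are dense. This is what makes a chosen
-- quotient linear in the section Y.
theorem ext_of_quot (hM : IsStandard n k M) {j : Fin l} {G G' : smoothFunctions n k M}
    (hG : ∀ p ∉ C.K, G.1 (orbitMap p) = 0) (hG' : ∀ p ∉ C.K, G'.1 (orbitMap p) = 0)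
    (h : ∀ p ∈ c.source, ‖c.z p j‖ ^ 2 * G.1 (orbitMap p) = ‖c.z p j‖ ^ 2 * G'.1 (orbitMap p)) :
    G = G' := by
  refine quotientPullback_injective (hM.ext_of_isFree fun p hp => ?_)
  by_cases hK : p ∈ C.K
  · have hps := C.subset_source (C.subset_U hK)
    exact mul_left_cancel₀ (pow_ne_zero _ (norm_ne_zero_iff.mpr ((c.isFree_iff hps).mp hp j)))
      (h p hps)
  · exact (hG p hK).trans (hG' p hK).symm

/-- The coefficients `ψ Y(t_j) / t_j` of a section of `𝒜_{∂B}`. -/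
def radialCoef (hM : IsStandard n k M) (j : Fin l) :
    logDer (boundaryIdeal n k M) →ₗ[smoothFunctions n k M] smoothFunctions n k M where
  toFun Y := (C.exists_quot hM j Y).choose
  map_add' Y Y' := by
    have h := (C.exists_quot hM j (Y + Y')).choose_spec
    have h₁ := (C.exists_quot hM j Y).choose_spec
    have h₂ := (C.exists_quot hM j Y').choose_spec
    refine C.ext_of_quot hM (j := j) h.1 (fun p hp => ?_) fun p hp => ?_
    · change (C.exists_quot hM j Y).choose.1 _ + (C.exists_quot hM j Y').choose.1 _ = 0
      rw [h₁.1 p hp, h₂.1 p hp, add_zero]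
    · refine (h.2 p hp).symm.trans ?_
      change _ * ((Y.1 (C.t j)).1 _ + (Y'.1 (C.t j)).1 _) =
        _ * ((C.exists_quot hM j Y).choose.1 _ + (C.exists_quot hM j Y').choose.1 _)
      rw [mul_add, mul_add, h₁.2 p hp, h₂.2 p hp]
  map_smul' r Y := by
    have h := (C.exists_quot hM j (r • Y)).choose_spec
    have h₁ := (C.exists_quot hM j Y).choose_spec
    refine C.ext_of_quot hM (j := j) h.1 (fun p hp => ?_) fun p hp => ?_
    · change r.1 _ * (C.exists_quot hM j Y).choose.1 _ = 0
      rw [h₁.1 p hp, mul_zero]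
    · refine (h.2 p hp).symm.trans ?_
      change _ * (r.1 _ * (Y.1 (C.t j)).1 _) = _ * (r.1 _ * (C.exists_quot hM j Y).choose.1 _)
      rw [mul_left_comm, h₁.2 p hp, mul_left_comm]

theorem radialCoef_mul (hM : IsStandard n k M) (j : Fin l) (Y : logDer (boundaryIdeal n k M))
    {p : M} (hp : p ∈ c.source) : ‖c.z p j‖ ^ 2 * (C.radialCoef hM j Y).1 (orbitMap p) =
      C.ψ.1 (orbitMap p) * (Y.1 (C.t j)).1 (orbitMap p) :=
  ((C.exists_quot hM j Y).choose_spec.2 p hp).symm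

theorem radialCoef_eq_zero (hM : IsStandard n k M) (j : Fin l) (Y : logDer (boundaryIdeal n k M))
    {p : M} (hp : p ∉ C.K) : (C.radialCoef hM j Y).1 (orbitMap p) = 0 :=
  (C.exists_quot hM j Y).choose_spec.1 p hp

/-- The coefficients of a section of `𝒜_{∂B}` in the local frame, scaled by the square of the
cutoff. -/
def coef (hM : IsStandard n k M) (i : Fin l ⊕ Fin m) :
    logDer (boundaryIdeal n k M) →ₗ[smoothFunctions n k M] smoothFunctions n k M :=
  Sum.elim (C.radialCoef hM) (fun i =>
    { toFun := fun Y => C.ψ * Y.1 (C.x i)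
      map_add' := fun Y Y' => by simp [mul_add]
      map_smul' := fun r Y => by simp [mul_left_comm] }) i

theorem coef_inr (hM : IsStandard n k M) (i : Fin m) (Y : logDer (boundaryIdeal n k M)) :
    C.coef hM (Sum.inr i) Y = C.ψ * Y.1 (C.x i) := rfl

theorem coef_inl (hM : IsStandard n k M) (j : Fin l) (Y : logDer (boundaryIdeal n k M)) :
    C.coef hM (Sum.inl j) Y = C.radialCoef hM j Y := rfl

theorem coef_eq_zero (hM : IsStandard n k M) (i : Fin l ⊕ Fin m)
    (Y : logDer (boundaryIdeal n k M)) {p : M} (hp : p ∉ C.K) :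
    (C.coef hM i Y).1 (orbitMap p) = 0 := by
  rcases i with j | i
  · exact C.radialCoef_eq_zero hM j Y hp
  · rw [coef_inr]
    change C.ψ.1 _ * _ = 0
    rw [C.ψ_eq_zero p hp, zero_mul]

end StandardChart.Cut

end TorusAction
end

noncomputable section

/-! ### Expansion in the local frame and horizontal lifts -/

namespace TorusAction

open LogForms Set

theorem derivation_sum_apply {R : Type*} [CommRing R] [Algebra ℝ R] {ι : Type*} (s : Finset ι)
    (D : ι → Derivation ℝ R R) (f : R) : (∑ i ∈ s, D i) f = ∑ i ∈ s, D i f := by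
  classical
  induction s using Finset.induction_on with
  | empty => simp
  | insert i s hi h => rw [Finset.sum_insert hi, Finset.sum_insert hi, Derivation.add_apply, h]

variable {n k : ℕ} {M : Type*} [TopologicalSpace M] [ChartedSpace (EuclideanSpace ℝ (Fin n)) M]
  [MulAction (Torus k) M]

variable (n k M) in
/-- Evaluation of functions on the quotient at a point. -/
def evalAt (b : OrbitSpace k M) : smoothFunctions n k M →ₐ[ℝ] ℝ :=
  (Pi.evalAlgHom ℝ (fun _ : OrbitSpace k M => ℝ) b).comp (smoothFunctions n k M).val

theorem evalAt_apply (b : OrbitSpace k M) (f : smoothFunctions n k M) : evalAt n k M b f = f.1 b :=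
  rfl

theorem evalAt_derivation_sum {ι : Type*} [Fintype ι] (b : OrbitSpace k M)
    (r : ι → smoothFunctions n k M)
    (D : ι → Derivation ℝ (smoothFunctions n k M) (smoothFunctions n k M))
    (f : smoothFunctions n k M) :
    ((∑ i, r i • D i) f).1 b = ∑ i, (r i).1 b * (D i f).1 b := by
  rw [← evalAt_apply, derivation_sum_apply, map_sum]
  rfl

variable [T2Space M] [IsManifold (𝓡 n) ∞ M] [SmoothTorusAction n k M]

namespace StandardChart.Cut

variable {a l m : ℕ} {c : StandardChart n k M a l m} (C : Cut c)

/-- One factor ψ comes from the coefficients and a second one from the frame fields, whence ψ². -/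
theorem der_coordinates (hM : IsStandard n k M) (Y : logDer (boundaryIdeal n k M)) {p : M}
    (hp : p ∈ C.U) : (∀ j, ((∑ i, C.coef hM i Y • C.der (dir i)) (C.t j)).1 (orbitMap p) =
      C.ψ.1 (orbitMap p) ^ 2 * (Y.1 (C.t j)).1 (orbitMap p)) ∧
    ∀ j, ((∑ i, C.coef hM i Y • C.der (dir i)) (C.x j)).1 (orbitMap p) =
      C.ψ.1 (orbitMap p) ^ 2 * (Y.1 (C.x j)).1 (orbitMap p) := by
  constructor <;> intro j <;> rw [evalAt_derivation_sum, Fintype.sum_sum_type]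
  · simp only [C.der_t _ hp, dir, Sum.elim_inl, Sum.elim_inr, Pi.zero_apply, mul_zero, zero_mul,
      Finset.sum_const_zero, add_zero, coef_inl]
    rw [Finset.sum_eq_single j]
    · simp only [Pi.single_eq_same, mul_one]
      have h := C.radialCoef_mul hM j Y (C.mem_source hp)
      linear_combination C.ψ.1 (orbitMap p) * h
    · intro i _ hi
      simp [Pi.single_eq_of_ne' hi]
    · simp
  · simp only [C.der_x _ hp, dir, Sum.elim_inl, Sum.elim_inr, Pi.zero_apply, mul_zero,
      Finset.sum_const_zero, zero_add, coef_inr]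
    rw [Finset.sum_eq_single j]
    · simp only [Pi.single_eq_same, mul_one]
      change C.ψ.1 _ * (Y.1 _).1 _ * C.ψ.1 _ = _
      ring
    · intro i _ hi
      simp [Pi.single_eq_of_ne' hi]
    · simp

omit [IsManifold (𝓡 n) ∞ M] in
include C in
/-- At free orbits, derivations are determined by their values on the coordinates. -/
theorem derivation_eq_zero (hM : IsStandard n k M)
    (D : Derivation ℝ (smoothFunctions n k M) (smoothFunctions n k M)) {p : M} (hp : p ∈ C.U)
    (hfree : IsFree k p) (ht : ∀ j, (D (C.t j)).1 (orbitMap p) = 0)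
    (hx : ∀ j, (D (C.x j)).1 (orbitMap p) = 0) (f : smoothFunctions n k M) :
    (D f).1 (orbitMap p) = 0 := by
  have hps := C.mem_source hp
  -- On t_j > 0 the square root is smooth, so f, read off at the slice point z_j = √(t_j), is a
  -- smooth function of (t, x) near a free orbit. At the boundary this would fail.
  refine derivation_eq_zero_of_coordinates (φ := evalQuotient n k M) (p := p)
    (V := (Fin l → ℝ) × (Fin m → ℝ)) (y := fun q => sqMap (c.coord q))
    (G := fun y => f.1 (orbitMap (c.sec (fun j => (Real.sqrt (y.1 j) : ℂ), y.2))))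
    (O := {y | ∀ j, 0 < y.1 j}) (fun f hf => hM.derivation_local D hf)
    (c.continuousOn_sqMap_coord.continuousAt (c.isOpen_source.mem_nhds hps)) ?_ ?_ ?_ ?_ ?_
  · intro g hg
    obtain ⟨f, hf⟩ := c.exists_smooth_germ hg (sqMap (c.coord p)) one_pos
    refine ⟨f, ?_⟩
    filter_upwards [(c.isOpen_tube Metric.isOpen_ball).mem_nhds
      (⟨hps, Metric.mem_ball_self one_pos⟩ : p ∈ c.tube _)] with q hq using hf q hq
  · intro L f hf
    have h : ∀ᶠ q in 𝓝 p, f.1 (orbitMap q) =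
        (∑ j, L (Pi.single j 1, 0) • C.t j + ∑ j, L (0, Pi.single j 1) • C.x j :
          smoothFunctions n k M).1 (orbitMap q) := by
      filter_upwards [hf, C.isOpen_U.mem_nhds hp] with q h₁ h₂
      change f.1 (orbitMap q) = L (sqMap (c.coord q)) at h₁
      rw [h₁, ← evalAt_apply, map_add, map_sum, map_sum]
      simp only [map_smul, evalAt_apply, C.t_eq q h₂, C.x_eq q h₂, smul_eq_mul]
      have e : sqMap (c.coord q) = ∑ j, ‖c.z q j‖ ^ 2 • ((Pi.single j 1, 0) :
          (Fin l → ℝ) × (Fin m → ℝ)) + ∑ j, c.x q j • (0, Pi.single j 1) := by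
        refine Prod.ext (funext fun i => ?_) (funext fun i => ?_)
        · simp [Prod.fst_sum, Finset.sum_apply, Pi.single_apply, sqMap, coord]
        · simp [Prod.snd_sum, Finset.sum_apply, Pi.single_apply, sqMap, coord]
      rw [e]
      simp only [map_add, map_sum, map_smul, smul_eq_mul, mul_comm]
    refine (hM.derivation_congr D h).trans ?_
    rw [← evalAt_apply, map_add, map_sum, map_sum]
    have e : ∀ (r : ℝ) g, (D g).1 (orbitMap p) = 0 →
        evalAt n k M (orbitMap p) (D (r • g)) = 0 := fun r g hg => by
      rw [Derivation.map_smul, map_smul, evalAt_apply, hg, smul_zero]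
    rw [map_add, map_sum, map_sum, Finset.sum_eq_zero fun j _ => e _ _ (ht j),
      Finset.sum_eq_zero fun j _ => e _ _ (hx j), add_zero]
  · refine IsOpen.mem_nhds ?_ fun j => ?_
    · simp only [ofPred_forall]
      exact isOpen_iInter_of_finite fun j => isOpen_lt continuous_const (by fun_prop)
    · exact pow_pos (norm_pos_iff.mpr ((c.isFree_iff hps).mp hfree j)) 2
  · have h : ContDiff ℝ ∞ fun v : Slice l m => f.1 (orbitMap (c.sec v)) :=
      (f.2.comp c.contMDiff_sec).contDiff
    refine h.comp_contDiffOn (ContDiffOn.prodMk (contDiffOn_pi.mpr fun j => ?_) (by fun_prop))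
    intro y hy
    have h₁ : ContDiffAt ℝ ∞ (fun y : (Fin l → ℝ) × (Fin m → ℝ) => Real.sqrt (y.1 j)) y :=
      ContDiffAt.sqrt (by fun_prop) (hy j).ne'
    exact (Complex.ofRealCLM.contDiff.contDiffAt.comp y h₁).contDiffWithinAt
  · filter_upwards [c.isOpen_source.mem_nhds hps] with q hq
    obtain ⟨g, hg⟩ := c.exists_smul_sec hq (v := (fun j => (Real.sqrt ((sqMap (c.coord q)).1 j) : ℂ),
      (sqMap (c.coord q)).2)) (by simp [sqMap, Real.sqrt_sq (norm_nonneg _)])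
    change f.1 (orbitMap q) = f.1 (orbitMap (c.sec _))
    rw [← hg, orbitMap_smul, hg]

/-- The expansion of sections of `𝒜_{∂B}` in the local frame. -/
theorem sum_coef_smul_frame (hM : IsStandard n k M) (Y : logDer (boundaryIdeal n k M)) :
    ∑ i, C.coef hM i Y • C.frame hM i = C.ψ ^ 2 • Y := by
  refine Subtype.ext (Derivation.ext fun f => quotientPullback_injective
    (hM.ext_of_isFree fun p hp => ?_))
  have e : (∑ i, C.coef hM i Y • C.frame hM i : logDer (boundaryIdeal n k M)).1 =
      ∑ i, C.coef hM i Y • C.der (dir i) := by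
    rw [Submodule.coe_sum]
    rfl
  rw [e, quotientPullback_apply, quotientPullback_apply]
  change _ = C.ψ.1 (orbitMap p) ^ 2 * (Y.1 f).1 (orbitMap p)
  by_cases hK : p ∈ C.K
  · have hU := C.subset_U hK
    have h := C.derivation_eq_zero hM (∑ i, C.coef hM i Y • C.der (dir i) - C.ψ ^ 2 • Y.1) hU hp
      (fun j => sub_eq_zero.mpr ((C.der_coordinates hM Y hU).1 j))
      (fun j => sub_eq_zero.mpr ((C.der_coordinates hM Y hU).2 j)) f
    exact sub_eq_zero.mp h
  · rw [C.ψ_eq_zero p hK, evalAt_derivation_sum]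
    simp [C.coef_eq_zero hM _ Y hK]

/-- The horizontal lift of (a multiple of) a section of `𝒜_{∂B}`. -/
def lift (hM : IsStandard n k M) (Y : logDer (boundaryIdeal n k M)) :
    logDer (ellipticIdeal n k M) :=
  ∑ i, quotientPullback n k M (C.coef hM i Y) • C.frameUp hM i

theorem coe_lift (hM : IsStandard n k M) (Y : logDer (boundaryIdeal n k M)) :
    (C.lift hM Y).1 = ∑ i, quotientPullback n k M (C.coef hM i Y) • C.derUp (dir i) := by
  rw [lift, Submodule.coe_sum]
  rfl

theorem related_lift (hM : IsStandard n k M) (Y : logDer (boundaryIdeal n k M)) :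
    Related (quotientPullback n k M) (C.lift hM Y).1 (C.ψ ^ 2 • Y).1 := by
  rw [← C.sum_coef_smul_frame hM, coe_lift, Submodule.coe_sum]
  exact Related.sum fun i _ => (C.derUp_related _).smul _

end StandardChart.Cut

/-! ### Angles -/

/-- Angles are only defined modulo 2π; this compares derivatives of two real lifts of one curve in
the circle. -/
theorem deriv_eq_of_circleExp_eq {f g : ℝ → ℝ} {t f' g' : ℝ} (hf : HasDerivAt f f' t)
    (hg : HasDerivAt g g' t) (h : ∀ᶠ s in 𝓝 t, Circle.exp (f s) = Circle.exp (g s)) : f' = g' := by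
  have key : ∀ {f : ℝ → ℝ} {f' : ℝ}, HasDerivAt f f' t →
      HasDerivAt (fun s => Complex.exp (f s * Complex.I))
        (Complex.exp (f t * Complex.I) * (f' * Complex.I)) t := fun hf =>
    (hf.ofReal_comp.mul_const Complex.I).cexp
  have h₁ := (key hf).unique ((key hg).congr_of_eventuallyEq (by
    filter_upwards [h] with s hs
    simpa [Circle.coe_exp] using congrArg (fun z : Circle => (z : ℂ)) hs))
  have h₂ : Complex.exp (f t * Complex.I) = Complex.exp (g t * Complex.I) := by
    simpa [Circle.coe_exp] using congrArg (fun z : Circle => (z : ℂ)) h.self_of_nhds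
  rw [h₂] at h₁
  have h₃ := mul_right_cancel₀ Complex.I_ne_zero (mul_left_cancel₀ (Complex.exp_ne_zero _) h₁)
  exact_mod_cast h₃

namespace StandardChart

variable {a l m : ℕ} (c : StandardChart n k M a l m)

/-- The equivariant map to the torus given by a chart, on the free orbits. -/
def angle (p : M) : Torus k := c.generators.symm (c.w p, fun j => phase (c.z p j))

omit [T2Space M] [IsManifold (𝓡 n) ∞ M] [SmoothTorusAction n k M] in
theorem angle_smul (g : Torus k) {p : M} (hp : p ∈ c.source) (hfree : IsFree k p) :
    c.angle (g • p) = g * c.angle p := by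
  have h := (c.isFree_iff hp).mp hfree
  apply c.generators.injective
  simp only [angle, map_mul, ContinuousMulEquiv.apply_symm_apply, c.w_smul g p hp,
    c.z_smul g p hp, phase_mul _ (h _)]
  rfl

/-- The torus map attached to a chart is the exponential of linear functions of the angles. -/
theorem exists_linear_generators_symm : ∃ (L₁ : (Fin a → ℝ) →L[ℝ] (Fin k → ℝ))
    (L₂ : (Fin l → ℝ) →L[ℝ] (Fin k → ℝ)), ∀ θ φ,
      c.generators.symm (torusExp θ, torusExp φ) = torusExp (L₁ θ + L₂ φ) := by
  obtain ⟨L₁, h₁⟩ := exists_linear_of_torusHom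
    ((c.generators.symm : Torus a × Torus l →* Torus k).comp (MonoidHom.inl _ _))
    (c.generators.symm.continuous.comp (Continuous.prodMk_left _))
  obtain ⟨L₂, h₂⟩ := exists_linear_of_torusHom
    ((c.generators.symm : Torus a × Torus l →* Torus k).comp (MonoidHom.inr _ _))
    (c.generators.symm.continuous.comp (Continuous.prodMk_right _))
  refine ⟨L₁, L₂, fun θ φ => ?_⟩
  rw [torusExp_add, ← h₁, ← h₂]
  change _ = c.generators.symm (_, 1) * c.generators.symm (1, _)
  rw [← map_mul, Prod.mk_mul_mk, one_mul, mul_one]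

/-- Smooth angles near a free orbit. -/
theorem exists_angles {p : M} (hp : p ∈ c.source) (hfree : IsFree k p) :
    ∃ (O : Set M) (ϑ : Fin k → C^∞⟮𝓡 n, M; ℝ⟯), IsOpen O ∧ p ∈ O ∧ O ⊆ c.source ∧
      (∀ q ∈ O, IsFree k q) ∧ ∀ q ∈ O, torusExp (fun i => ϑ i q) = c.angle q := by
  have hO' : IsOpen {q | q ∈ c.source ∧ ∀ j, c.z q j ≠ 0} := by
    have h : IsOpen {z : Fin l → ℂ | ∀ i, z i ≠ 0} := by
      simp only [ofPred_forall]
      exact isOpen_iInter_of_finite fun i => isOpen_ne.preimage (continuous_apply i)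
    exact c.contMDiffOn_z.continuousOn.isOpen_inter_preimage c.isOpen_source h
  have hp' : p ∈ {q | q ∈ c.source ∧ ∀ j, c.z q j ≠ 0} := ⟨hp, (c.isFree_iff hp).mp hfree⟩
  obtain ⟨O₁, hO₁, hpO₁, -, θ, hθ, hθe⟩ := exists_torus_angle c.isOpen_source c.contMDiffOn_w hp
  obtain ⟨O₂, hO₂, hpO₂, hO₂s, φ, hφ, hφe⟩ := exists_torus_angle (I := 𝓡 n) hO'
    (f := fun q j => phase (c.z q j)) (fun j q hq =>
      ContMDiffAt.comp_contMDiffWithinAt (g := phase) q (contMDiffAt_phase (hq.2 j))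
        ((contMDiffOn_pi_space.mp c.contMDiffOn_z j q hq.1).mono (sep_subset _ _))) hp'
  obtain ⟨L₁, L₂, hL⟩ := c.exists_linear_generators_symm
  have hϑ : ∀ i, ContMDiffOn (𝓡 n) 𝓘(ℝ) ∞ (fun q => (L₁ (θ q) + L₂ (φ q)) i) (O₁ ∩ O₂) := by
    intro i
    have h := (L₁.contDiff (n := ∞)).contMDiff.comp_contMDiffOn (hθ.mono (inter_subset_left (t := O₂)))
    have h' := (L₂.contDiff (n := ∞)).contMDiff.comp_contMDiffOn (hφ.mono (inter_subset_right (s := O₁)))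
    exact contMDiffOn_pi_space.mp (h.add h') i
  -- Derivations act on global functions only, so the local angles are replaced by global functions
  -- with the same germ at p.
  choose ϑ hϑe using fun i => exists_smooth_extension (hO₁.inter hO₂) ⟨hpO₁, hpO₂⟩ (hϑ i)
  obtain ⟨O₃, hO₃e, hO₃, hpO₃⟩ := eventually_nhds_iff.mp (Filter.eventually_all.mpr hϑe)
  refine ⟨O₁ ∩ O₂ ∩ O₃, ϑ, (hO₁.inter hO₂).inter hO₃, ⟨⟨hpO₁, hpO₂⟩, hpO₃⟩,
    fun q hq => (hO₂s hq.1.2).1, fun q hq => ?_, fun q hq => ?_⟩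
  · exact (c.isFree_iff (hO₂s hq.1.2).1).mpr (hO₂s hq.1.2).2
  · have e : (fun i => ϑ i q) = L₁ (θ q) + L₂ (φ q) := funext fun i => hO₃e q hq.2 i
    rw [e, ← hL, hθe q hq.1.1, hφe q hq.1.2]
    rfl

variable {c} {O : Set M} {ϑ : Fin k → C^∞⟮𝓡 n, M; ℝ⟯}

/-- By equivariance of `angle`, the function ϑ_i grows like s v_i along the orbit, modulo 2π. -/
theorem fundamentalField_angle (hO : IsOpen O) (hOs : O ⊆ c.source) (hOf : ∀ q ∈ O, IsFree k q)
    (hϑ : ∀ q ∈ O, torusExp (fun i => ϑ i q) = c.angle q) (v : Fin k → ℝ) (i : Fin k) {q : M}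
    (hq : q ∈ O) : fundamentalField n k M v (ϑ i) q = v i := by
  have hd := (differentiableAt_curve n k M v (ϑ i) q).hasDerivAt
  have hg : HasDerivAt (fun s : ℝ => s * v i + ϑ i q) (v i) 0 := by
    simpa using ((hasDerivAt_id (0 : ℝ)).mul_const (v i)).add_const (ϑ i q)
  refine deriv_eq_of_circleExp_eq hd hg ?_
  have hc : Continuous fun s : ℝ => torusExp (s • v) • q :=
    (SmoothTorusAction.contMDiff_action (n := n) (k := k) (M := M)).continuous.comp (by fun_prop :
      Continuous fun s : ℝ => (s • v, q))
  have h0 := hc.tendsto 0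
  rw [zero_smul, torusExp_zero, one_smul] at h0
  filter_upwards [h0.eventually (hO.mem_nhds hq)] with s hs
  have h₁ := hϑ _ hs
  rw [c.angle_smul _ (hOs hq) (hOf q hq), ← hϑ q hq, ← torusExp_add] at h₁
  exact congrFun h₁ i

/-- The flow keeps w and multiplies each z_j by a positive number, so it changes no phase: the
lifted frame is horizontal for the flat connection of the chart. -/
theorem Cut.derUp_angle (C : Cut c) (e : (Fin l → ℝ) × (Fin m → ℝ)) (hO : IsOpen O)
    (hOs : O ⊆ c.source) (hOf : ∀ q ∈ O, IsFree k q)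
    (hϑ : ∀ q ∈ O, torusExp (fun i => ϑ i q) = c.angle q) (i : Fin k) {q : M}
    (hq : q ∈ O) : C.derUp e (ϑ i) q = 0 := by
  have hd := (differentiableAt_flow (C.contMDiff_flow e) (ϑ i) q).hasDerivAt
  refine deriv_eq_of_circleExp_eq hd (hasDerivAt_const 0 (ϑ i q)) ?_
  filter_upwards [(tendsto_flow (C.contMDiff_flow e) (C.flow_zero e) q).eventually
    (hO.mem_nhds hq)] with s hs
  have h₁ := hϑ _ hs
  have h₂ : c.angle (C.flow e (q, s)) = c.angle q := by
    rw [C.flow_of_mem e (hOs hq), angle, c.w_inv, c.z_inv, angle]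
    congr 2
    funext j
    have hz := (c.isFree_iff (hOs hq)).mp (hOf q hq) j
    conv_lhs => rw [← norm_mul_phase (c.z q j), ← mul_assoc, ← Complex.ofReal_mul]
    exact phase_real_mul (mul_pos (Real.exp_pos _) (norm_pos_iff.mpr hz)) _
  rw [h₂, ← hϑ q hq] at h₁
  exact congrFun h₁ i

theorem Cut.lift_angle (C : Cut c) (hM : IsStandard n k M) (Y : logDer (boundaryIdeal n k M))
    (hO : IsOpen O) (hOs : O ⊆ c.source) (hOf : ∀ q ∈ O, IsFree k q)
    (hϑ : ∀ q ∈ O, torusExp (fun i => ϑ i q) = c.angle q) (i : Fin k) {q : M}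
    (hq : q ∈ O) : (C.lift hM Y).1 (ϑ i) q = 0 := by
  rw [C.coe_lift, derivation_sum_apply]
  have e : ∀ (s : Finset (Fin l ⊕ Fin m)) (f : Fin l ⊕ Fin m → C^∞⟮𝓡 n, M; ℝ⟯),
      (∑ i ∈ s, f i) q = ∑ i ∈ s, f i q := fun s f => by
    change evalHom n M _ q = _
    rw [map_sum, Finset.sum_apply]
    rfl
  rw [e]
  refine Finset.sum_eq_zero fun j _ => ?_
  change _ * C.derUp (dir j) (ϑ i) q = 0
  rw [C.derUp_angle _ hO hOs hOf hϑ i hq, mul_zero]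

end StandardChart

end TorusAction
end

noncomputable section

namespace TorusAction

open LogForms Set

variable {n k : ℕ} {M : Type*} [TopologicalSpace M] [ChartedSpace (EuclideanSpace ℝ (Fin n)) M]
  [MulAction (Torus k) M] [T2Space M] [IsManifold (𝓡 n) ∞ M] [SmoothTorusAction n k M]

/-! ### Vertical vector fields -/

variable (n M) in
/-- Evaluation of smooth functions at a point. -/
def evalPoint (p : M) : C^∞⟮𝓡 n, M; ℝ⟯ →ₐ[ℝ] ℝ :=
  (Pi.evalAlgHom ℝ (fun _ : M => ℝ) p).comp (evalHom n M)

omit [T2Space M] [IsManifold (𝓡 n) ∞ M] [MulAction (Torus k) M] [SmoothTorusAction n k M] in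
theorem evalPoint_apply (p : M) (f : C^∞⟮𝓡 n, M; ℝ⟯) : evalPoint n M p f = f p := rfl

omit [T2Space M] [IsManifold (𝓡 n) ∞ M] [MulAction (Torus k) M] [SmoothTorusAction n k M] in
theorem evalPoint_derivation_sum {ι : Type*} (s : Finset ι) (p : M) (r : ι → C^∞⟮𝓡 n, M; ℝ⟯)
    (D : ι → Derivation ℝ C^∞⟮𝓡 n, M; ℝ⟯ C^∞⟮𝓡 n, M; ℝ⟯) (f : C^∞⟮𝓡 n, M; ℝ⟯) :
    (∑ i ∈ s, r i • D i) f p = ∑ i ∈ s, r i p * D i f p := by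
  rw [← evalPoint_apply, derivation_sum_apply, map_sum]
  rfl

namespace StandardChart

variable {a m : ℕ} (c : StandardChart n k M a 0 m) {O : Set M} {ϑ : Fin k → C^∞⟮𝓡 n, M; ℝ⟯}

/-- Derivations are determined by their values on the angles and on invariant functions. -/
theorem derivation_eq_zero (hO : IsOpen O)
    (hOs : O ⊆ c.source) (hϑ : ∀ q ∈ O, torusExp (fun i => ϑ i q) = c.angle q)
    (D : Derivation ℝ C^∞⟮𝓡 n, M; ℝ⟯ C^∞⟮𝓡 n, M; ℝ⟯) {p : M} (hp : p ∈ O)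
    (h₁ : ∀ i, D (ϑ i) p = 0) (h₂ : ∀ f, D (quotientPullback n k M f) p = 0)
    (s : C^∞⟮𝓡 n, M; ℝ⟯) : D s p = 0 := by
  have hps := hOs hp
  have hϑs : ContMDiff (𝓡 n) 𝓘(ℝ, Fin k → ℝ) ∞ fun q i => ϑ i q :=
    contMDiff_pi_space.mpr fun i => (ϑ i).contMDiff
  have hy : ContMDiffOn (𝓡 n) 𝓘(ℝ, (Fin k → ℝ) × (Fin m → ℝ)) ∞
      (fun q => ((fun i => ϑ i q), c.x q)) c.source :=
    hϑs.contMDiffOn.prodMk_space c.contMDiffOn_x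
  have hx : ∀ j, ∃ f : smoothFunctions n k M, ∀ᶠ q in 𝓝 p, f.1 (orbitMap q) = c.x q j := by
    intro j
    obtain ⟨f, hf⟩ := c.exists_smooth_germ (g := fun y => y.2 j) (by fun_prop) (sqMap (c.coord p))
      one_pos
    refine ⟨f, ?_⟩
    filter_upwards [(c.isOpen_tube Metric.isOpen_ball).mem_nhds
      (⟨hps, Metric.mem_ball_self one_pos⟩ : p ∈ c.tube _)] with q hq using hf q hq
  choose x hx using hx
  -- Without complex coordinates, (ϑ, x) is a local coordinate system: a nearby point is recovered
  -- by acting with exp(ϑ) on the slice point with the same x.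
  refine derivation_eq_zero_of_coordinates (φ := evalHom n M) (D := D) (p := p)
    (V := (Fin k → ℝ) × (Fin m → ℝ)) (y := fun q => ((fun i => ϑ i q), c.x q))
    (G := fun y => s (torusExp y.1 • c.sec (0, y.2))) (O := univ)
    (fun f hf => derivation_local D hf)
    (hy.continuousOn.continuousAt (c.isOpen_source.mem_nhds hps)) ?_ ?_ Filter.univ_mem ?_ ?_
  · exact fun g hg => exists_smooth_extension c.isOpen_source hps
      (hg.contMDiff.comp_contMDiffOn hy)
  · intro L f hf
    have h : f =ᶠ[𝓝 p] (∑ j, L (Pi.single j 1, 0) • ϑ j +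
        ∑ j, L (0, Pi.single j 1) • quotientPullback n k M (x j) : C^∞⟮𝓡 n, M; ℝ⟯) := by
      filter_upwards [hf, Filter.eventually_all.mpr hx] with q h₁ h₂
      change f q = L ((fun i => ϑ i q), c.x q) at h₁
      rw [h₁, ← evalPoint_apply, map_add, map_sum, map_sum]
      simp only [map_smul, evalPoint_apply, quotientPullback_apply, h₂, smul_eq_mul]
      have e : (((fun i => ϑ i q), c.x q) : (Fin k → ℝ) × (Fin m → ℝ)) =
          ∑ j, ϑ j q • ((Pi.single j 1, 0) : (Fin k → ℝ) × (Fin m → ℝ)) +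
            ∑ j, c.x q j • (0, Pi.single j 1) := by
        refine Prod.ext (funext fun i => ?_) (funext fun i => ?_)
        · simp [Prod.fst_sum, Finset.sum_apply, Pi.single_apply]
        · simp [Prod.snd_sum, Finset.sum_apply, Pi.single_apply]
      rw [e]
      simp only [map_add, map_sum, map_smul, smul_eq_mul, mul_comm]
    refine (derivation_congr D h).trans ?_
    have e : ∀ (r : ℝ) g, D g p = 0 → evalPoint n M p (D (r • g)) = 0 := fun r g hg => by
      rw [Derivation.map_smul, map_smul, evalPoint_apply, hg, smul_zero]
    rw [← evalPoint_apply, map_add, map_sum, map_sum, map_add, map_sum, map_sum,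
      Finset.sum_eq_zero fun j _ => e _ _ (h₁ j), Finset.sum_eq_zero fun j _ => e _ _ (h₂ _),
      add_zero]
  · have h : ContMDiff 𝓘(ℝ, (Fin k → ℝ) × (Fin m → ℝ)) (𝓡 n) ∞
        fun y : (Fin k → ℝ) × (Fin m → ℝ) => torusExp y.1 • c.sec (0, y.2) :=
      (SmoothTorusAction.contMDiff_action (n := n) (k := k) (M := M)).comp
        (ContMDiff.prodMk contDiff_fst.contMDiff (c.contMDiff_sec.comp
          (by fun_prop : ContDiff ℝ ∞ fun y : (Fin k → ℝ) × (Fin m → ℝ) =>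
            ((0, y.2) : Slice 0 m)).contMDiff))
    exact (s.contMDiff.comp h).contDiff.contDiffOn
  · filter_upwards [hO.mem_nhds hp] with q hq
    change s q = s _
    have hs := c.sec_mem (0, c.x q)
    congr 1
    refine c.eq_of_coords (hOs hq) (c.smul_mem _ _ hs) ?_ (Subsingleton.elim _ _) ?_
    · rw [c.w_smul _ _ hs, w_sec]
      change _ = (c.generators (torusExp fun i => ϑ i q)).1 * 1
      rw [hϑ q hq, angle, ContinuousMulEquiv.apply_symm_apply, mul_one]
    · rw [c.x_smul _ _ hs, x_sec]

end StandardChart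

variable {Θ : OneForm (ellipticIdeal n k M) k}

/-- Over a free orbit the fundamental fields span the vertical directions, and the coefficients of Z
are the derivatives Z(ϑ_i) of the angles. Linearity of Θ over the smooth functions, together with
its values on fundamental fields, identifies these coefficients with Θ(Z). -/
theorem IsConnection.vertical_apply (hΘ : IsConnection Θ) (hM : IsStandard n k M)
    {Z : logDer (ellipticIdeal n k M)} (hZ : ∀ f, Z.1 (quotientPullback n k M f) = 0) {p : M}
    (hp : IsFree k p) (s : C^∞⟮𝓡 n, M; ℝ⟯) :
    Z.1 s p = ∑ i, Θ Z i p * fundamentalField n k M (Pi.single i 1) s p := by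
  obtain ⟨a, m, c, hpc⟩ := hM.exists_chart_of_isFree hp
  obtain ⟨O, ϑ, hO, hpO, hOs, hOf, hϑ⟩ := c.exists_angles hpc hp
  obtain ⟨Q, K, -, hKO, hQ, h1⟩ := exists_bump_smooth (n := n) hO hpO
  -- The angles are only meaningful on O; the bump function Q turns the local expansion into an
  -- identity of global sections, to which Θ can be applied.
  have key : Q • Z = ∑ i, (Q * Z.1 (ϑ i)) • liftedAction n k M (Pi.single i 1) := by
    refine Subtype.ext (Derivation.ext fun f => ContMDiffMap.ext fun q => ?_)
    have e : (∑ i, (Q * Z.1 (ϑ i)) • liftedAction n k M (Pi.single i 1)).1 =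
        ∑ i, (Q * Z.1 (ϑ i)) • fundamentalField n k M (Pi.single i 1) := by
      rw [Submodule.coe_sum]
      rfl
    rw [e]
    change Q q * Z.1 f q = _
    by_cases hq : q ∈ O
    · have h := c.derivation_eq_zero hO hOs hϑ
        (Q • Z.1 - ∑ i, (Q * Z.1 (ϑ i)) • fundamentalField n k M (Pi.single i 1)) hq
        (fun i => ?_) (fun f => ?_) f
      · exact sub_eq_zero.mp h
      · change Q q * Z.1 (ϑ i) q -
          (∑ j, (Q * Z.1 (ϑ j)) • fundamentalField n k M (Pi.single j 1)) (ϑ i) q = 0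
        rw [evalPoint_derivation_sum, Finset.sum_eq_single i]
        · rw [StandardChart.fundamentalField_angle hO hOs hOf hϑ _ _ hq, Pi.single_eq_same, mul_one]
          exact sub_self _
        · intro j _ hj
          rw [StandardChart.fundamentalField_angle hO hOs hOf hϑ _ _ hq,
            Pi.single_eq_of_ne' hj, mul_zero]
        · simp
      · change Q q * Z.1 _ q -
          (∑ j, (Q * Z.1 (ϑ j)) • fundamentalField n k M (Pi.single j 1))
            (quotientPullback n k M f) q = 0
        rw [evalPoint_derivation_sum, hZ]
        simp only [fundamentalField_quotientPullback]
        exact (by simp : Q q * 0 - ∑ i, (Q * Z.1 (ϑ i)) q * 0 = 0)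
    · rw [evalPoint_derivation_sum, hQ q fun h => hq (hKO h), zero_mul]
      refine (Finset.sum_eq_zero fun i _ => ?_).symm
      change Q q * _ * _ = 0
      rw [hQ q fun h => hq (hKO h), zero_mul, zero_mul]
  have hval : ∀ i, Θ Z i p = Z.1 (ϑ i) p := by
    intro i
    have h := congrArg (fun W => evalPoint n M p (Θ W i)) key
    simp only [map_smul, map_sum, Finset.sum_apply, Pi.smul_apply, hΘ.vertical, smul_eq_mul,
      map_mul, evalPoint_apply, h1.self_of_nhds, one_mul, AlgHom.commutes] at h
    rw [h, Finset.sum_eq_single i]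
    · simp
    · intro j _ hj
      simp [Pi.single_eq_of_ne' hj]
    · simp
  have h := congrArg (fun W : logDer (ellipticIdeal n k M) => W.1 s p) key
  have e : (∑ i, (Q * Z.1 (ϑ i)) • liftedAction n k M (Pi.single i 1)).1 =
      ∑ i, (Q * Z.1 (ϑ i)) • fundamentalField n k M (Pi.single i 1) := by
    rw [Submodule.coe_sum]
    rfl
  simp only [e, evalPoint_derivation_sum] at h
  change Q p * Z.1 s p = ∑ i, Q p * Z.1 (ϑ i) p * _ at h
  simpa only [h1.self_of_nhds, one_mul, ← hval] using h

/-- On vertical vector fields, the connection is given by the derivatives of the angles. -/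
theorem IsConnection.apply_eq_angle (hΘ : IsConnection Θ) (hM : IsStandard n k M)
    {Z : logDer (ellipticIdeal n k M)} (hZ : ∀ f, Z.1 (quotientPullback n k M f) = 0)
    {a l m : ℕ} {c : StandardChart n k M a l m} {O : Set M} {ϑ : Fin k → C^∞⟮𝓡 n, M; ℝ⟯}
    (hO : IsOpen O) (hOs : O ⊆ c.source) (hOf : ∀ q ∈ O, IsFree k q)
    (hϑ : ∀ q ∈ O, torusExp (fun i => ϑ i q) = c.angle q) {p : M} (hp : p ∈ O) (i : Fin k) :
    Θ Z i p = Z.1 (ϑ i) p := by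
  rw [hΘ.vertical_apply hM hZ (hOf p hp), Finset.sum_eq_single i]
  · rw [StandardChart.fundamentalField_angle hO hOs hOf hϑ _ _ hp, Pi.single_eq_same, mul_one]
  · intro j _ hj
    rw [StandardChart.fundamentalField_angle hO hOs hOf hϑ _ _ hp, Pi.single_eq_of_ne' hj,
      mul_zero]
  · simp

end TorusAction
end

noncomputable section

/-! ### Closedness and local primitives of the curvature -/

namespace LogForms

section Algebra

variable {R : Type*} [CommRing R] [Algebra ℝ R] {I : Ideal R} {k : ℕ}

theorem dOne_apply (α : OneForm I k) (X Y : logDer I) (i : Fin k) :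
    dOne I k α ![X, Y] i = X.1 (α Y i) - Y.1 (α X i) - α (bracket X Y) i := rfl

theorem dTwo_apply (β : TwoForm I k) (X Y Z : logDer I) (i : Fin k) :
    dTwo I k β ![X, Y, Z] i = X.1 (β ![Y, Z] i) - Y.1 (β ![X, Z] i) + Z.1 (β ![X, Y] i)
      - β ![bracket X Y, Z] i + β ![bracket X Z, Y] i - β ![bracket Y Z, X] i := rfl

theorem oneForm_combination (α : OneForm I k) (Z X Y W : logDer I) (r s t : R) (i : Fin k) :
    α (Z + r • X + s • Y - t • W) i = α Z i + r * α X i + s * α Y i - t * α W i := by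
  simp

theorem bracket_apply (X Y : logDer I) (f : R) :
    (bracket X Y).1 f = X.1 (Y.1 f) - Y.1 (X.1 f) := Derivation.commutator_apply ..

end Algebra

end LogForms

namespace TorusAction

open LogForms Set

variable {n k : ℕ} {M : Type*} [TopologicalSpace M] [ChartedSpace (EuclideanSpace ℝ (Fin n)) M]
  [MulAction (Torus k) M] [T2Space M] [IsManifold (𝓡 n) ∞ M] [SmoothTorusAction n k M]
  {Θ : OneForm (ellipticIdeal n k M) k}

namespace StandardChart.Cut

variable {a l m : ℕ} {c : StandardChart n k M a l m} (C : Cut c)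

/-- The values of the connection on the lifted frame of a chart. -/
def conn (hM : IsStandard n k M) (hΘ : IsConnection Θ) (i : Fin l ⊕ Fin m) :
    Fin k → smoothFunctions n k M := fun b =>
  descend (Θ (C.frameUp hM i) b) fun g p =>
    (congrArg (fun s : C^∞⟮𝓡 n, M; ℝ⟯ => s p)
      (hΘ.invariant g _ _ (C.derUp_related_translate (dir i) g) b)).symm

theorem quotientPullback_conn (hM : IsStandard n k M) (hΘ : IsConnection Θ) (i : Fin l ⊕ Fin m)
    (b : Fin k) : quotientPullback n k M (C.conn hM hΘ i b) = Θ (C.frameUp hM i) b :=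
  quotientPullback_descend _ _

/-- The local primitive of the curvature defined by the lifts of a chart. -/
def primitive (hM : IsStandard n k M) (hΘ : IsConnection Θ) : OneForm (boundaryIdeal n k M) k :=
  ∑ i, (C.coef hM i).smulRight (C.conn hM hΘ i)

theorem primitive_apply (hM : IsStandard n k M) (hΘ : IsConnection Θ)
    (Y : logDer (boundaryIdeal n k M)) (b : Fin k) :
    C.primitive hM hΘ Y b = ∑ i, C.coef hM i Y * C.conn hM hΘ i b := by
  simp [primitive, LinearMap.sum_apply, Finset.sum_apply]

theorem quotientPullback_primitive (hM : IsStandard n k M) (hΘ : IsConnection Θ)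
    (Y : logDer (boundaryIdeal n k M)) (b : Fin k) :
    quotientPullback n k M (C.primitive hM hΘ Y b) = Θ (C.lift hM Y) b := by
  rw [primitive_apply, map_sum, lift, map_sum, Finset.sum_apply]
  refine Finset.sum_congr rfl fun i _ => ?_
  rw [map_mul, quotientPullback_conn, map_smul]
  rfl

theorem lift_quotientPullback (hM : IsStandard n k M) (Y : logDer (boundaryIdeal n k M))
    (f : smoothFunctions n k M) : (C.lift hM Y).1 (quotientPullback n k M f) =
      quotientPullback n k M (C.ψ ^ 2 * Y.1 f) := C.related_lift hM Y f

end StandardChart.Cut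

variable {K : TwoForm (boundaryIdeal n k M) k}

theorem IsStandard.exists_cut (hM : IsStandard n k M) (p : M) :
    ∃ (a l m : ℕ) (c : StandardChart n k M a l m) (C : StandardChart.Cut c),
      p ∈ c.source ∧ ∀ᶠ q in 𝓝 p, C.ψ.1 (orbitMap q) = 1 := by
  obtain ⟨a, l, m, c, hp⟩ := hM p
  obtain ⟨C, -, h⟩ := c.exists_cut isOpen_univ (fun _ _ _ => mem_univ _) hp (mem_univ _)
  exact ⟨a, l, m, c, C, hp, h⟩

/-- The curvature is closed. -/
theorem IsCurvature.closed (hM : IsStandard n k M) (hK : IsCurvature Θ K) :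
    K ∈ ClosedTwoForm (boundaryIdeal n k M) k := by
  change dTwo (boundaryIdeal n k M) k K = 0
  ext1 v
  funext b
  refine smoothFunctions_ext fun p => ?_
  obtain ⟨a, l, m, c, C, -, hψ⟩ := hM.exists_cut p
  -- The sections ψ² v_i lift to M, where d(dΘ) = 0, and pull-back of functions is injective. By
  -- tensoriality the factor (ψ²)³ comes out, and it equals one at p.
  have h₁ : dTwo (boundaryIdeal n k M) k K (fun i => C.ψ ^ 2 • v i) b = 0 := by
    have hr := C.related_lift hM
    have e : ∀ {f : smoothFunctions n k M} {Y}, (C.lift hM Y).1 (quotientPullback n k M f) =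
      quotientPullback n k M ((C.ψ ^ 2 • Y : logDer _).1 f) := C.related_lift hM _ _
    have h := congrArg (fun β => β ![C.lift hM (v 0), C.lift hM (v 1), C.lift hM (v 2)] b)
      (dTwo_dOne Θ)
    simp only [AlternatingMap.zero_apply, Pi.zero_apply, dTwo_apply,
      hK _ _ _ _ (hr _) (hr _), e] at h
    have hb : ∀ X Y Z, dOne (ellipticIdeal n k M) k Θ
        ![bracket (C.lift hM X) (C.lift hM Y), C.lift hM Z] b = quotientPullback n k M
          (K ![bracket (C.ψ ^ 2 • X) (C.ψ ^ 2 • Y), C.ψ ^ 2 • Z] b) := fun X Y Z =>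
      hK _ _ _ _ ((hr X).lie (hr Y)) (hr Z) b
    simp only [hb, ← map_sub, ← map_add] at h
    refine quotientPullback_injective (h.trans (map_zero _).symm)
  rw [AlternatingMap.map_smul_univ] at h₁
  have h₂ := congrArg (fun f : smoothFunctions n k M => f.1 (orbitMap p)) h₁
  have e : (∏ _i : Fin 3, C.ψ ^ 2).1 (orbitMap p) = 1 := by
    rw [← evalAt_apply]
    simp [evalAt_apply, hψ.self_of_nhds]
  change (∏ _i : Fin 3, C.ψ ^ 2).1 (orbitMap p) * (dTwo _ k K v b).1 (orbitMap p) = 0 at h₂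
  rwa [e, one_mul] at h₂

/-- On free orbits Θ(Z) is the derivative of the angles, hence zero. Continuity of Θ(Z) extends this
to the orbits with stabilisers, where no angles exist. -/
theorem StandardChart.connection_eq_zero {a l m : ℕ} (c : StandardChart n k M a l m)
    (hM : IsStandard n k M) (hΘ : IsConnection Θ)
    {Z : logDer (ellipticIdeal n k M)} (hZ : ∀ f, Z.1 (quotientPullback n k M f) = 0)
    (hang : ∀ (O : Set M) (ϑ : Fin k → C^∞⟮𝓡 n, M; ℝ⟯), IsOpen O → O ⊆ c.source →
      (∀ q ∈ O, IsFree k q) → (∀ q ∈ O, torusExp (fun i => ϑ i q) = c.angle q) →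
        ∀ i, ∀ q ∈ O, Z.1 (ϑ i) q = 0) (i : Fin k) :
    ∀ p ∈ c.source, Θ Z i p = 0 := by
  refine hM.eqOn_of_isFree c.isOpen_source (Θ Z i).contMDiff.continuous.continuousOn
    continuousOn_const fun p hp hfree => ?_
  obtain ⟨O, ϑ, hO, hpO, hOs, hOf, hϑ⟩ := c.exists_angles hp hfree
  rw [hΘ.apply_eq_angle hM hZ hO hOs hOf hϑ hpO, hang O ϑ hO hOs hOf hϑ i p hpO]

namespace StandardChart.Cut

variable {a l m : ℕ} {c : StandardChart n k M a l m} (C : Cut c)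

/-- Where the cutoff is one, the curvature is the differential of the local primitive. -/
theorem curvature_eq (hM : IsStandard n k M) (hΘ : IsConnection Θ) (hK : IsCurvature Θ K) {p : M}
    (hp : p ∈ c.source) (hψ : ∀ᶠ q in 𝓝 p, C.ψ.1 (orbitMap q) = 1)
    (Y₁ Y₂ : logDer (boundaryIdeal n k M)) (b : Fin k) :
    (K ![Y₁, Y₂] b).1 (orbitMap p) =
      (dOne (boundaryIdeal n k M) k (C.primitive hM hΘ) ![Y₁, Y₂] b).1 (orbitMap p) := by
  set π := quotientPullback n k M
  -- The failure of the lift to respect brackets. As `C.lift` covers ψ²Y, the bracket of lifts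
  -- covers [ψ²Y₁, ψ²Y₂], whose Leibniz terms are subtracted. Hence Z is vertical; it annihilates
  -- the angles because all the lifts do, so Θ(Z) = 0.
  let Z : logDer (ellipticIdeal n k M) := bracket (C.lift hM Y₁) (C.lift hM Y₂) -
    π (C.ψ ^ 2) • C.lift hM (bracket Y₁ Y₂) - π (Y₁.1 (C.ψ ^ 2)) • C.lift hM Y₂ +
    π (Y₂.1 (C.ψ ^ 2)) • C.lift hM Y₁
  have hZ' : ∀ f, Z.1 f = (C.lift hM Y₁).1 ((C.lift hM Y₂).1 f) -
      (C.lift hM Y₂).1 ((C.lift hM Y₁).1 f) - π (C.ψ ^ 2) * (C.lift hM (bracket Y₁ Y₂)).1 f -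
      π (Y₁.1 (C.ψ ^ 2)) * (C.lift hM Y₂).1 f + π (Y₂.1 (C.ψ ^ 2)) * (C.lift hM Y₁).1 f :=
    fun f => by rw [← bracket_apply]; rfl
  have hZ : ∀ f, Z.1 (π f) = 0 := fun f => by
    rw [hZ', C.lift_quotientPullback, C.lift_quotientPullback, C.lift_quotientPullback,
      C.lift_quotientPullback, C.lift_quotientPullback, ← map_mul, ← map_mul, ← map_mul, ← map_sub,
      ← map_sub, ← map_sub, ← map_add, bracket_apply]
    refine (congrArg _ ?_).trans (map_zero π)
    simp only [Derivation.leibniz, smul_eq_mul]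
    ring
  have hΘZ := c.connection_eq_zero hM hΘ hZ (fun O ϑ hO hOs hOf hϑ i q hq => by
    have h0 : ∀ Y, ∀ q ∈ O, (C.lift hM Y).1 (ϑ i) q = 0 := fun Y q hq =>
      C.lift_angle hM Y hO hOs hOf hϑ i hq
    have h1 : ∀ Y Y', (C.lift hM Y).1 ((C.lift hM Y').1 (ϑ i)) q = 0 := fun Y Y' =>
      derivation_local _ (by filter_upwards [hO.mem_nhds hq] with q' hq' using h0 Y' q' hq')
    rw [hZ']
    change _ - _ - _ * (C.lift hM _).1 (ϑ i) q - _ * (C.lift hM _).1 (ϑ i) q +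
      _ * (C.lift hM _).1 (ϑ i) q = 0
    rw [h0 _ q hq, h0 _ q hq, h0 _ q hq, h1, h1]
    ring) b p hp
  have h₁ := hK _ _ _ _ (C.related_lift hM Y₁) (C.related_lift hM Y₂) b
  rw [dOne_apply, two_smul_left, two_smul_right] at h₁
  have e : bracket (C.lift hM Y₁) (C.lift hM Y₂) = Z + π (C.ψ ^ 2) • C.lift hM (bracket Y₁ Y₂) +
      π (Y₁.1 (C.ψ ^ 2)) • C.lift hM Y₂ - π (Y₂.1 (C.ψ ^ 2)) • C.lift hM Y₁ := by
    simp only [Z]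
    abel
  rw [e, oneForm_combination] at h₁
  simp only [Pi.smul_apply, smul_eq_mul, ← C.quotientPullback_primitive hM hΘ, C.lift_quotientPullback] at h₁
  have h₂ := congrArg (fun s : C^∞⟮𝓡 n, M; ℝ⟯ => s p) h₁
  -- Near p the cutoff is constant, so the Leibniz terms drop out at p.
  have hd : ∀ Y : logDer (boundaryIdeal n k M), (Y.1 (C.ψ ^ 2)).1 (orbitMap p) = 0 := fun Y => by
    refine (hM.derivation_congr Y.1 (g := 1) ?_).trans ?_
    · filter_upwards [hψ] with q hq
      change C.ψ.1 _ ^ 2 = 1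
      rw [hq, one_pow]
    · rw [Derivation.map_one_eq_zero]; rfl
  have h₄ : C.ψ.1 (orbitMap p) = 1 := hψ.self_of_nhds
  rw [dOne_apply]
  change C.ψ.1 _ ^ 2 * _ - C.ψ.1 _ ^ 2 * _ - (_ + C.ψ.1 _ ^ 2 * _ + (Y₁.1 (C.ψ ^ 2)).1 _ * _ -
    (Y₂.1 (C.ψ ^ 2)).1 _ * _) = C.ψ.1 _ ^ 2 * (C.ψ.1 _ ^ 2 * (K ![Y₁, Y₂] b).1 (orbitMap p)) at h₂
  rw [hΘZ, hd, hd, h₄, quotientPullback_apply] at h₂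
  change _ = (_ - _ - _ : ℝ)
  linear_combination -h₂

end StandardChart.Cut

end TorusAction
end

noncomputable section

namespace TorusAction

open LogForms Set

variable {n k : ℕ} {M : Type*} [TopologicalSpace M] [ChartedSpace (EuclideanSpace ℝ (Fin n)) M]
  [MulAction (Torus k) M]

namespace StandardChart

variable {a l m a' l' m' : ℕ} (c : StandardChart n k M a l m) (c' : StandardChart n k M a' l' m')

/-! ### Rays in a coordinate disc -/

/-- The curve obtained by moving the coordinate `z_j` along the real axis. -/
def ray (j : Fin l) (q : M) (r : ℝ) : M := c.inv (c.w q) (Function.update (c.z q) j r) (c.x q)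

theorem contMDiff_ray (j : Fin l) (q : M) : ContMDiff 𝓘(ℝ) (𝓡 n) ∞ (c.ray j q) := by
  obtain ⟨θ, hθ⟩ := torusExp_surjective (c.w q)
  have h : ContDiff ℝ ∞ fun r : ℝ =>
      ((θ, Function.update (c.z q) j (r : ℂ), c.x q) : (Fin a → ℝ) × Slice l m) := by
    refine contDiff_const.prodMk (ContDiff.prodMk (contDiff_pi.mpr fun i => ?_) contDiff_const)
    by_cases hi : i = j
    · subst hi
      simp only [Function.update_self]
      exact Complex.ofRealCLM.contDiff
    · simp only [Function.update_of_ne hi]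
      exact contDiff_const
  have e : c.ray j q = (fun p : (Fin a → ℝ) × Slice l m => c.inv (torusExp p.1) p.2.1 p.2.2) ∘
      fun r : ℝ => (θ, Function.update (c.z q) j (r : ℂ), c.x q) := by
    funext r
    simp only [Function.comp_apply, hθ, ray]
  rw [e]
  exact c.contMDiff_inv.comp h.contMDiff

theorem ray_mem (j : Fin l) (q : M) (r : ℝ) : c.ray j q r ∈ c.source := c.inv_mem _ _ _

variable {c} {j : Fin l} {q : M}

theorem ray_zero (hq : q ∈ c.source) (hj : c.z q j = 0) : c.ray j q 0 = q := by
  rw [ray, Complex.ofReal_zero, ← hj, Function.update_eq_self]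
  exact c.left_inv q hq

theorem tendsto_ray (hq : q ∈ c.source) (hj : c.z q j = 0) :
    Filter.Tendsto (c.ray j q) (𝓝 0) (𝓝 q) := by
  have h := (c.contMDiff_ray j q).continuous.tendsto 0
  rwa [ray_zero hq hj] at h

theorem isFree_ray (hj : ∀ i, c.z q i = 0 → i = j) {r : ℝ} (hr : r ≠ 0) :
    IsFree k (c.ray j q r) := by
  rw [c.isFree_iff (c.ray_mem j q r)]
  intro i
  rw [ray, c.z_inv]
  by_cases hi : i = j
  · subst hi
    simpa using hr
  · rw [Function.update_of_ne hi]
    exact fun h => hi (hj i h)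

theorem z_ray (r : ℝ) : c.z (c.ray j q r) j = r := by
  rw [ray, c.z_inv, Function.update_self]

variable [T2Space M]

/-- The lift of ψ t_j ∂_{t_j} preserves the ray and acts on it as ψ (r/2) ∂_r; behaviour at the
boundary is thereby reduced to functions of one real variable. -/
theorem Cut.flow_ray (C : Cut c) (r s : ℝ) : C.flow (dir (Sum.inl j)) (c.ray j q r, s) =
    c.ray j q (Real.exp (s * C.ψ.1 (orbitMap (c.ray j q r)) / 2) * r) := by
  rw [C.flow_of_mem _ (c.ray_mem j q r)]
  generalize C.ψ.1 (orbitMap (c.ray j q r)) = u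
  simp only [ray, c.w_inv, c.z_inv, c.x_inv, dir, Sum.elim_inl, Pi.zero_apply, mul_zero, add_zero]
  congr 1
  funext i
  by_cases hi : i = j
  · subst hi
    simp
  · simp [hi]

variable [SmoothTorusAction n k M]

/-- Comparison of the boundary coordinates of two charts, near a point where only one of those of
the first vanishes. -/
theorem exists_quot_coordinate (hM : IsStandard n k M) (hq : q ∈ c.source)
    (hj : ∀ i, c.z q i = 0 → i = j) (hq' : q ∈ c'.source) (i : Fin l') :
    ∃ G : smoothFunctions n k M, ∀ᶠ p in 𝓝 q, ‖c.z p j‖ ^ 2 = ‖c'.z p i‖ ^ 2 * G.1 (orbitMap p) := by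
  have hO : IsOpen (c'.source ∩ {p ∈ c.source | ∀ i, i ≠ j → c.z p i ≠ 0}) := by
    refine c'.isOpen_source.inter (c.contMDiffOn_z.continuousOn.isOpen_inter_preimage
      c.isOpen_source (t := {z : Fin l → ℂ | ∀ i, i ≠ j → z i ≠ 0}) ?_)
    simp only [ofPred_forall]
    exact isOpen_iInter_of_finite fun i => isOpen_iInter_of_finite fun _ =>
      isOpen_ne.preimage (continuous_apply i)
  obtain ⟨C, hC, hψ⟩ := c.exists_cut hO (fun g p hp => ⟨c'.smul_mem g p hp.1,
    c.smul_mem g p hp.2.1, fun i hi => by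
      rw [c.z_smul g p hp.2.1]
      exact mul_ne_zero (Circle.coe_ne_zero _) (hp.2.2 i hi)⟩) hq
    ⟨hq', hq, fun i hi h => hi (hj i h)⟩
  -- The support of ψ avoids the zeros of all z_i with i ≠ j. A zero of a coordinate of c' lies on
  -- ∂B, and within this support that forces z_j = 0.
  have hdiv : ∀ p ∈ c'.source, c'.z p i = 0 → (C.ψ * C.t j).1 (orbitMap p) = 0 := by
    intro p hp hz
    change C.ψ.1 _ * _ = 0
    by_cases hK : p ∈ C.K
    · have hU := C.subset_U hK
      obtain ⟨i', hi'⟩ := (c.mem_boundary_iff hM (C.subset_source hU)).mp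
        ((c'.mem_boundary_iff hM hp).mpr ⟨i, hz⟩)
      have : i' = j := by
        by_contra h
        exact (hC hU).2.2 i' h hi'
      subst this
      rw [C.t_eq p hU, hi', norm_zero, zero_pow two_ne_zero, mul_zero]
    · rw [C.ψ_eq_zero p hK, zero_mul]
  obtain ⟨G, -, hG⟩ := c'.exists_div hM C.isClosed_K (fun p hp => (hC (C.subset_U hp)).1)
    (C.ψ * C.t j) i hdiv fun p hp => by
      change C.ψ.1 _ * _ = 0
      rw [C.ψ_eq_zero p hp, zero_mul]
  refine ⟨G, ?_⟩
  filter_upwards [hψ, c'.isOpen_source.mem_nhds hq'] with p hp hp'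
  have hU : p ∈ C.U := by
    by_contra h
    have := C.ψ_eq_zero p fun h' => h (C.subset_U h')
    simp [hp] at this
  rw [← hG p hp']
  change _ = C.ψ.1 _ * _
  rw [hp, one_mul, C.t_eq p hU]

variable [IsManifold (𝓡 n) ∞ M]

/-- Along a ray, the coordinates of another chart are smooth nowhere vanishing functions, up to a
positive factor. -/
theorem exists_ray_coordinate (hM : IsStandard n k M) (hq : q ∈ c.source)
    (hj : ∀ i, c.z q i = 0 ↔ i = j) (hq' : q ∈ c'.source) (i : Fin l') :
    ∃ ξ : ℝ → ℂ, ContDiff ℝ ∞ ξ ∧ ξ 0 ≠ 0 ∧ ∀ᶠ r in 𝓝 (0 : ℝ), ∃ u : ℝ, (0 < r → 0 < u) ∧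
      c'.z (c.ray j q r) i = u * ξ r := by
  have hj0 := (hj j).mpr rfl
  have hz : ContMDiffOn (𝓡 n) 𝓘(ℝ, ℂ) ∞ (fun p => c'.z p i) c'.source :=
    contMDiffOn_pi_space.mp c'.contMDiffOn_z i
  obtain ⟨f, hf⟩ := exists_smooth_extension c'.isOpen_source hq'
    (Complex.reCLM.contDiff.contMDiff.comp_contMDiffOn hz)
  obtain ⟨g, hg⟩ := exists_smooth_extension c'.isOpen_source hq'
    (Complex.imCLM.contDiff.contMDiff.comp_contMDiffOn hz)
  have hfs : ContDiff ℝ ∞ fun r => f (c.ray j q r) := (f.contMDiff.comp (c.contMDiff_ray j q)).contDiff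
  have hgs : ContDiff ℝ ∞ fun r => g (c.ray j q r) := (g.contMDiff.comp (c.contMDiff_ray j q)).contDiff
  have hray := tendsto_ray hq hj0
  have hcomb : ∀ {f g : ℝ → ℝ}, ContDiff ℝ ∞ f → ContDiff ℝ ∞ g →
      ContDiff ℝ ∞ fun r => (f r : ℂ) + g r * Complex.I := fun hf hg =>
    (Complex.ofRealCLM.contDiff.comp hf).add ((Complex.ofRealCLM.contDiff.comp hg).mul contDiff_const)
  have hev : ∀ᶠ r in 𝓝 (0 : ℝ), c'.z (c.ray j q r) i =
      f (c.ray j q r) + g (c.ray j q r) * Complex.I := by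
    filter_upwards [hray.eventually hf, hray.eventually hg] with r h₁ h₂
    rw [h₁, h₂]
    exact (Complex.re_add_im _).symm
  by_cases h0 : c'.z q i = 0
  · have hf0 : f q = 0 := by
      rw [hf.self_of_nhds]
      exact congrArg Complex.re h0
    have hg0 : g q = 0 := by
      rw [hg.self_of_nhds]
      exact congrArg Complex.im h0
    obtain ⟨F, hF, hF'⟩ := SmoothDivision.exists_div_linear hfs (ContinuousLinearMap.id ℝ ℝ) (e := 1)
      rfl (fun v hv => by
        obtain rfl : v = 0 := hv
        rw [ray_zero hq hj0, hf0])
    obtain ⟨G, hG, hG'⟩ := SmoothDivision.exists_div_linear hgs (ContinuousLinearMap.id ℝ ℝ) (e := 1)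
      rfl (fun v hv => by
        obtain rfl : v = 0 := hv
        rw [ray_zero hq hj0, hg0])
    have hev' : ∀ᶠ r in 𝓝 (0 : ℝ), c'.z (c.ray j q r) i = r * (F r + G r * Complex.I) := by
      filter_upwards [hev] with r hr
      rw [hr, hF', hG']
      simp only [ContinuousLinearMap.id_apply, Complex.ofReal_mul]
      ring
    refine ⟨fun r => F r + G r * Complex.I, hcomb hF hG, fun hξ => ?_, ?_⟩
    -- Here the coordinate of c' is r ξ(r), and r² is the square of its modulus times H. Cancelling
    -- r² gives |ξ|² H = 1 for small r ≠ 0, which is incompatible with ξ(0) = 0.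
    · obtain ⟨H, hH⟩ := exists_quot_coordinate c' hM hq (fun i => (hj i).mp) hq' i
      have hlim : Filter.Tendsto (fun r : ℝ => ‖(F r : ℂ) + G r * Complex.I‖ ^ 2 *
          H.1 (orbitMap (c.ray j q r))) (𝓝[≠] 0) (𝓝 0) := by
        have h₁ : Continuous fun r : ℝ => ‖(F r : ℂ) + G r * Complex.I‖ ^ 2 *
            H.1 (orbitMap (c.ray j q r)) :=
          ((hcomb hF hG).continuous.norm.pow 2).mul
            (H.2.continuous.comp (c.contMDiff_ray j q).continuous)
        have h₂ := (h₁.tendsto 0).mono_left (nhdsWithin_le_nhds (s := {0}ᶜ))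
        simpa only [hξ, norm_zero, zero_pow two_ne_zero, zero_mul] using h₂
      have hone : Filter.Tendsto (fun r : ℝ => ‖(F r : ℂ) + G r * Complex.I‖ ^ 2 *
          H.1 (orbitMap (c.ray j q r))) (𝓝[≠] 0) (𝓝 1) := by
        refine tendsto_const_nhds.congr' ?_
        filter_upwards [(hray.eventually hH).filter_mono nhdsWithin_le_nhds,
          hev'.filter_mono nhdsWithin_le_nhds, self_mem_nhdsWithin] with r h₁ h₂ hr
        rw [h₂, z_ray, norm_mul, mul_pow, mul_assoc] at h₁
        have hr' : ‖(r : ℂ)‖ ^ 2 ≠ 0 := by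
          simpa using hr
        exact mul_left_cancel₀ hr' (by rw [mul_one, ← h₁])
      exact zero_ne_one (tendsto_nhds_unique hlim hone)
    · filter_upwards [hev'] with r hr using ⟨r, id, hr⟩
  · refine ⟨fun r => f (c.ray j q r) + g (c.ray j q r) * Complex.I, hcomb hfs hgs, ?_, ?_⟩
    · have h₁ := hev.self_of_nhds
      simp only [ray_zero hq hj0] at h₁ ⊢
      rwa [← h₁]
    · filter_upwards [hev] with r hr
      exact ⟨1, fun _ => one_pos, by rw [hr]; simp⟩

/-- The angles of another chart extend smoothly to the end point of a ray. -/
theorem exists_ray_angle (hM : IsStandard n k M) (hq : q ∈ c.source)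
    (hj : ∀ i, c.z q i = 0 ↔ i = j) (hq' : q ∈ c'.source) :
    ∃ (O : Set ℝ) (φ : ℝ → Fin k → ℝ), IsOpen O ∧ 0 ∈ O ∧ ContDiffOn ℝ ∞ φ O ∧
      ∀ r ∈ O, 0 < r → torusExp (φ r) = c'.angle (c.ray j q r) := by
  choose ξ hξ hξ0 hev using exists_ray_coordinate c' hM hq hj hq'
  have hray0 := ray_zero hq ((hj j).mpr rfl)
  obtain ⟨O₁, hO₁, h0O₁, -, θ, hθ, hθe⟩ := exists_torus_angle (I := 𝓘(ℝ))
    (f := fun r => c'.w (c.ray j q r)) (p := (0 : ℝ))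
    (c'.isOpen_source.preimage (c.contMDiff_ray j q).continuous)
    (fun i => (c'.contMDiffOn_w i).comp (c.contMDiff_ray j q).contMDiffOn fun r hr => hr)
    (by rwa [mem_preimage, hray0])
  have hO' : IsOpen {r : ℝ | ∀ i, ξ i r ≠ 0} := by
    simp only [ofPred_forall]
    exact isOpen_iInter_of_finite fun i => isOpen_ne.preimage (hξ i).continuous
  obtain ⟨O₂, hO₂, h0O₂, -, χ, hχ, hχe⟩ := exists_torus_angle (I := 𝓘(ℝ))
    (f := fun r i => phase (ξ i r)) (p := (0 : ℝ)) hO' (fun i r hr =>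
      ContMDiffAt.comp_contMDiffWithinAt (g := phase) r (contMDiffAt_phase (hr i))
        (hξ i).contMDiff.contMDiffAt.contMDiffWithinAt) hξ0
  obtain ⟨O₃, hO₃e, hO₃, h0O₃⟩ := eventually_nhds_iff.mp (Filter.eventually_all.mpr hev)
  obtain ⟨L₁, L₂, hL⟩ := c'.exists_linear_generators_symm
  refine ⟨O₁ ∩ O₂ ∩ O₃, fun r => L₁ (θ r) + L₂ (χ r), (hO₁.inter hO₂).inter hO₃,
    ⟨⟨h0O₁, h0O₂⟩, h0O₃⟩, ?_, fun r hr hr0 => ?_⟩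
  · exact (L₁.contDiff.comp_contDiffOn (hθ.contDiffOn.mono fun r hr => hr.1.1)).add
      (L₂.contDiff.comp_contDiffOn (hχ.contDiffOn.mono fun r hr => hr.1.2))
  · rw [← hL, hθe r hr.1.1, hχe r hr.1.2, angle]
    congr 2
    funext i
    -- For r > 0 the factor u is positive and does not affect the phase, so the phase is that of
    -- ξ_i, which is smooth through r = 0.
    obtain ⟨u, hu, he⟩ := hO₃e r hr.2 i
    rw [he]
    conv_rhs => rw [← norm_mul_phase (ξ i r), ← mul_assoc, ← Complex.ofReal_mul]
    by_cases h : ξ i r = 0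
    · simp [h, phase]
    · exact (phase_real_mul (mul_pos (hu hr0) (norm_pos_iff.mpr h)) _).symm

end StandardChart

end TorusAction
end

noncomputable section

/-! ### Comparison of the local primitives of two charts -/

namespace LogForms

section Algebra

variable {R : Type*} [CommRing R] [Algebra ℝ R] {k : ℕ}

theorem oneForm_smul_sub {I : Ideal R} (α : OneForm I k) (r : R) (X Y : logDer I) (i : Fin k) :
    α (r • X - Y) i = r * α X i - α Y i := by
  simp

/-- The one-form `df ⊗ v`. -/
def dSMul (I : Ideal R) (f : R) (v : Fin k → R) : OneForm I k where
  toFun X := X.1 f • v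
  map_add' X Y := by simp [add_smul]
  map_smul' r X := by simp [mul_smul]

theorem dSMul_apply (I : Ideal R) (f : R) (v : Fin k → R) (X : logDer I) (i : Fin k) :
    dSMul I f v X i = X.1 f * v i := rfl

end Algebra

end LogForms

namespace TorusAction

open LogForms Set

variable {n k : ℕ} {M : Type*} [TopologicalSpace M] [ChartedSpace (EuclideanSpace ℝ (Fin n)) M]
  [MulAction (Torus k) M] [T2Space M] [IsManifold (𝓡 n) ∞ M] [SmoothTorusAction n k M]
  {Θ : OneForm (ellipticIdeal n k M) k}

namespace StandardChart.Cut

variable {a l m a' l' m' : ℕ} {c : StandardChart n k M a l m} {c' : StandardChart n k M a' l' m'}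
  (C : Cut c) (C' : Cut c')

theorem primitive_eq_zero (hM : IsStandard n k M) (hΘ : IsConnection Θ)
    (Y : logDer (boundaryIdeal n k M)) (b : Fin k) {q : M} (hq : q ∉ C.K) :
    (C.primitive hM hΘ Y b).1 (orbitMap q) = 0 := by
  rw [primitive_apply, ← evalAt_apply, map_sum]
  refine Finset.sum_eq_zero fun i _ => ?_
  rw [map_mul, evalAt_apply, C.coef_eq_zero hM i Y hq, zero_mul]

/-- The difference of the lifts of a frame with respect to two charts. -/
def liftDifference (hM : IsStandard n k M) (i : Fin l ⊕ Fin m) : logDer (ellipticIdeal n k M) :=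
  quotientPullback n k M (C'.ψ ^ 2) • C.frameUp hM i - C'.lift hM (C.frame hM i)

/-- The weight ψ'² on the first lift matches the one built into `C'.lift`, so both cover the same
section and their difference is vertical. -/
theorem liftDifference_quotientPullback (hM : IsStandard n k M) (i : Fin l ⊕ Fin m)
    (f : smoothFunctions n k M) :
    (C.liftDifference C' hM i).1 (quotientPullback n k M f) = 0 := by
  have h₁ := C'.lift_quotientPullback hM (C.frame hM i) f
  have h₂ := C.derUp_related (dir i) f
  change _ * C.derUp (dir i) _ - (C'.lift hM _).1 _ = 0
  rw [h₁, h₂, ← map_mul]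
  exact sub_self _

theorem connection_liftDifference (hM : IsStandard n k M) (hΘ : IsConnection Θ)
    (i : Fin l ⊕ Fin m) (b : Fin k) (q : M) : Θ (C.liftDifference C' hM i) b q =
      C'.ψ.1 (orbitMap q) ^ 2 * (C.conn hM hΘ i b).1 (orbitMap q) -
        (C'.primitive hM hΘ (C.frame hM i) b).1 (orbitMap q) := by
  rw [liftDifference, oneForm_smul_sub, ← C.quotientPullback_conn hM hΘ, ← C'.quotientPullback_primitive hM hΘ]
  rfl

-- The lift of c' annihilates the angles of c', so only their derivative along the flow of c
-- contributes. On the ray this flow has speed ψ r/2 at s = 0; the factor r is what makes the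
-- expression vanish at the boundary.
variable {C'} in
theorem liftDifference_angle (hM : IsStandard n k M) {j : Fin l} {q : M} {O : Set ℝ}
    {φ : ℝ → Fin k → ℝ} (hO : IsOpen O) (hφ : ContDiffOn ℝ ∞ φ O)
    (hφe : ∀ r ∈ O, 0 < r → torusExp (φ r) = c'.angle (c.ray j q r)) {O' : Set M}
    {ϑ : Fin k → C^∞⟮𝓡 n, M; ℝ⟯} (hO' : IsOpen O') (hOs : O' ⊆ c'.source)
    (hOf : ∀ q ∈ O', IsFree k q) (hϑ : ∀ q ∈ O', torusExp (fun i => ϑ i q) = c'.angle q) {r : ℝ}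
    (hr : r ∈ O) (hr0 : 0 < r) (hrO' : c.ray j q r ∈ O') (b : Fin k) :
    (C.liftDifference C' hM (Sum.inl j)).1 (ϑ b) (c.ray j q r) =
      C'.ψ.1 (orbitMap (c.ray j q r)) ^ 2 * (deriv (fun r => φ r b) r *
        (C.ψ.1 (orbitMap (c.ray j q r)) / 2 * r)) := by
  have hd := (differentiableAt_flow (C.contMDiff_flow (dir (Sum.inl j))) (ϑ b)
    (c.ray j q r)).hasDerivAt
  have he : HasDerivAt (fun s : ℝ => Real.exp (s * C.ψ.1 (orbitMap (c.ray j q r)) / 2) * r)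
      (C.ψ.1 (orbitMap (c.ray j q r)) / 2 * r) 0 := by
    have h := ((((hasDerivAt_id (0 : ℝ)).mul_const (C.ψ.1 (orbitMap (c.ray j q r)))).div_const
      2).exp).mul_const r
    simpa using h
  have he0 : Real.exp (0 * C.ψ.1 (orbitMap (c.ray j q r)) / 2) * r = r := by simp
  have hφd : HasDerivAt (fun r => φ r b) (deriv (fun r => φ r b) r)
      (Real.exp (0 * C.ψ.1 (orbitMap (c.ray j q r)) / 2) * r) := by
    rw [he0]
    have h := (contDiffOn_pi.mp hφ b).contDiffAt (hO.mem_nhds hr)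
    exact (h.differentiableAt (by simp)).hasDerivAt
  have key := deriv_eq_of_circleExp_eq hd (HasDerivAt.comp (0 : ℝ) hφd he) (by
    have h₁ := (tendsto_flow (C.contMDiff_flow (dir (Sum.inl j))) (C.flow_zero _)
      (c.ray j q r)).eventually (hO'.mem_nhds hrO')
    have h₂ := he.continuousAt.tendsto
    rw [he0] at h₂
    filter_upwards [h₁, h₂.eventually (hO.mem_nhds hr)] with s hs hs'
    have e := hϑ _ hs
    rw [C.flow_ray, ← hφe _ hs' (mul_pos (Real.exp_pos _) hr0)] at e
    exact (congrArg (fun s => Circle.exp (ϑ b s)) (C.flow_ray r s)).trans (congrFun e b))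
  have h0 := C'.lift_angle hM (C.frame hM (Sum.inl j)) hO' hOs hOf hϑ b hrO'
  change _ * C.derUp (dir (Sum.inl j)) (ϑ b) (c.ray j q r) - (C'.lift hM _).1 (ϑ b) _ = _
  rw [h0, sub_zero, derUp_apply, key]
  rfl

/-- On `z_j = 0`, the value of the connection on the lift of `t_j ∂_{t_j}` does not depend on the
chart defining the lift. -/
theorem residue_eq (hM : IsStandard n k M) (hΘ : IsConnection Θ) (j : Fin l) {q : M}
    (hq : q ∈ c.source) (hj : c.z q j = 0) (b : Fin k) :
    C'.ψ.1 (orbitMap q) ^ 2 * (C.conn hM hΘ (Sum.inl j) b).1 (orbitMap q) =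
      (C'.primitive hM hΘ (C.frame hM (Sum.inl j)) b).1 (orbitMap q) := by
  set F := Θ (C.liftDifference C' hM (Sum.inl j)) b with hF
  have hFc : Continuous F := F.contMDiff.continuous
  -- By continuity of F it suffices to treat points where z_j is the only vanishing coordinate;
  -- there the rest of the ray consists of free orbits.
  suffices h : ∀ q ∈ {q ∈ c.source | ∀ i, c.z q i = 0 ↔ i ∈ ({j} : Set (Fin l))}, F q = 0 by
    have h' : F q = 0 := closure_minimal (s := {q ∈ c.source | ∀ i, c.z q i = 0 ↔
      i ∈ ({j} : Set (Fin l))}) h (isClosed_eq hFc continuous_const)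
      (c.mem_closure_of_vanishing {j} hq (by rintro i rfl; exact hj))
    rw [hF, C.connection_liftDifference C' hM hΘ] at h'
    exact sub_eq_zero.mp h'
  clear hq hj q
  rintro q ⟨hq, hj⟩
  by_cases hq' : q ∈ c'.source
  · obtain ⟨O, φ, hO, h0O, hφ, hφe⟩ := exists_ray_angle c' hM hq hj hq'
    have hray0 := ray_zero hq ((hj j).mpr rfl)
    have hrc := (c.contMDiff_ray j q).continuous
    have h₁ : Filter.Tendsto (fun r => F (c.ray j q r)) (𝓝[>] 0) (𝓝 (F q)) := by
      have h := (hFc.comp hrc).tendsto 0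
      simp only [Function.comp_apply, hray0] at h
      exact h.mono_left nhdsWithin_le_nhds
    -- The derivative of φ stays bounded because φ is smooth at r = 0, and the factor r tends to
    -- zero.
    have h₂ : Filter.Tendsto (fun r => C'.ψ.1 (orbitMap (c.ray j q r)) ^ 2 *
        (deriv (fun r => φ r b) r * (C.ψ.1 (orbitMap (c.ray j q r)) / 2 * r))) (𝓝[>] 0) (𝓝 0) := by
      have hd : ContinuousAt (deriv fun r => φ r b) 0 :=
        (((contDiffOn_pi.mp hφ b).continuousOn_deriv_of_isOpen hO (by simp)).continuousAt
          (hO.mem_nhds h0O))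
      have hψ : ContinuousAt (fun r => C.ψ.1 (orbitMap (c.ray j q r))) 0 :=
        (C.ψ.2.continuous.comp hrc).continuousAt
      have hψ' : ContinuousAt (fun r => C'.ψ.1 (orbitMap (c.ray j q r))) 0 :=
        (C'.ψ.2.continuous.comp hrc).continuousAt
      have h := ((hψ'.pow 2).mul (hd.mul ((hψ.div_const 2).mul continuousAt_id))).tendsto
      have e : (C'.ψ.1 (orbitMap (c.ray j q 0))) ^ 2 * (deriv (fun r => φ r b) 0 *
        (C.ψ.1 (orbitMap (c.ray j q 0)) / 2 * id 0)) = 0 := by simp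
      refine Filter.Tendsto.mono_left ?_ nhdsWithin_le_nhds
      exact h.trans (le_of_eq (congrArg 𝓝 e))
    refine tendsto_nhds_unique h₁ (h₂.congr' ?_)
    filter_upwards [self_mem_nhdsWithin, nhdsWithin_le_nhds (hO.mem_nhds h0O),
      nhdsWithin_le_nhds ((hrc.tendsto 0).eventually (c'.isOpen_source.mem_nhds
        (hray0.symm ▸ hq')))] with r hr hrO hrs
    have hfree := isFree_ray (c := c) (fun i => (hj i).mp) hr.ne'
    obtain ⟨O', ϑ, hO', hrO', hOs, hOf, hϑ⟩ := c'.exists_angles hrs hfree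
    rw [hF, hΘ.apply_eq_angle hM (C.liftDifference_quotientPullback C' hM _) hO' hOs hOf hϑ hrO',
      C.liftDifference_angle hM hO hφ hφe hO' hOs hOf hϑ hrO hr hrO']
  · have hK : q ∉ C'.K := fun h => hq' (C'.mem_source (C'.subset_U h))
    rw [hF, C.connection_liftDifference C' hM hΘ, C'.ψ_eq_zero q hK, C'.primitive_eq_zero hM hΘ _ b hK]
    simp

/-- The difference of the local primitives of two charts is a form on the quotient which is smooth
up to the boundary. -/
theorem exists_primitive_sub (hM : IsStandard n k M) (hΘ : IsConnection Θ) :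
    ∃ α : OneForm (⊤ : Ideal (smoothFunctions n k M)) k, ∀ Y b,
      α (anchor (boundaryIdeal n k M) Y) b = C.ψ * (C'.ψ ^ 2 * C.primitive hM hΘ Y b -
        C.ψ ^ 2 * C'.primitive hM hΘ Y b) := by
  -- These are the values of Θ on `liftDifference`, the coefficients of the difference of primitives
  -- in dlog t_j and dx_i. By `residue_eq`, ψ κ_j vanishes on z_j = 0 and is t_j μ_j, which turns
  -- its dlog t_j term into the smooth form μ_j dt_j.
  let κ : Fin l ⊕ Fin m → Fin k → smoothFunctions n k M := fun i b =>
    C'.ψ ^ 2 * C.conn hM hΘ i b - C'.primitive hM hΘ (C.frame hM i) b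
  have hK : C.K ⊆ c.source := fun p hp => C.mem_source (C.subset_U hp)
  have hdiv : ∀ (j : Fin l) (b : Fin k), ∃ G : smoothFunctions n k M,
      (∀ p ∉ C.K, G.1 (orbitMap p) = 0) ∧ ∀ p ∈ c.source,
        (C.ψ * κ (Sum.inl j) b).1 (orbitMap p) = ‖c.z p j‖ ^ 2 * G.1 (orbitMap p) := by
    refine fun j b => c.exists_div hM C.isClosed_K hK _ j (fun p hp hz => ?_) fun p hp => ?_
    · have h := C.residue_eq C' hM hΘ j hp hz b
      change C.ψ.1 _ * (C'.ψ.1 _ ^ 2 * _ - _) = 0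
      rw [h, sub_self, mul_zero]
    · change C.ψ.1 _ * _ = 0
      rw [C.ψ_eq_zero p hp, zero_mul]
  choose μ hμK hμ using hdiv
  refine ⟨∑ j, dSMul ⊤ (C.t j) (fun b => C.ψ * μ j b) +
    ∑ i, dSMul ⊤ (C.x i) (fun b => C.ψ ^ 2 * κ (Sum.inr i) b), fun Y b => ?_⟩
  have h₁ : C.ψ * (C'.ψ ^ 2 * C.primitive hM hΘ Y b - C.ψ ^ 2 * C'.primitive hM hΘ Y b) =
      ∑ i, C.coef hM i Y * (C.ψ * κ i b) := by
    have e : C.ψ ^ 2 * C'.primitive hM hΘ Y b =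
        ∑ i, C.coef hM i Y * C'.primitive hM hΘ (C.frame hM i) b := by
      have h := congrArg (fun Y => C'.primitive hM hΘ Y b) (C.sum_coef_smul_frame hM Y)
      simp only [map_sum, map_smul, Finset.sum_apply, Pi.smul_apply, smul_eq_mul] at h
      exact h.symm
    rw [e, primitive_apply, Finset.mul_sum, ← Finset.sum_sub_distrib, Finset.mul_sum]
    refine Finset.sum_congr rfl fun i _ => ?_
    simp only [κ]
    ring
  rw [h₁, Fintype.sum_sum_type, LinearMap.add_apply, Pi.add_apply, LinearMap.sum_apply,
    LinearMap.sum_apply, Finset.sum_apply, Finset.sum_apply]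
  simp only [dSMul_apply]
  congr 1
  · refine Finset.sum_congr rfl fun j _ => smoothFunctions_ext fun p => ?_
    change (Y.1 (C.t j)).1 _ * (C.ψ.1 _ * (μ j b).1 _) =
      (C.radialCoef hM j Y).1 _ * (C.ψ * κ (Sum.inl j) b).1 _
    by_cases hp : p ∈ C.K
    · have h := C.radialCoef_mul hM j Y (hK hp)
      rw [hμ j b p (hK hp)]
      linear_combination -(μ j b).1 (orbitMap p) * h
    · rw [hμK j b p hp, C.radialCoef_eq_zero hM j Y hp]
      simp
  · refine Finset.sum_congr rfl fun i _ => ?_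
    rw [coef_inr]
    change Y.1 (C.x i) * (C.ψ ^ 2 * κ (Sum.inr i) b) = _
    ring

end StandardChart.Cut

end TorusAction
end

noncomputable section

/-! ### Gluing of forms on the quotient -/

namespace LogForms

section Algebra

variable {R : Type*} [CommRing R] [Algebra ℝ R] {k : ℕ}

theorem eq_vec_two {T : Type*} (v : Fin 2 → T) : v = ![v 0, v 1] := by
  funext i
  fin_cases i <;> rfl

theorem eq_vec_three {T : Type*} (v : Fin 3 → T) : v = ![v 0, v 1, v 2] := by
  funext i
  fin_cases i <;> rfl

/-- The sum of a one-form on `𝒜_I` and the pull-back of a one-form along the anchor. -/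
def addAnchor {I : Ideal R} (η : OneForm I k) (α : OneForm (⊤ : Ideal R) k) : OneForm I k :=
  η + α ∘ₗ anchor I

theorem dOne_addAnchor {I : Ideal R} (η : OneForm I k) (α : OneForm (⊤ : Ideal R) k)
    (X Y : logDer I) (i : Fin k) : dOne I k (addAnchor η α) ![X, Y] i =
      dOne I k η ![X, Y] i + dOne ⊤ k α ![anchor I X, anchor I Y] i := by
  rw [addAnchor, map_add]
  rfl

theorem anchorPullback_apply (I : Ideal R) (β : TwoForm (⊤ : Ideal R) k) (X Y : logDer I) :
    anchorPullback I β ![X, Y] = β ![anchor I X, anchor I Y] := by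
  simp only [anchorPullback, AlternatingMap.compLinearMap_apply]
  congr 1
  ext i : 1
  fin_cases i <;> rfl

theorem twoForm_ext {I : Ideal R} {β β' : TwoForm I k} (h : ∀ X Y i, β ![X, Y] i = β' ![X, Y] i) :
    β = β' := by
  ext1 v
  have e := eq_vec_two v
  funext i
  rw [e]
  exact h _ _ i

/-- Linear combinations of one-forms. -/
def combination {I : Ideal R} {ι : Type*} (s : Finset ι) (r : ι → R) (α : ι → OneForm I k) :
    OneForm I k := ∑ i ∈ s, r i • α i

theorem combination_apply {I : Ideal R} {ι : Type*} (s : Finset ι) (r : ι → R)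
    (α : ι → OneForm I k) (Y : logDer I) (c : Fin k) :
    combination s r α Y c = ∑ i ∈ s, r i * α i Y c := by
  simp [combination, LinearMap.sum_apply, Finset.sum_apply]

/-- A telescoping sum. At a point where some u_m with m < N equals one, the weights add up to one,
without any division as in a normalised partition of unity. -/
theorem sum_prod_one_sub (u : ℕ → R) (N : ℕ) :
    ∑ i ∈ Finset.range N, (∏ m ∈ Finset.range i, (1 - u m)) * u i =
      1 - ∏ m ∈ Finset.range N, (1 - u m) := by
  induction N with
  | zero => simp
  | succ N ih =>
    rw [Finset.sum_range_succ, ih, Finset.prod_range_succ]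
    ring

/-- A section of the tangent bundle multiplied by an element of `I` is a section of `𝒜_I`. -/
def mulIdeal {I : Ideal R} {P : R} (hP : P ∈ I) (X : logDer (⊤ : Ideal R)) : logDer I :=
  ⟨P • X.1, fun f _ => I.mul_mem_right (X.1 f) hP⟩

theorem anchor_mulIdeal {I : Ideal R} {P : R} (hP : P ∈ I) (X : logDer (⊤ : Ideal R)) :
    anchor I (mulIdeal hP X) = P • X := rfl

end Algebra

end LogForms

namespace TorusAction

open LogForms Set

variable {n k : ℕ} {M : Type*} [TopologicalSpace M] [ChartedSpace (EuclideanSpace ℝ (Fin n)) M]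
  [MulAction (Torus k) M]

/-! ### Gluing -/

section Glue

variable {ι : Type*} {W : ι → Set (OrbitSpace k M)} (hW : ∀ j, IsOpen (W j))
  (hcov : ∀ b, ∃ j, b ∈ W j)

include hcov in
theorem smoothFunctions_ext_of_cover {f g : smoothFunctions n k M}
    (h : ∀ j, ∀ b ∈ W j, f.1 b = g.1 b) : f = g :=
  Subtype.ext (funext fun b => (hcov b).elim fun j hj => h j b hj)

include hW hcov in
theorem exists_glue {T : Type*} (s : ι → T → smoothFunctions n k M)
    (h : ∀ i j τ, ∀ b ∈ W i, b ∈ W j → (s i τ).1 b = (s j τ).1 b) :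
    ∃ s' : T → smoothFunctions n k M, ∀ j τ, ∀ b ∈ W j, (s' τ).1 b = (s j τ).1 b := by
  choose J hJ using hcov
  refine ⟨fun τ => ⟨fun b => (s (J b) τ).1 b, fun p => ?_⟩, fun j τ b hb => h _ _ _ _ (hJ b) hb⟩
  refine ((s (J (orbitMap p)) τ).2 p).congr_of_eventuallyEq ?_
  filter_upwards [((hW _).preimage continuous_orbitMap).mem_nhds (hJ (orbitMap p))] with q hq
  exact h _ _ _ _ (hJ _) hq

variable {I : Ideal (smoothFunctions n k M)}

-- A form is a family of functions indexed by its arguments, so it is glued value by value;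
-- linearity is then checked on each set of the cover.
include hW hcov in
theorem exists_glue_oneForm (α : ι → OneForm I k)
    (h : ∀ i j Y c, ∀ b ∈ W i, b ∈ W j → (α i Y c).1 b = (α j Y c).1 b) :
    ∃ α' : OneForm I k, ∀ j Y c, ∀ b ∈ W j, (α' Y c).1 b = (α j Y c).1 b := by
  obtain ⟨s, hs⟩ := exists_glue hW hcov (T := logDer I × Fin k) (fun j τ => α j τ.1 τ.2)
    fun i j τ b hb hb' => h i j τ.1 τ.2 b hb hb'
  refine ⟨⟨⟨fun Y c => s (Y, c), fun X Y => ?_⟩, fun r Y => ?_⟩, fun j Y c b hb => hs j (Y, c) b hb⟩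
  · refine funext fun c => smoothFunctions_ext_of_cover hcov fun j b hj => ?_
    change (s (X + Y, c)).1 b = (s (X, c)).1 b + (s (Y, c)).1 b
    rw [hs j _ b hj, hs j _ b hj, hs j _ b hj, map_add]
    rfl
  · refine funext fun c => smoothFunctions_ext_of_cover hcov fun j b hj => ?_
    change (s (r • Y, c)).1 b = r.1 b * (s (Y, c)).1 b
    rw [hs j _ b hj, hs j _ b hj]
    exact congrArg (fun f : smoothFunctions n k M => f.1 b)
      (congrFun (LinearMap.map_smul (α j) r Y) c)

include hW hcov in
theorem exists_glue_twoForm (β : ι → TwoForm I k)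
    (h : ∀ i j v c, ∀ b ∈ W i, b ∈ W j → (β i v c).1 b = (β j v c).1 b) :
    ∃ β' : TwoForm I k, ∀ j v c, ∀ b ∈ W j, (β' v c).1 b = (β j v c).1 b := by
  obtain ⟨s, hs⟩ := exists_glue hW hcov (T := (Fin 2 → logDer I) × Fin k) (fun j τ => β j τ.1 τ.2)
    fun i j τ b hb hb' => h i j τ.1 τ.2 b hb hb'
  refine ⟨⟨⟨fun v c => s (v, c), fun v i X Y => ?_, fun v i r X => ?_⟩, fun v i j hv hij => ?_⟩,
    fun j v c b hb => hs j (v, c) b hb⟩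
  · refine funext fun c => smoothFunctions_ext_of_cover hcov fun j b hj => ?_
    change (s (_, c)).1 b = (s (_, c)).1 b + (s (_, c)).1 b
    rw [hs j _ b hj, hs j _ b hj, hs j _ b hj]
    simp only [AlternatingMap.map_update_add]
    rfl
  · refine funext fun c => smoothFunctions_ext_of_cover hcov fun j b hj => ?_
    change (s (_, c)).1 b = r.1 b * (s (_, c)).1 b
    rw [hs j _ b hj, hs j _ b hj]
    exact congrArg (fun f : smoothFunctions n k M => f.1 b)
      (congrFun ((β j).map_update_smul v i r X) c)
  · refine funext fun c => smoothFunctions_ext_of_cover hcov fun l b hl => ?_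
    change (s (_, c)).1 b = 0
    rw [hs l _ b hl]
    simp only [(β l).map_eq_zero_of_eq v hv hij]
    rfl

end Glue

variable [T2Space M] [IsManifold (𝓡 n) ∞ M] [SmoothTorusAction n k M]

theorem IsStandard.derivation_congr_orbit (hM : IsStandard n k M)
    (D : Derivation ℝ (smoothFunctions n k M) (smoothFunctions n k M)) {b : OrbitSpace k M}
    {f g : smoothFunctions n k M} (h : ∀ᶠ b' in 𝓝 b, f.1 b' = g.1 b') : (D f).1 b = (D g).1 b := by
  obtain ⟨p, rfl⟩ := orbitMap_surjective b
  exact hM.derivation_congr D ((eventually_orbitMap (n := n)).mp h)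

theorem IsStandard.dOne_congr (hM : IsStandard n k M) {I : Ideal (smoothFunctions n k M)}
    {α β : OneForm I k} {b : OrbitSpace k M}
    (h : ∀ᶠ b' in 𝓝 b, ∀ Y c, (α Y c).1 b' = (β Y c).1 b') (X Y : logDer I) (c : Fin k) :
    (dOne I k α ![X, Y] c).1 b = (dOne I k β ![X, Y] c).1 b := by
  rw [dOne_apply, dOne_apply]
  have h₁ : ∀ X Y : logDer I, (X.1 (α Y c)).1 b = (X.1 (β Y c)).1 b := fun X Y =>
    hM.derivation_congr_orbit _ (h.mono fun b' hb' => hb' Y c)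
  change (_ - _ - _ : ℝ) = _ - _ - _
  rw [h₁ X Y, h₁ Y X, h.self_of_nhds]

theorem IsStandard.dTwo_congr (hM : IsStandard n k M) {I : Ideal (smoothFunctions n k M)}
    {α β : TwoForm I k} {b : OrbitSpace k M}
    (h : ∀ᶠ b' in 𝓝 b, ∀ v c, (α v c).1 b' = (β v c).1 b') (X Y Z : logDer I) (c : Fin k) :
    (dTwo I k α ![X, Y, Z] c).1 b = (dTwo I k β ![X, Y, Z] c).1 b := by
  rw [dTwo_apply, dTwo_apply]
  have h₁ : ∀ (X : logDer I) v, (X.1 (α v c)).1 b = (X.1 (β v c)).1 b := fun X v =>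
    hM.derivation_congr_orbit _ (h.mono fun b' hb' => hb' v c)
  change (_ - _ + _ - _ + _ - _ : ℝ) = _ - _ + _ - _ + _ - _
  simp only [h₁, h.self_of_nhds]

/-- Forms on the quotient which agree on the sections of `𝒜_{∂B}` are equal. -/
theorem IsStandard.twoForm_eqOn (hM : IsStandard n k M) {O : Set (OrbitSpace k M)} (hO : IsOpen O)
    {α β : TwoForm (⊤ : Ideal (smoothFunctions n k M)) k}
    (h : ∀ b ∈ O, ∀ (X Y : logDer (boundaryIdeal n k M)) c,
      (α ![anchor _ X, anchor _ Y] c).1 b = (β ![anchor _ X, anchor _ Y] c).1 b) :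
    ∀ b ∈ O, ∀ v c, (α v c).1 b = (β v c).1 b := by
  intro b hb v c
  obtain ⟨p, rfl⟩ := orbitMap_surjective b
  refine hM.eqOn_of_isFree (f := fun p => (α v c).1 (orbitMap p))
    (g := fun p => (β v c).1 (orbitMap p)) (hO.preimage continuous_orbitMap)
    (α v c).2.continuous.continuousOn (β v c).2.continuous.continuousOn (fun p hp hfree => ?_) p hb
  -- Multiplication by P turns any vector field into a section of 𝒜_{∂B} without changing its value
  -- over the free orbit; density of free orbits does the rest.
  obtain ⟨P, hP, hP1⟩ := hM.exists_mem_boundaryIdeal hfree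
  have e := eq_vec_two v
  have hs : ∀ γ : TwoForm (⊤ : Ideal (smoothFunctions n k M)) k,
      (γ v c).1 (orbitMap p) =
        (γ ![anchor _ (mulIdeal hP (v 0)), anchor _ (mulIdeal hP (v 1))] c).1 (orbitMap p) := by
    intro γ
    rw [anchor_mulIdeal, anchor_mulIdeal, two_smul_left, two_smul_right, ← e]
    change _ = P.1 _ * (P.1 _ * _)
    rw [hP1, one_mul, one_mul]
  rw [hs α, hs β]
  exact h _ hp _ _ c

/-- A two-form which differs from the differential of a global one-form by forms which are locally
exact on the quotient is cohomologous to the pull-back of a closed form on the quotient. -/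
theorem IsStandard.exists_closed_form (hM : IsStandard n k M)
    {K : TwoForm (boundaryIdeal n k M) k} {ι : Type*} {W : ι → Set (OrbitSpace k M)}
    (hW : ∀ j, IsOpen (W j)) (hcov : ∀ b, ∃ j, b ∈ W j) (η : OneForm (boundaryIdeal n k M) k)
    (β : ι → OneForm (⊤ : Ideal (smoothFunctions n k M)) k)
    (h : ∀ j, ∀ b ∈ W j, ∀ X Y c, (K ![X, Y] c).1 b =
      (dOne _ k η ![X, Y] c).1 b + (dOne ⊤ k (β j) ![anchor _ X, anchor _ Y] c).1 b) :
    ∃ K' : ClosedTwoForm (⊤ : Ideal (smoothFunctions n k M)) k,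
      dOne _ k η = K - anchorPullback (boundaryIdeal n k M) K'.1 := by
  -- On an overlap both differentials restrict to K - dη on 𝒜_{∂B}, so they agree as smooth forms on
  -- B.
  obtain ⟨K', hK'⟩ := exists_glue_twoForm hW hcov (fun j => dOne ⊤ k (β j))
    (fun i j v c b hi hj => hM.twoForm_eqOn ((hW i).inter (hW j)) (fun b hb X Y c => by
      have h₁ := h i b hb.1 X Y c
      rw [h j b hb.2 X Y c] at h₁
      exact (add_left_cancel h₁).symm) b ⟨hi, hj⟩ v c)
  refine ⟨⟨K', ?_⟩, ?_⟩
  · change dTwo ⊤ k K' = 0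
    ext1 v
    refine funext fun c => smoothFunctions_ext_of_cover hcov fun j b hj => ?_
    have e := eq_vec_three v
    rw [e, hM.dTwo_congr (β := dOne ⊤ k (β j)) (by
      filter_upwards [(hW j).mem_nhds hj] with b' hb' v c using hK' j v c b' hb'), dTwo_dOne]
  · refine twoForm_ext fun X Y c => smoothFunctions_ext_of_cover hcov fun j b hj => ?_
    have h₁ := h j b hj X Y c
    change _ = (K ![X, Y] c).1 b - (anchorPullback _ K' ![X, Y] c).1 b
    rw [anchorPullback_apply, hK' j _ c b hj, h₁]
    ring

end TorusAction
end

noncomputable section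

/-! ### The global primitive and the smooth representative -/

namespace TorusAction

open LogForms Set

variable {n k : ℕ} {M : Type*} [TopologicalSpace M] [ChartedSpace (EuclideanSpace ℝ (Fin n)) M]
  [MulAction (Torus k) M]

/-- Local one-forms on `𝒜_I` whose differences are smooth on the quotient are the restrictions of a
global one-form, up to forms which are smooth on the quotient. -/
theorem exists_global_primitive {I : Ideal (smoothFunctions n k M)} {ψ : ℕ → smoothFunctions n k M}
    {η : ℕ → OneForm I k} {α : ℕ → ℕ → OneForm (⊤ : Ideal (smoothFunctions n k M)) k}
    (hα : ∀ i j Y b, α i j (anchor I Y) b = ψ i * (ψ j ^ 2 * η i Y b - ψ i ^ 2 * η j Y b))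
    {W : ℕ → Set (OrbitSpace k M)} (hW : ∀ j, IsOpen (W j)) (hcov : ∀ b, ∃ j, b ∈ W j)
    (hψ : ∀ j, ∀ b ∈ W j, (ψ j).1 b = 1) :
    ∃ (η' : OneForm I k) (β : ℕ → OneForm (⊤ : Ideal (smoothFunctions n k M)) k),
      ∀ j, ∀ b ∈ W j, ∀ Y c, (η j Y c).1 b = (η' Y c).1 b + (β j (anchor I Y) c).1 b := by
  -- The cube is forced by the weights in `hα`: on W_j, where ψ_j = 1, one has ψ_i η_i - α_ij = ψ_i³
  -- η_j. Hence Σ q_i (ψ_i η_i - α_ij) = (Σ q_i ψ_i³) η_j = η_j.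
  let q : ℕ → smoothFunctions n k M := fun i => ∏ m ∈ Finset.range i, (1 - ψ m ^ 3)
  have hq : ∀ {i j b}, b ∈ W i → i < j → evalAt n k M b (q j) = 0 := fun {i j b} hb hij => by
    rw [map_prod]
    refine Finset.prod_eq_zero (Finset.mem_range.mpr hij) ?_
    rw [map_sub, map_one, map_pow, evalAt_apply, hψ i b hb, one_pow, sub_self]
  -- The index j is included. On W_j every later q_i contains the factor 1 - ψ_j³ = 0, so the
  -- partial sums stabilise and define a global form without local finiteness.
  let S : ℕ → OneForm I k := fun j => combination (Finset.range (j + 1)) (fun i => q i * ψ i) η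
  have hS : ∀ j Y c b, (S j Y c).1 b = ∑ i ∈ Finset.range (j + 1),
      evalAt n k M b (q i) * (ψ i).1 b * (η i Y c).1 b := fun j Y c b => by
    rw [← evalAt_apply, combination_apply, map_sum]
    simp only [map_mul, evalAt_apply]
  have hmono : ∀ {i j}, i ≤ j → ∀ Y c, ∀ b ∈ W i, (S i Y c).1 b = (S j Y c).1 b := by
    intro i j hij Y c b hb
    rw [hS, hS]
    refine Finset.sum_subset (Finset.range_mono (by omega)) fun m _ hm => ?_
    rw [Finset.mem_range, not_lt] at hm
    rw [hq hb (by omega), zero_mul, zero_mul]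
  obtain ⟨η', hη'⟩ := exists_glue_oneForm hW hcov S fun i j Y c b hi hj => by
    rcases le_total i j with h | h
    · exact hmono h Y c b hi
    · exact (hmono h Y c b hj).symm
  refine ⟨η', fun j => combination (Finset.range (j + 1)) (fun i => -q i) fun i => α i j,
    fun j b hb Y c => ?_⟩
  rw [hη' j Y c b hb, hS, combination_apply,
    ← evalAt_apply b (∑ i ∈ _, _), map_sum, ← Finset.sum_add_distrib]
  have h₁ := congrArg (evalAt n k M b) (sum_prod_one_sub (fun m => ψ m ^ 3) (j + 1))
  have h₂ := hq hb (Nat.lt_succ_self j)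
  rw [map_sub, h₂, map_one, sub_zero, map_sum] at h₁
  rw [← one_mul ((η j Y c).1 b), ← h₁, Finset.sum_mul]
  refine Finset.sum_congr rfl fun i _ => ?_
  rw [hα]
  simp only [map_mul, map_neg, map_sub, map_pow, evalAt_apply, hψ j b hb]
  ring

variable [T2Space M] [IsManifold (𝓡 n) ∞ M] [SmoothTorusAction n k M]
  {Θ : OneForm (ellipticIdeal n k M) k} {K : TwoForm (boundaryIdeal n k M) k}

/-- The curvature is cohomologous to the pull-back of a closed form on the quotient. -/
theorem IsCurvature.exists_closed_form [SecondCountableTopology M] (hM : IsStandard n k M)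
    (hΘ : IsConnection Θ) (hK : IsCurvature Θ K) :
    ∃ (η : OneForm (boundaryIdeal n k M) k)
      (K' : ClosedTwoForm (⊤ : Ideal (smoothFunctions n k M)) k),
      dOne _ k η = K - anchorPullback (boundaryIdeal n k M) K'.1 := by
  rcases isEmpty_or_nonempty M with hempty | hne
  · exact ⟨0, 0, twoForm_ext fun X Y c => smoothFunctions_ext fun p => hempty.elim p⟩
  choose a l m c C hp hψ using hM.exists_cut
  -- Second countability reduces the cover to a countable one, as the successive products of weights
  -- are indexed by ℕ.
  obtain ⟨s, hs, hsu⟩ := TopologicalSpace.countable_cover_nhds fun p =>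
    interior_mem_nhds.mpr (hψ p)
  have hsne : s.Nonempty := by
    obtain ⟨p⟩ := hne
    obtain ⟨i, hi, -⟩ := mem_iUnion₂.mp (hsu.symm ▸ mem_univ p : p ∈ ⋃ x ∈ s, _)
    exact ⟨i, hi⟩
  obtain ⟨e, rfl⟩ := hs.exists_eq_range hsne
  have hα : ∀ i j, _ := fun i j => (C (e i)).exists_primitive_sub (C (e j)) hM hΘ
  choose α hα using hα
  let W : ℕ → Set (OrbitSpace k M) := fun j => interior {b | (C (e j)).ψ.1 b = 1}
  have hcov : ∀ b, ∃ j, b ∈ W j := by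
    intro b
    obtain ⟨p, rfl⟩ := orbitMap_surjective b
    obtain ⟨i, ⟨j, rfl⟩, h⟩ := mem_iUnion₂.mp (hsu.symm ▸ mem_univ p : p ∈ ⋃ x ∈ range e, _)
    exact ⟨j, mem_interior_iff_mem_nhds.mpr ((eventually_orbitMap (n := n)).mpr
      (mem_interior_iff_mem_nhds.mp h))⟩
  have hψW : ∀ j, ∀ b ∈ W j, (C (e j)).ψ.1 b = 1 := fun j b hb =>
    interior_subset (s := {b | (C (e j)).ψ.1 b = 1}) hb
  obtain ⟨η, β, hβ⟩ := exists_global_primitive hα (fun j => isOpen_interior) hcov hψW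
  obtain ⟨K', hK'⟩ := hM.exists_closed_form (K := K) (fun j => isOpen_interior) hcov η β
    fun j b hb X Y i => by
      obtain ⟨p, rfl⟩ := orbitMap_surjective b
      have hp1 := hψW j _ hb
      have hpc : p ∈ (c (e j)).source := by
        by_contra h
        have h0 := (C (e j)).ψ_eq_zero p fun h' => h ((C (e j)).mem_source ((C (e j)).subset_U h'))
        exact one_ne_zero (hp1.symm.trans h0)
      have hev : ∀ᶠ b in 𝓝 (orbitMap (k := k) p), b ∈ W j := isOpen_interior.mem_nhds hb
      rw [(C (e j)).curvature_eq hM hΘ hK hpc ((eventually_orbitMap (n := n)).mp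
        (hev.mono (hψW j))), hM.dOne_congr (β := addAnchor η (β j)) (by
          filter_upwards [hev] with b hb Y c
          exact hβ j b hb Y c), dOne_addAnchor]
      rfl
  exact ⟨η, K', hK'⟩

end TorusAction
end

noncomputable section

namespace TorusAction

open LogForms Set

variable {n k : ℕ} {M : Type*} [TopologicalSpace M] [ChartedSpace (EuclideanSpace ℝ (Fin n)) M]
  [MulAction (Torus k) M] [T2Space M] [IsManifold (𝓡 n) ∞ M] [SmoothTorusAction n k M]
  {Θ : OneForm (ellipticIdeal n k M) k} {K : TwoForm (boundaryIdeal n k M) k}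

/-! ### Residues -/

namespace StandardChart.Cut

variable {a l m a' m' : ℕ} {c : StandardChart n k M a l m} (C : Cut c)

theorem mem_of_ψ_eq_one {p : M} (h : C.ψ.1 (orbitMap p) = 1) : p ∈ C.U := by
  by_contra hp
  have h0 := C.ψ_eq_zero p fun h' => hp (C.subset_U h')
  exact one_ne_zero (h.symm.trans h0)

theorem frame_apply_eq_zero (hM : IsStandard n k M) {j : Fin l} {p : M} (hp : p ∈ c.source)
    (hz : c.z p j = 0) (f : smoothFunctions n k M) :
    ((C.frame hM (Sum.inl j)).1 f).1 (orbitMap p) = 0 := by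
  change (C.der (dir (Sum.inl j)) f).1 (orbitMap p) = 0
  have h : ∀ s : ℝ, C.flow (dir (Sum.inl j)) (p, s) = p := fun s => by
    rw [C.flow_of_mem _ hp]
    conv_rhs => rw [← c.left_inv p hp]
    simp only [dir, Sum.elim_inl, Pi.zero_apply, mul_zero, add_zero]
    congr 1
    funext i
    by_cases hi : i = j
    · subst hi
      rw [hz, mul_zero]
    · simp [Pi.single_eq_of_ne hi]
  rw [der_apply]
  simp only [h, deriv_const]

variable {p : M} (hψ : ∀ᶠ q in 𝓝 p, C.ψ.1 (orbitMap q) = 1)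
include hψ

theorem eventually_t_eq (j : Fin l) : ∀ᶠ q in 𝓝 p, (C.t j).1 (orbitMap q) = ‖c.z q j‖ ^ 2 := by
  filter_upwards [hψ] with q hq using C.t_eq q (C.mem_of_ψ_eq_one hq) j

/-- The quotient X(t)/t is determined where t is invertible, in particular on the free orbits near
p, and both sides are continuous. -/
theorem radialCoef_eq (hM : IsStandard n k M) {j : Fin l} {t u : smoothFunctions n k M}
    {X : logDer (boundaryIdeal n k M)} (ht : ∀ᶠ q in 𝓝 p, t.1 (orbitMap q) = ‖c.z q j‖ ^ 2)
    (h : ∀ᶠ q in 𝓝 p, (X.1 t).1 (orbitMap q) = u.1 (orbitMap q) * t.1 (orbitMap q)) :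
    (C.radialCoef hM j X).1 (orbitMap p) = u.1 (orbitMap p) := by
  have htt : ∀ᶠ q in 𝓝 p, (C.t j).1 (orbitMap q) = t.1 (orbitMap q) := by
    filter_upwards [C.eventually_t_eq hψ j, ht] with q h₁ h₂ using h₁.trans h₂.symm
  have hall := (hψ.and (ht.and h)).and htt.eventually_nhds
  obtain ⟨O, hO, hOo, hpO⟩ := eventually_nhds_iff.mp hall
  refine hM.eqOn_of_isFree (f := fun p => (C.radialCoef hM j X).1 (orbitMap p))
    (g := fun p => u.1 (orbitMap p)) hOo (C.radialCoef hM j X).2.continuous.continuousOn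
    u.2.continuous.continuousOn (fun q hq hfree => ?_) p hpO
  obtain ⟨⟨h₁, h₂, h₃⟩, h₄⟩ := hO q hq
  have hs := C.mem_source (C.mem_of_ψ_eq_one h₁)
  have h₅ := C.radialCoef_mul hM j X hs
  rw [h₁, one_mul, hM.derivation_congr X.1 h₄, h₃, h₂, mul_comm (u.1 _)] at h₅
  exact mul_left_cancel₀ (pow_ne_zero 2 (norm_ne_zero_iff.mpr ((c.isFree_iff hs).mp hfree j))) h₅

theorem eventually_apply_t (hM : IsStandard n k M) (j : Fin l) (X : logDer (boundaryIdeal n k M)) :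
    ∀ᶠ q in 𝓝 p, (X.1 (C.t j)).1 (orbitMap q) =
      (C.radialCoef hM j X * C.t j).1 (orbitMap q) := by
  filter_upwards [hψ] with q hq
  have hU := C.mem_of_ψ_eq_one hq
  have h := C.radialCoef_mul hM j X (C.mem_source hU)
  rw [hq, one_mul] at h
  rw [← h, ← C.t_eq q hU]
  exact mul_comm _ _

/-- If X(t) = u t and Y(t) = v t near p, the products uv cancel in the commutator and [X, Y](t) =
(X(v) - Y(u)) t. -/
theorem radialCoef_bracket (hM : IsStandard n k M) (j : Fin l)
    (X Y : logDer (boundaryIdeal n k M)) :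
    (C.radialCoef hM j (bracket X Y)).1 (orbitMap p) =
      (X.1 (C.radialCoef hM j Y)).1 (orbitMap p) - (Y.1 (C.radialCoef hM j X)).1 (orbitMap p) := by
  refine C.radialCoef_eq hψ hM (u := X.1 (C.radialCoef hM j Y) - Y.1 (C.radialCoef hM j X))
    (C.eventually_t_eq hψ j) ?_
  filter_upwards [(C.eventually_apply_t hψ hM j X).eventually_nhds,
    (C.eventually_apply_t hψ hM j Y).eventually_nhds] with q hX hY
  rw [bracket_apply]
  change (X.1 (Y.1 _)).1 _ - (Y.1 (X.1 _)).1 _ =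
    ((X.1 _).1 (orbitMap q) - (Y.1 _).1 (orbitMap q)) * _
  rw [hM.derivation_congr X.1 hY, hM.derivation_congr Y.1 hX, Derivation.leibniz,
    Derivation.leibniz]
  have h₁ := hX.self_of_nhds
  have h₂ := hY.self_of_nhds
  change (_ : ℝ) = (C.radialCoef hM j X).1 _ * (C.t j).1 _ at h₁
  change (_ : ℝ) = (C.radialCoef hM j Y).1 _ * (C.t j).1 _ at h₂
  change (C.radialCoef hM j Y).1 _ * (X.1 (C.t j)).1 _ + (C.t j).1 _ * (X.1 _).1 _ -
    ((C.radialCoef hM j X).1 _ * (Y.1 (C.t j)).1 _ + (C.t j).1 _ * (Y.1 _).1 _) = _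
  rw [h₁, h₂]
  ring

/-- Because E vanishes at p, every term of the bracket differentiated by E disappears there, and
only minus the Y-derivative of the coefficient of E is left. -/
theorem coef_bracket (hM : IsStandard n k M) (i : Fin l ⊕ Fin m)
    {E Y : logDer (boundaryIdeal n k M)} (hE : ∀ f, (E.1 f).1 (orbitMap p) = 0) :
    (C.coef hM i (bracket E Y)).1 (orbitMap p) = -(Y.1 (C.coef hM i E)).1 (orbitMap p) := by
  rcases i with j | i
  · rw [coef_inl, C.radialCoef_bracket hψ, hE, zero_sub]
    rfl
  · rw [coef_inr, coef_inr, bracket_apply, Derivation.leibniz]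
    change C.ψ.1 _ * ((E.1 (Y.1 _)).1 _ - (Y.1 (E.1 _)).1 _) =
      -(C.ψ.1 _ * (Y.1 (E.1 _)).1 _ + (E.1 _).1 _ * (Y.1 C.ψ).1 _)
    rw [hE, hE]
    ring

/-- The curvature on a section which vanishes at the given point. -/
theorem curvature_apply (hM : IsStandard n k M) (hΘ : IsConnection Θ) (hK : IsCurvature Θ K)
    {E Y : logDer (boundaryIdeal n k M)} (hE : ∀ f, (E.1 f).1 (orbitMap p) = 0) (b : Fin k) :
    (K ![E, Y] b).1 (orbitMap p) = -∑ i, (C.coef hM i E).1 (orbitMap p) *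
      (Y.1 (C.conn hM hΘ i b)).1 (orbitMap p) := by
  have hp := C.mem_source (C.mem_of_ψ_eq_one hψ.self_of_nhds)
  rw [C.curvature_eq hM hΘ hK hp hψ, dOne_apply]
  change (E.1 _).1 _ - (Y.1 _).1 _ - (C.primitive hM hΘ _ _).1 _ = _
  -- In dη(E, Y) = E(η(Y)) - Y(η(E)) - η([E, Y]) the first term is zero at p, and the bracket term
  -- cancels the derivatives of the coefficients of E arising from the second.
  have h₁ : (C.primitive hM hΘ (bracket E Y) b).1 (orbitMap p) = -∑ i,
      (Y.1 (C.coef hM i E)).1 (orbitMap p) * (C.conn hM hΘ i b).1 (orbitMap p) := by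
    rw [primitive_apply, ← evalAt_apply, map_sum, ← Finset.sum_neg_distrib]
    refine Finset.sum_congr rfl fun i _ => ?_
    rw [map_mul, evalAt_apply, C.coef_bracket hψ hM i hE, neg_mul]
    rfl
  have h₂ : (Y.1 (C.primitive hM hΘ E b)).1 (orbitMap p) = ∑ i,
      ((C.coef hM i E).1 (orbitMap p) * (Y.1 (C.conn hM hΘ i b)).1 (orbitMap p) +
        (Y.1 (C.coef hM i E)).1 (orbitMap p) * (C.conn hM hΘ i b).1 (orbitMap p)) := by
    rw [primitive_apply, map_sum, ← evalAt_apply, map_sum]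
    refine Finset.sum_congr rfl fun i _ => ?_
    rw [Derivation.leibniz]
    change (C.coef hM i E).1 _ * (Y.1 (C.conn hM hΘ i b)).1 _ +
      (C.conn hM hΘ i b).1 _ * (Y.1 (C.coef hM i E)).1 _ = _
    rw [mul_comm ((C.conn hM hΘ i b).1 _)]
  rw [hE, h₁, h₂, Finset.sum_add_distrib]
  ring

end StandardChart.Cut

/-- The second residue of the curvature vanishes. -/
theorem IsCurvature.residueTwoVanishes (hM : IsStandard n k M) (hΘ : IsConnection Θ)
    (hK : IsCurvature Θ K) : ResidueTwoVanishes K := by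
  rintro _ - t ⟨a, m, c, p, hp, rfl, -, -⟩ E₁ E₂ h₁ h₂ i
  obtain ⟨C, -, hψ⟩ := c.exists_cut isOpen_univ (fun _ _ _ => mem_univ _) hp (mem_univ _)
  -- After this rewriting every summand contains a derivative along E₂, which vanishes at the point.
  rw [C.curvature_apply hψ hM hΘ hK h₁.1, neg_eq_zero]
  exact Finset.sum_eq_zero fun j _ => by rw [h₂.1, mul_zero]

/-- The functions `F` are, near `b`, the values of the connection on the lift of `t ∂_t`. -/
def IsRadialValue (hM : IsStandard n k M) (hΘ : IsConnection Θ) (b : OrbitSpace k M)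
    (F : Fin k → smoothFunctions n k M) : Prop :=
  ∃ (a m : ℕ) (c : StandardChart n k M a 1 m) (C : StandardChart.Cut c) (p : M), p ∈ c.source ∧
    orbitMap p = b ∧ c.z p = 0 ∧ (∀ᶠ q in 𝓝 p, C.ψ.1 (orbitMap q) = 1) ∧
      F = C.conn hM hΘ (Sum.inl 0)

namespace StandardChart.Cut

variable {a m a' m' : ℕ} {c : StandardChart n k M a 1 m} {c' : StandardChart n k M a' 1 m'}
  (C : Cut c) (C' : Cut c') {p : M} (hp : p ∈ c.source) (hp' : p ∈ c'.source) (hz : c.z p = 0)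
  (hψ : ∀ᶠ q in 𝓝 p, C.ψ.1 (orbitMap q) = 1)
  (hψ' : ∀ᶠ q in 𝓝 p, C'.ψ.1 (orbitMap q) = 1)

-- The value of t ∂_t on ∂B[1] is intrinsic. With t' = tG and t = t'H, the radial field X of the
-- first chart satisfies X(t') = (1 + H X(G)) t', and X(G) is zero at p because X vanishes there.
include hp hp' hz hψ hψ' in
theorem radialCoef_frame (hM : IsStandard n k M) :
    (C'.radialCoef hM 0 (C.frame hM (Sum.inl 0))).1 (orbitMap p) = 1 := by
  obtain ⟨G, hG⟩ := exists_quot_coordinate (j := (0 : Fin 1)) c hM hp'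
    (fun i _ => Subsingleton.elim _ _) hp 0
  obtain ⟨H, hH⟩ := exists_quot_coordinate (j := (0 : Fin 1)) c' hM hp
    (fun i _ => Subsingleton.elim _ _) hp' 0
  set X := C.frame hM (Sum.inl 0) with hX
  have h := C'.radialCoef_eq hψ' hM (X := X) (u := 1 + H * X.1 G)
    (C'.eventually_t_eq hψ' 0) (by
      have hG' : ∀ᶠ q in 𝓝 p, (C'.t 0).1 (orbitMap q) = (C.t 0 * G).1 (orbitMap q) := by
        filter_upwards [hG, C.eventually_t_eq hψ 0, C'.eventually_t_eq hψ' 0] with q h₁ h₂ h₃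
        change _ = (C.t 0).1 _ * _
        rw [h₂, h₃, h₁]
      filter_upwards [hG'.eventually_nhds, hψ, hH, C.eventually_t_eq hψ 0,
        C'.eventually_t_eq hψ' 0] with q h₁ h₂ h₃ h₄ h₅
      rw [hM.derivation_congr X.1 h₁, Derivation.leibniz]
      have h₆ := C.der_t (dir (Sum.inl 0)) (C.mem_of_ψ_eq_one h₂) 0
      have h₇ := h₁.self_of_nhds
      change _ = (C.t 0).1 _ * G.1 _ at h₇
      change (C.t 0).1 _ * (X.1 G).1 _ + G.1 _ * (C.der (dir (Sum.inl 0)) (C.t 0)).1 _ =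
        (1 + H.1 _ * (X.1 G).1 _) * _
      rw [h₆, h₂, ← h₄]
      simp only [dir, Sum.elim_inl, Pi.single_eq_same]
      rw [← h₄, ← h₅] at h₃
      linear_combination (X.1 G).1 (orbitMap q) * h₃ - h₇)
  rw [h]
  change 1 + H.1 _ * (X.1 G).1 _ = 1
  rw [hX, C.frame_apply_eq_zero hM hp (congrFun hz 0), mul_zero, add_zero]

-- By `residue_eq` the first value is that of the second primitive on the first radial frame field.
-- At p this field has second radial coefficient one and no other coefficients. The residues of the
-- primitives thus form one well-defined function on ∂B[1].
include hp hp' hz hψ hψ' in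
theorem conn_eq (hM : IsStandard n k M) (hΘ : IsConnection Θ) (b : Fin k) :
    (C.conn hM hΘ (Sum.inl 0) b).1 (orbitMap p) =
      (C'.conn hM hΘ (Sum.inl 0) b).1 (orbitMap p) := by
  have h := C.residue_eq C' hM hΘ 0 hp (congrFun hz 0) b
  rw [hψ'.self_of_nhds, one_pow, one_mul] at h
  refine h.trans ?_
  rw [← evalAt_apply, primitive_apply, Fintype.sum_sum_type, map_add, map_sum, map_sum,
    Finset.sum_eq_zero (s := (Finset.univ : Finset (Fin m'))) fun i _ => ?_, add_zero,
    Fin.sum_univ_one, map_mul, coef_inl, evalAt_apply,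
    C.radialCoef_frame C' hp hp' hz hψ hψ' hM, one_mul]
  · rfl
  · rw [map_mul, evalAt_apply, coef_inr]
    change C'.ψ.1 _ * ((C.frame hM (Sum.inl 0)).1 _).1 _ * _ = 0
    rw [C.frame_apply_eq_zero hM hp (congrFun hz 0), mul_zero, zero_mul]

end StandardChart.Cut

variable {hM : IsStandard n k M} {hΘ : IsConnection Θ} {b : OrbitSpace k M}
  {F F' : Fin k → smoothFunctions n k M}

theorem IsRadialValue.eq (h : IsRadialValue hM hΘ b F) (h' : IsRadialValue hM hΘ b F') (i : Fin k) :
    (F i).1 b = (F' i).1 b := by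
  obtain ⟨a, m, c, C, p, hp, rfl, hz, hψ, rfl⟩ := h
  obtain ⟨a', m', c', C', p', hp', hpp, -, hψ', rfl⟩ := h'
  obtain ⟨g, rfl⟩ := orbitMap_eq_iff.mp hpp
  have hp₁ := (c'.smul_mem_iff g).mp hp'
  refine C.conn_eq C' hp hp₁ hz hψ ?_ hM hΘ i
  have h := (eventually_orbitMap (n := n) (P := fun b => C'.ψ.1 b = 1)).mpr hψ'
  rw [orbitMap_smul] at h
  exact (eventually_orbitMap (n := n)).mp h

/-- In a chart with a single complex coordinate the nearby points of ∂B[1] are those with z = 0, so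
the same chart and cutoff serve for them. -/
theorem IsRadialValue.eventually (h : IsRadialValue hM hΘ b F) :
    ∀ᶠ b' in 𝓝 b, b' ∈ stratum n k M 1 → IsRadialValue hM hΘ b' F := by
  obtain ⟨a, m, c, C, p, hp, rfl, hz, hψ, rfl⟩ := h
  rw [eventually_orbitMap (n := n)]
  filter_upwards [hψ.eventually_nhds] with q hq hb
  have hqs := C.mem_source (C.mem_of_ψ_eq_one hq.self_of_nhds)
  have hbd : orbitMap q ∈ boundary n k M := mem_iUnion₂.mpr ⟨1, le_rfl, hb⟩
  obtain ⟨j, hj⟩ := (c.mem_boundary_iff hM hqs).mp hbd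
  refine ⟨a, m, c, C, q, hqs, rfl, funext fun i => ?_, hq, rfl⟩
  rw [Subsingleton.elim i j]
  exact hj

theorem exists_isRadialValue (hM : IsStandard n k M) (hΘ : IsConnection Θ)
    (hb : b ∈ stratum n k M 1) : ∃ F, IsRadialValue hM hΘ b F := by
  obtain ⟨a, m, c, p, hp, rfl, hz⟩ := hb
  obtain ⟨C, -, hψ⟩ := c.exists_cut isOpen_univ (fun _ _ _ => mem_univ _) hp (mem_univ _)
  exact ⟨_, a, m, c, C, p, hp, rfl, hz, hψ, rfl⟩

/-- A log generator has radial coefficient one at b, and its other coefficients vanish there, so a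
single term of the local curvature formula survives. -/
theorem IsRadialValue.curvature_apply (hK : IsCurvature Θ K) (h : IsRadialValue hM hΘ b F)
    {t : Fin 1 → smoothFunctions n k M} (ht : IsBoundaryCoordinates b t)
    {E Y : logDer (boundaryIdeal n k M)} (hE : IsLogGenerator b t 0 E) (i : Fin k) :
    ∃ F', IsRadialValue hM hΘ b F' ∧ (K ![E, Y] i).1 b = -(Y.1 (F' i)).1 b := by
  obtain ⟨a, m, c, p, hp, rfl, hz, ht⟩ := ht
  obtain ⟨C, -, hψ⟩ := c.exists_cut isOpen_univ (fun _ _ _ => mem_univ _) hp (mem_univ _)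
  refine ⟨_, ⟨a, m, c, C, p, hp, rfl, hz, hψ, rfl⟩, ?_⟩
  obtain ⟨u, hu, hu1⟩ := hE.2 0
  rw [C.curvature_apply hψ hM hΘ hK hE.1, Fintype.sum_sum_type, Fin.sum_univ_one,
    Finset.sum_eq_zero (s := (Finset.univ : Finset (Fin m))) fun i _ => ?_, add_zero,
    StandardChart.Cut.coef_inl, C.radialCoef_eq hψ hM (ht 0)
      ((eventually_orbitMap (n := n)).mp hu), hu1, if_pos rfl, one_mul]
  rw [StandardChart.Cut.coef_inr]
  change C.ψ.1 _ * (E.1 _).1 _ * _ = 0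
  rw [hE.1, mul_zero, zero_mul]

/-- Derivations of the functions on a stratum are local. -/
theorem IsStandard.stratum_derivation_congr (hM : IsStandard n k M)
    (D : Derivation ℝ (stratumFunctions n k M) (stratumFunctions n k M)) {b : stratum n k M 1}
    {f g : stratumFunctions n k M} (h : ∀ᶠ b' in 𝓝 b, f.1 b' = g.1 b') :
    (D f).1 b = (D g).1 b := by
  rw [nhds_subtype_eq_comap, Filter.eventually_comap] at h
  obtain ⟨O, hO, hOo, hbO⟩ := eventually_nhds_iff.mp h
  obtain ⟨p, hp⟩ := orbitMap_surjective b.1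
  obtain ⟨ψ, h1, h0⟩ := hM.exists_bump (hOo.preimage continuous_orbitMap)
    (fun g q hq => by rwa [mem_preimage, orbitMap_smul]) (p := p) (by rwa [mem_preimage, hp])
  have h₁ := derivation_apply_eq_zero (φ := (stratumFunctions n k M).val) (D := D) (p := b)
    (χ := restrictToStratum ψ) (f := f - g)
    (by rw [← h1.self_of_nhds, hp]; rfl) (sub_eq_zero.mpr (hO b hbO b rfl)) (by
      refine Subtype.ext (funext fun b' => ?_)
      change ψ.1 b' * (f.1 b' - g.1 b') = 0
      by_cases hb' : b'.1 ∈ O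
      · rw [hO b' hb' b' rfl, sub_self, mul_zero]
      · obtain ⟨q, hq⟩ := orbitMap_surjective b'.1
        rw [← hq, h0 q (by rwa [mem_preimage, hq]), zero_mul])
  rw [map_sub] at h₁
  exact sub_eq_zero.mp h₁

/-- The first residue of the curvature is exact. -/
theorem IsCurvature.residueOneExact (hM : IsStandard n k M) (hΘ : IsConnection Θ)
    (hK : IsCurvature Θ K) : ResidueOneExact K := by
  choose F hF using fun b : stratum n k M 1 => exists_isRadialValue hM hΘ b.2
  have hloc : ∀ (b : stratum n k M 1) F', IsRadialValue hM hΘ b.1 F' → ∀ i,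
      ∀ᶠ b' in 𝓝 b, -(F b' i).1 b'.1 = (-F' i).1 b'.1 := by
    intro b F' h i
    filter_upwards [continuous_subtype_val.continuousAt.eventually h.eventually] with b' hb'
    exact congrArg Neg.neg ((hF b').eq (hb' b'.2) i)
  -- The primitive is minus the value of Θ on the lift of t ∂_t; the sign is that of K(E, Y) =
  -- -Y(F'). The choice of F depends on b, but near each point all choices agree with one smooth
  -- function.
  refine ⟨fun i => ⟨fun b => -(F b i).1 b.1, fun b => ⟨-F b i, hloc b (F b) (hF b) i⟩⟩, ?_⟩
  intro b t ht E hE Y W hW i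
  obtain ⟨F', hF', h⟩ := (hF b).curvature_apply hK ht hE (Y := Y) i
  rw [h]
  refine (hM.stratum_derivation_congr W.1 (g := restrictToStratum (-F' i))
    (hloc b F' hF' i)).trans ?_
  rw [hW, map_neg]
  rfl

end TorusAction
end

open LogForms TorusAction in
theorem mainTheorem9 {n k : ℕ} {M : Type*} [TopologicalSpace M] [T2Space M]
    [SecondCountableTopology M] [ChartedSpace (EuclideanSpace ℝ (Fin n)) M]
    [IsManifold (𝓡 n) ∞ M] [MulAction (Torus k) M] [SmoothTorusAction n k M]
    (hM : IsStandard n k M)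
    (Θ : OneForm (ellipticIdeal n k M) k) (hΘ : IsConnection Θ)
    (K : TwoForm (boundaryIdeal n k M) k) (hK : IsCurvature Θ K) :
    (∃ (hcl : K ∈ ClosedTwoForm (boundaryIdeal n k M) k)
        (K' : ClosedTwoForm (⊤ : Ideal (smoothFunctions n k M)) k),
      cohomologyClass ⟨anchorPullback (boundaryIdeal n k M) K'.1, anchorPullback_closed _ K'⟩ =
        cohomologyClass ⟨K, hcl⟩) ∧
    ResidueOneExact K ∧ ResidueTwoVanishes K := by
  obtain ⟨η, K', h⟩ := hK.exists_closed_form hM hΘ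
  exact ⟨⟨hK.closed hM, K', ((cohomologyClass_eq_iff _ _).mpr ⟨η, h⟩).symm⟩,
    hK.residueOneExact hM hΘ, hK.residueTwoVanishes hM hΘ⟩
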